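/- Let $p$ be a prime, let $\mathcal F$ be a saturated fusion system over a finite $p$-group $S$, and let $\mathcal R$ be a commutative ring with unit. A subgroup $H\le S$ is $\mathcal F$-centric if $C_S(K)\le K$ for every $K\le S$ that is isomorphic to $H$ in $\mathcal F$; write $H\in\mathcal F^c$. Let $\mathcal O(\mathcal F^c)$ be the category with objects the $\mathcal F$-centric subgroups and $\operatorname{Hom}(H,K)=\operatorname{Inn}(K)\backslash\operatorname{Hom}_{\mathcal F}(H,K)$, and let $\mathcal O(\mathcal F^c)_\sqcup$ be the category of formal finite coproducts of its objects. For $H,K\in\mathcal F^c$ consider the pairs $(A,\overline\varphi)$ with $A\le H$ $\mathcal F$-centric and $\overline\varphi\in\operatorname{Hom}_{\mathcal O(\mathcal F^c)}(A,K)$, preordered by $(A,\overline\varphi)\precsim(B,\overline\psi)$ if there is $h\in H$ with $A^h\le B$ and $\overline\varphi\,\overline{c_h}=\overline\psi\,\overline{\iota_{A^h}^B}$, where $A^h=h^{-1}Ah$ and $c_h\colon A^h\to A$, $x\mapsto hxh^{-1}$. Let $[H\times K]$ be a set of representatives of the maximal pairs up to the equivalence relation "$\precsim$ and $\succsim$".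 The Mackey algebra $\mu_{\mathcal R}(\mathcal F)$ is $\mathcal R\otimes_{\mathbb Z}-$ applied to the Grothendieck ring of the semiring (under disjoint union and composition $X\times_J Y$, with product zero when the middle groups differ) generated by the isomorphism classes of the bisets $R_H^K=(H\times K)/\Delta(H,\mathrm{Id})$, $I_H^K=(K\times H)/\Delta(H,\mathrm{Id})$ and $c_\varphi=(\varphi(H)\times H)/\Delta(H,\varphi)$, for $H\le K\le S$ and $\varphi\colon H\to\varphi(H)$ an isomorphism in $\mathcal F$, where $\Delta(H,\varphi)=\{(\varphi(x),x):x\in H\}$. Let $\mathcal I$ be the two-sided ideal generated by the $I_K^K$ with $K\le S$ not $\mathcal F$-centric. For $H\in\mathcal F^c$ let $\mu_{\mathcal R}(\mathcal F_H(H))\subseteq\mu_{\mathcal R}(\mathcal F)$ be the (non-unital) subalgebra generated by the $R_A^B,I_A^B$ with $A\le B\le H$ and the conjugations $c_{c_h}$, $h\in H$, between subgroups of $H$; its identity is $1_H=\sum_{K\le H}I_K^K$. For a $\mu_{\mathcal R}(\mathcal F)$-module $M$ with $I_K^KM=0$ for all non-$\mathcal F$-centric $K$ put $$M_H=\mu_{\mathcal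 R}(\mathcal F)1_H\otimes_{\mu_{\mathcal R}(\mathcal F_H(H))}1_HM,$$ $$\theta_H^M\colon M_H\to M,\quad y\otimes x\mapsto yx,$$ $$\theta_M^H\colon M\to M_H,\quad z\mapsto\sum_{(A,\overline\varphi)\in[H\times K]}I_{\varphi(A)}^Kc_{\varphi}\otimes c_{\varphi^{-1}}R_{\varphi(A)}^Kz\qquad(K\in\mathcal F^c,\ z\in I_K^KM),$$ with $\theta_M^H$ extended additively and $\varphi$ any representative of $\overline\varphi$, viewed as an isomorphism onto its image. The category $\mathcal O(\mathcal F^c)_\sqcup$ has binary products. The centric Burnside ring $B(\mathcal F^c;\mathcal R)$ is $\mathcal R\otimes_{\mathbb Z}-$ applied to the Grothendieck group of the isomorphism classes of objects of $\mathcal O(\mathcal F^c)_\sqcup$ under coproduct, with multiplication $[X][Y]=[X\times Y]$ induced by these products (an identity element is not assumed to exist). Then the following hold. 1. There is a (not necessarily unit-preserving) homomorphism of $\mathcal R$-algebras $$\overline\Gamma\colon B(\mathcal F^c;\mathcal R)\to Z\big(\mu_{\mathcal R}(\mathcal F)/\mathcal I\big),\qquad \overline\Gamma([H])=\theta_H\big(\theta^H(1)\big)\quad(H\in\mathcal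 F^c),$$ where $\theta_H,\theta^H$ are taken for the module $M=\mu_{\mathcal R}(\mathcal F)/\mathcal I$. If $B(\mathcal F^c;\mathcal R)$ contains an element that is not a zero divisor, then $\overline\Gamma$ is injective. If $\mathcal R$ is $p$-local (every prime other than $p$ is invertible in $\mathcal R$), then $B(\mathcal F^c;\mathcal R)$ has an identity element and $\overline\Gamma$ maps it to $1$. 2. Suppose that $\mathcal R$ is $p$-local. Let $\mathcal G$ be a saturated fusion system over a finite $p$-group $T\ge S$ that contains $\mathcal F$, and let $M$ be a $\mathcal G$-centric Mackey functor over $\mathcal F$ on $\mathcal R$, that is, a finitely generated left $\mu_{\mathcal R}(\mathcal F)$-module with $I_K^KM=0$ for every $K\le S$ that is not $\mathcal G$-centric. Then the ring $B(\mathcal F^c;\mathcal R)$ acts on $M$ (by an $\mathcal R$-algebra homomorphism $B(\mathcal F^c;\mathcal R)\to\operatorname{End}_{\mu_{\mathcal R}(\mathcal F)}(M)$ that maps the identity element to $\operatorname{Id}_M$) so that $[H]$ acts as $\theta_H^M\theta_M^H$ for every $H\in\mathcal F^c$. -/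

import Mathlib

open CategoryTheory

universe u v w x y

namespace CentricMackey

noncomputable section

/-! ### Grothendieck rings -/

/-- The Grothendieck group of a commutative additive monoid. When the monoid carries a
distributive multiplication, so does its Grothendieck group. -/
def GrothendieckRing (A : Type u) [AddCommMonoid A] : Type u := Algebra.GrothendieckAddGroup A

namespace GrothendieckRing

instance (A : Type u) [AddCommMonoid A] : AddCommGroup (GrothendieckRing A) :=
  inferInstanceAs (AddCommGroup (Algebra.GrothendieckAddGroup A))

/-- The class of an element of the monoid in the Grothendieck group. -/
def of {A : Type u} [AddCommMonoid A] : A →+ GrothendieckRing A :=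
  Algebra.GrothendieckAddGroup.of

/-- The universal property of the Grothendieck group. -/
def lift {A : Type u} [AddCommMonoid A] {B : Type v} [AddCommGroup B] (f : A →+ B) :
    GrothendieckRing A →+ B :=
  Algebra.GrothendieckAddGroup.lift f

theorem lift_of {A : Type u} [AddCommMonoid A] {B : Type v} [AddCommGroup B] (f : A →+ B)
    (a : A) : lift f (of a) = f a :=
  DFunLike.congr_fun (Algebra.GrothendieckAddGroup.lift.symm_apply_apply f) a

theorem hom_ext {A : Type u} [AddCommMonoid A] {B : Type v} [AddCommGroup B]
    {f g : GrothendieckRing A →+ B} (h : ∀ a, f (of a) = g (of a)) : f = g :=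
  Algebra.GrothendieckAddGroup.lift.symm.injective (AddMonoidHom.ext h)

/-- The biadditive extension of the multiplication of a semiring to its Grothendieck group. -/
def mulHom (A : Type u) [NonUnitalNonAssocSemiring A] :
    GrothendieckRing A →+ GrothendieckRing A →+ GrothendieckRing A :=
  lift
    { toFun := fun a => lift (of.comp (AddMonoidHom.mulLeft a))
      map_zero' := hom_ext fun b => by simp [lift_of]
      map_add' := fun a a' => hom_ext fun b => by simp [lift_of, add_mul] }

theorem mulHom_of {A : Type u} [NonUnitalNonAssocSemiring A] (a b : A) :
    mulHom A (of a) (of b) = of (a * b) := by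
  rw [mulHom, lift_of]
  exact lift_of _ _

instance (A : Type u) [NonUnitalNonAssocSemiring A] :
    NonUnitalNonAssocRing (GrothendieckRing A) :=
  { (inferInstance : AddCommGroup (GrothendieckRing A)) with
    mul := fun a b => mulHom A a b
    left_distrib := fun a b c => map_add (mulHom A a) b c
    right_distrib := fun a b c => DFunLike.congr_fun (map_add (mulHom A) a b) c
    zero_mul := fun a => DFunLike.congr_fun (map_zero (mulHom A)) a
    mul_zero := fun a => map_zero (mulHom A a) }

theorem of_mul {A : Type u} [NonUnitalNonAssocSemiring A] (a b : A) :
    of (a * b) = of a * of b := (mulHom_of a b).symm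

theorem ind {A : Type u} [AddCommMonoid A] {P : GrothendieckRing A → Prop}
    (h : ∀ a b : A, P (of a - of b)) (x : GrothendieckRing A) : P x := by
  induction x using AddLocalization.ind with
  | H y =>
    have key : AddLocalization.mk y.1 y.2 =
        (AddLocalization.mk y.1 0 - AddLocalization.mk y.2.1 0 :
          Algebra.GrothendieckAddGroup A) := by
      rw [Algebra.GrothendieckAddGroup.mk_sub_mk]
      simp
    exact key ▸ h y.1 y.2

instance (A : Type u) [Semiring A] : Ring (GrothendieckRing A) :=
  { (inferInstance : NonUnitalNonAssocRing (GrothendieckRing A)) with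
    one := of 1
    one_mul := fun a => by
      change of 1 * a = a
      induction a using ind with
      | h a b => rw [mul_sub, ← of_mul, ← of_mul, one_mul, one_mul]
    mul_one := fun a => by
      change a * of 1 = a
      induction a using ind with
      | h a b => rw [sub_mul, ← of_mul, ← of_mul, mul_one, mul_one]
    mul_assoc := fun a b c => by
      induction a using ind with
      | h a a' =>
      induction b using ind with
      | h b b' =>
      induction c using ind with
      | h c c' => simp only [mul_sub, sub_mul, ← of_mul, mul_assoc] }

end GrothendieckRing

open scoped TensorProduct

/-- The base change `R ⊗ A` to `R` of the Grothendieck ring of a semiring `A`. -/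
def GrothendieckAlgebra (R : Type v) [CommRing R] (A : Type u) [NonUnitalNonAssocSemiring A] :
    Type (max v u) := R ⊗[ℤ] GrothendieckRing A

namespace GrothendieckAlgebra

variable (R : Type v) [CommRing R]

instance (priority := low) (A : Type u) [NonUnitalNonAssocSemiring A] :
    NonUnitalNonAssocRing (GrothendieckAlgebra R A) :=
  inferInstanceAs (NonUnitalNonAssocRing (R ⊗[ℤ] GrothendieckRing A))

instance (priority := low) (A : Type u) [NonUnitalNonAssocSemiring A] :
    Module R (GrothendieckAlgebra R A) :=
  inferInstanceAs (Module R (R ⊗[ℤ] GrothendieckRing A))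

instance (A : Type u) [Semiring A] : Ring (GrothendieckAlgebra R A) :=
  inferInstanceAs (Ring (R ⊗[ℤ] GrothendieckRing A))

instance (A : Type u) [Semiring A] : Algebra R (GrothendieckAlgebra R A) :=
  inferInstanceAs (Algebra R (R ⊗[ℤ] GrothendieckRing A))

/-- The class `1 ⊗ a` of an element of the semiring. -/
def of {A : Type u} [NonUnitalNonAssocSemiring A] (a : A) : GrothendieckAlgebra R A :=
  (1 : R) ⊗ₜ[ℤ] GrothendieckRing.of a

end GrothendieckAlgebra

/-! ### Restriction followed by induction for modules over noncommutative rings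

In this section `A` is a ring and `B ⊆ A` is a subset which is closed under the ring operations
and contains an idempotent `e` that is an identity element for `B`. -/

section ResInd

variable {A : Type u} [Ring A] (B : Set A) (e : A)

/-- The restriction `e M` of an `A`-module `M` to `B`. -/
def restriction (M : Type w) [AddCommGroup M] [Module A M] : AddSubgroup M :=
  (DistribSMul.toAddMonoidHom M e).range

/-- The left ideal `A e`. -/
def leftIdeal : Ideal A := Ideal.span {e}

variable (M : Type w) [AddCommGroup M] [Module A M]

/-- The `A`-submodule of `A e ⊗_ℤ e M` given by the relations `x b ⊗ m = x ⊗ b m` for `b ∈ B`. -/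
def balanced : Submodule A (leftIdeal e ⊗[ℤ] restriction e M) :=
  Submodule.span A {t | ∃ b ∈ B, ∃ (x x' : leftIdeal e) (m m' : restriction e M),
    (x' : A) = x * b ∧ (m' : M) = b • (m : M) ∧ t = x' ⊗ₜ[ℤ] m - x ⊗ₜ[ℤ] m'}

/-- The `A`-module `A e ⊗_B e M`: the restriction of `M` to `B`, induced to `A`. -/
def ResInd : Type (max u w) := (leftIdeal e ⊗[ℤ] restriction e M) ⧸ balanced B e M

namespace ResInd

instance : AddCommGroup (ResInd B e M) :=
  inferInstanceAs (AddCommGroup ((leftIdeal e ⊗[ℤ] restriction e M) ⧸ balanced B e M))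

instance : Module A (ResInd B e M) :=
  inferInstanceAs (Module A ((leftIdeal e ⊗[ℤ] restriction e M) ⧸ balanced B e M))

variable {M}

/-- The element `y e ⊗ e z` of `A e ⊗_B e M`. If `y = y e` and `z = e z`, this is `y ⊗ z`. -/
def tmul (y : A) (z : M) : ResInd B e M :=
  Submodule.Quotient.mk
    ((⟨y * e, Ideal.mul_mem_left _ _ (Ideal.subset_span rfl)⟩ : leftIdeal e) ⊗ₜ[ℤ]
    (⟨e • z, ⟨z, rfl⟩⟩ : restriction e M))

/-- The additive map `z ↦ y e ⊗ e z`. -/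
def tmulHom (y : A) : M →+ ResInd B e M where
  toFun := tmul B e y
  map_zero' := by
    have : (⟨e • (0 : M), ⟨0, rfl⟩⟩ : restriction e M) = 0 := Subtype.ext (smul_zero _)
    rw [tmul, this, TensorProduct.tmul_zero]
    rfl
  map_add' z z' := by
    have : (⟨e • (z + z'), ⟨z + z', rfl⟩⟩ : restriction e M) =
        ⟨e • z, ⟨z, rfl⟩⟩ + ⟨e • z', ⟨z', rfl⟩⟩ := Subtype.ext (smul_add _ _ _)
    rw [tmul, this, TensorProduct.tmul_add]
    rfl

variable (M)

/-- The `A`-linear map `A e ⊗_B e M → M`, `y ⊗ x ↦ y x`. -/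
def eval : ResInd B e M →ₗ[A] M :=
  Submodule.liftQ (balanced B e M)
    (TensorProduct.AlgebraTensorModule.lift
      { toFun := fun y =>
          (((DistribSMul.toAddMonoidHom M (y : A)).comp
            (restriction e M).subtype).toIntLinearMap : restriction e M →ₗ[ℤ] M)
        map_add' := fun y y' => by ext m; exact add_smul (y : A) (y' : A) (m : M)
        map_smul' := fun a y => by ext m; exact mul_smul a (y : A) (m : M) })
    (by
      refine Submodule.span_le.2 ?_
      rintro _ ⟨b, hb, x, x', m, m', hx, hm, rfl⟩
      simp only [SetLike.mem_coe, LinearMap.mem_ker, map_sub,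
        TensorProduct.AlgebraTensorModule.lift_tmul]
      change (x' : A) • (m : M) - (x : A) • (m' : M) = 0
      rw [hx, hm, mul_smul, sub_self])

theorem eval_tmul (y : A) (z : M) : eval B e M (tmul B e y z) = (y * e) • e • z := rfl

end ResInd

end ResInd

/-! ### Bisets -/

/-- A finite `(G, H)`-biset: a finite set with commuting left `G`- and right `H`-actions. -/
structure Biset (G H : Type u) [Group G] [Group H] : Type (u + 1) where
  carrier : Type u
  [left : MulAction G carrier]
  [right : MulAction Hᵐᵒᵖ carrier]
  [comm : SMulCommClass G Hᵐᵒᵖ carrier]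
  [fin : Finite carrier]

attribute [instance] Biset.left Biset.right Biset.comm Biset.fin

namespace Biset

variable {G H J L : Type u} [Group G] [Group H] [Group J] [Group L]

/-- Isomorphism of bisets: a bijection compatible with both actions. -/
def Iso (X Y : Biset G H) : Prop :=
  ∃ e : X.carrier ≃ Y.carrier, (∀ (g : G) (a : X.carrier), e (g • a) = g • e a) ∧
    ∀ (h : Hᵐᵒᵖ) (a : X.carrier), e (h • a) = h • e a

instance setoid (G H : Type u) [Group G] [Group H] : Setoid (Biset G H) where
  r := Iso
  iseqv :=
    { refl := fun X => ⟨Equiv.refl _, fun _ _ => rfl, fun _ _ => rfl⟩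
      symm := by
        rintro X Y ⟨e, h1, h2⟩
        refine ⟨e.symm, fun g a => ?_, fun g a => ?_⟩
        · rw [Equiv.symm_apply_eq, h1, Equiv.apply_symm_apply]
        · rw [Equiv.symm_apply_eq, h2, Equiv.apply_symm_apply]
      trans := by
        rintro X Y Z ⟨e, h1, h2⟩ ⟨f, h3, h4⟩
        exact ⟨e.trans f, fun g a => by simp [h1, h3], fun g a => by simp [h2, h4]⟩ }

/-- The disjoint union of two bisets. -/
def sum (X Y : Biset G H) : Biset G H where
  carrier := X.carrier ⊕ Y.carrier

/-- The empty biset. -/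
def empty (G H : Type u) [Group G] [Group H] : Biset G H :=
  letI : MulAction G PEmpty.{u + 1} :=
    { smul := fun _ a => a, one_smul := fun _ => rfl, mul_smul := fun _ _ _ => rfl }
  letI : MulAction Hᵐᵒᵖ PEmpty.{u + 1} :=
    { smul := fun _ a => a, one_smul := fun _ => rfl, mul_smul := fun _ _ _ => rfl }
  { carrier := PEmpty.{u + 1}, comm := ⟨fun _ _ a => a.elim⟩ }

/-- A finite group `G` as a `(G, G)`-biset. -/
def regular (G : Type u) [Group G] [Finite G] : Biset G G where
  carrier := G

/-- The equivalence relation `(x · j, y) ∼ (x, j · y)` on `X × Y`. -/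
def compSetoid (X : Biset G J) (Y : Biset J H) : Setoid (X.carrier × Y.carrier) where
  r a b := ∃ j : J, a.1 = MulOpposite.op j • b.1 ∧ b.2 = j • a.2
  iseqv :=
    { refl := fun a => ⟨1, by simp, by simp⟩
      symm := by
        rintro a b ⟨j, h1, h2⟩
        refine ⟨j⁻¹, ?_, ?_⟩
        · rw [h1, smul_smul, ← MulOpposite.op_mul, mul_inv_cancel]; simp
        · rw [h2, smul_smul]; simp
      trans := by
        rintro a b c ⟨j, h1, h2⟩ ⟨k, h3, h4⟩
        refine ⟨k * j, ?_, ?_⟩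
        · rw [h1, h3, smul_smul, ← MulOpposite.op_mul]
        · rw [h4, h2, smul_smul] }

/-- The composition `X ×_J Y` of a `(G, J)`-biset and a `(J, H)`-biset. -/
def comp (X : Biset G J) (Y : Biset J H) : Biset G H :=
  letI s := compSetoid X Y
  letI : MulAction G (Quotient s) :=
    { smul := fun g => Quotient.map (fun a => (g • a.1, a.2)) (by
        rintro a b ⟨j, h1, h2⟩
        exact ⟨j, by rw [h1, smul_comm], h2⟩)
      one_smul := by rintro ⟨a⟩; exact congrArg (Quotient.mk s) (Prod.ext (one_smul _ _) rfl)
      mul_smul := by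
        rintro g g' ⟨a⟩; exact congrArg (Quotient.mk s) (Prod.ext (mul_smul _ _ _) rfl) }
  letI : MulAction Hᵐᵒᵖ (Quotient s) :=
    { smul := fun h => Quotient.map (fun a => (a.1, h • a.2)) (by
        rintro a b ⟨j, h1, h2⟩
        exact ⟨j, h1, by rw [h2]; exact (smul_comm j h a.2).symm⟩)
      one_smul := by rintro ⟨a⟩; exact congrArg (Quotient.mk s) (Prod.ext rfl (one_smul _ _))
      mul_smul := by
        rintro g g' ⟨a⟩; exact congrArg (Quotient.mk s) (Prod.ext rfl (mul_smul _ _ _)) }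
  { carrier := Quotient s
    comm := ⟨by rintro g h ⟨a⟩; rfl⟩ }

/-- The class in `X ×_J Y` of a pair. -/
def comp.mk (X : Biset G J) (Y : Biset J H) (a : X.carrier) (b : Y.carrier) :
    (comp X Y).carrier :=
  Quotient.mk (compSetoid X Y) (a, b)

theorem comp.smul_mk (X : Biset G J) (Y : Biset J H) (a : X.carrier) (b : Y.carrier) (g : G) :
    g • comp.mk X Y a b = comp.mk X Y (g • a) b := rfl

theorem comp.op_smul_mk (X : Biset G J) (Y : Biset J H) (a : X.carrier) (b : Y.carrier)
    (h : Hᵐᵒᵖ) : h • comp.mk X Y a b = comp.mk X Y a (h • b) := rfl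

theorem comp.mk_smul (X : Biset G J) (Y : Biset J H) (a : X.carrier) (b : Y.carrier) (j : J) :
    comp.mk X Y (MulOpposite.op j • a) b = comp.mk X Y a (j • b) :=
  Quotient.sound (s := compSetoid X Y) ⟨j, rfl, rfl⟩

theorem comp.ind {X : Biset G J} {Y : Biset J H} {P : (comp X Y).carrier → Prop}
    (h : ∀ a b, P (comp.mk X Y a b)) (z : (comp X Y).carrier) : P z :=
  Quotient.ind (s := compSetoid X Y) (fun p => h p.1 p.2) z

/-- Maps out of `X ×_J Y` are balanced maps out of `X × Y`. -/
def comp.desc {X : Biset G J} {Y : Biset J H} {α : Sort v} (f : X.carrier → Y.carrier → α)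
    (hf : ∀ a (j : J) b, f (MulOpposite.op j • a) b = f a (j • b)) : (comp X Y).carrier → α :=
  Quotient.lift (s := compSetoid X Y) (fun p => f p.1 p.2) (by
    rintro ⟨a, b⟩ ⟨a', b'⟩ ⟨j, h1, h2⟩
    simp only at h1 h2 ⊢
    rw [h1, h2, hf])

theorem comp.desc_mk {X : Biset G J} {Y : Biset J H} {α : Sort v}
    (f : X.carrier → Y.carrier → α)
    (hf : ∀ a (j : J) b, f (MulOpposite.op j • a) b = f a (j • b)) (a b) :
    comp.desc f hf (comp.mk X Y a b) = f a b := rfl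

theorem sum_congr {X X' Y Y' : Biset G H} (h : Iso X X') (h' : Iso Y Y') :
    Iso (sum X Y) (sum X' Y') := by
  obtain ⟨e, h1, h2⟩ := h
  obtain ⟨f, h3, h4⟩ := h'
  refine ⟨Equiv.sumCongr e f, ?_, ?_⟩
  · rintro g (a | a)
    · exact congrArg Sum.inl (h1 g a)
    · exact congrArg Sum.inr (h3 g a)
  · rintro g (a | a)
    · exact congrArg Sum.inl (h2 g a)
    · exact congrArg Sum.inr (h4 g a)

/-- Two mutually inverse equivariant maps give an isomorphism. -/
theorem Iso.mk' {X Y : Biset G H} (f : X.carrier → Y.carrier) (f' : Y.carrier → X.carrier)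
    (h1 : ∀ a, f' (f a) = a) (h2 : ∀ a, f (f' a) = a)
    (h3 : ∀ (g : G) a, f (g • a) = g • f a) (h4 : ∀ (h : Hᵐᵒᵖ) a, f (h • a) = h • f a) :
    Iso X Y := ⟨⟨f, f', h1, h2⟩, h3, h4⟩

theorem comp_congr {X X' : Biset G J} {Y Y' : Biset J H} (h : Iso X X') (h' : Iso Y Y') :
    Iso (comp X Y) (comp X' Y') := by
  obtain ⟨e, h1, h2⟩ := id h
  obtain ⟨f, h3, h4⟩ := id h'
  obtain ⟨e', rfl⟩ : ∃ e' : X'.carrier ≃ X.carrier, e = e'.symm := ⟨e.symm, rfl⟩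
  obtain ⟨f', rfl⟩ : ∃ f' : Y'.carrier ≃ Y.carrier, f = f'.symm := ⟨f.symm, rfl⟩
  have h2' : ∀ (j : Jᵐᵒᵖ) a, e' (j • a) = j • e' a := fun j a => by
    apply e'.symm.injective; rw [h2]; simp
  have h3' : ∀ (j : J) a, f' (j • a) = j • f' a := fun j a => by
    apply f'.symm.injective; rw [h3]; simp
  refine Iso.mk'
    (comp.desc (fun a b => comp.mk X' Y' (e'.symm a) (f'.symm b)) fun a j b => ?_)
    (comp.desc (fun a b => comp.mk X Y (e' a) (f' b)) fun a j b => ?_) ?_ ?_ ?_ ?_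
  · rw [h2, h3, comp.mk_smul]
  · rw [h2', h3', comp.mk_smul]
  · exact comp.ind fun a b => by simp [comp.desc_mk]
  · exact comp.ind fun a b => by simp [comp.desc_mk]
  · exact fun g => comp.ind fun a b => by simp [comp.desc_mk, comp.smul_mk, h1]
  · exact fun g => comp.ind fun a b => by simp [comp.desc_mk, comp.op_smul_mk, h4]

theorem comp_assoc (X : Biset G J) (Y : Biset J L) (Z : Biset L H) :
    Iso (comp (comp X Y) Z) (comp X (comp Y Z)) := by
  refine Iso.mk'
    (comp.desc (fun p c => comp.desc (fun a b => comp.mk X (comp Y Z) a (comp.mk Y Z b c))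
      (fun a j b => ?_) p) ?_)
    (comp.desc (fun a q => comp.desc (fun b c => comp.mk (comp X Y) Z (comp.mk X Y a b) c)
      (fun b l c => ?_) q) ?_) ?_ ?_ ?_ ?_
  · rw [comp.mk_smul, comp.smul_mk]
  · intro p l c
    induction p using comp.ind with
    | h a b => simp only [comp.desc_mk, comp.op_smul_mk, comp.mk_smul]
  · rw [← comp.op_smul_mk, comp.mk_smul]
  · intro a j q
    induction q using comp.ind with
    | h b c => simp only [comp.desc_mk, comp.smul_mk, comp.mk_smul]
  · exact comp.ind fun p c => by
      induction p using comp.ind with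
      | h a b => rfl
  · exact comp.ind fun a q => by
      induction q using comp.ind with
      | h b c => rfl
  · exact fun g => comp.ind fun p c => by
      induction p using comp.ind with
      | h a b => rfl
  · exact fun g => comp.ind fun p c => by
      induction p using comp.ind with
      | h a b => rfl

theorem regular_comp [Finite G] (X : Biset G H) : Iso (comp (regular G) X) X := by
  refine Iso.mk' (comp.desc (fun (g : G) a => g • a) ?_)
    (fun a => comp.mk (regular G) X (1 : G) a) ?_ ?_ ?_ ?_
  · intro a j b; exact mul_smul (α := G) a j b
  · exact comp.ind fun (a : G) b => (comp.mk_smul (regular G) X (1 : G) b a).symm.trans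
      (congrArg (fun t => comp.mk (regular G) X t b) (one_mul (M := G) a))
  · intro a; exact one_smul G a
  · exact fun g => comp.ind fun a b => mul_smul (α := G) g a b
  · exact fun h => comp.ind fun (a : G) b => smul_comm a h b

theorem comp_regular [Finite H] (X : Biset G H) : Iso (comp X (regular H)) X := by
  refine Iso.mk' (comp.desc (fun a (h : H) => MulOpposite.op h • a) ?_)
    (fun a => comp.mk X (regular H) a (1 : H)) ?_ ?_ ?_ ?_
  · intro a j (b : H)
    change MulOpposite.op b • MulOpposite.op j • a = MulOpposite.op (j * b) • a
    rw [smul_smul, ← MulOpposite.op_mul]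
  · exact comp.ind fun a (b : H) => (comp.mk_smul X (regular H) a (1 : H) b).trans
      (congrArg (fun t => comp.mk X (regular H) a t) (mul_one (M := H) b))
  · intro a; exact one_smul Hᵐᵒᵖ a
  · exact fun g => comp.ind fun a b => (smul_comm g _ a).symm
  · exact fun h => comp.ind fun a (b : H) => mul_smul h (MulOpposite.op b) a

theorem sum_comp (X X' : Biset G J) (Y : Biset J H) :
    Iso (comp (sum X X') Y) (sum (comp X Y) (comp X' Y)) := by
  refine Iso.mk'
    (comp.desc (fun a b => Sum.elim (fun a => Sum.inl (comp.mk X Y a b))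
      (fun a => Sum.inr (comp.mk X' Y a b)) a) ?_)
    (Sum.elim (comp.desc (fun a b => comp.mk (sum X X') Y (Sum.inl a) b) ?_)
      (comp.desc (fun a b => comp.mk (sum X X') Y (Sum.inr a) b) ?_)) ?_ ?_ ?_ ?_
  · rintro (a | a) j b
    · exact congrArg Sum.inl (comp.mk_smul X Y a b j)
    · exact congrArg Sum.inr (comp.mk_smul X' Y a b j)
  · intro a j b; exact comp.mk_smul (sum X X') Y (Sum.inl a) b j
  · intro a j b; exact comp.mk_smul (sum X X') Y (Sum.inr a) b j
  · exact comp.ind (by rintro (a | a) b <;> rfl)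
  · rintro (a | a)
    · induction a using comp.ind with
      | h a b => rfl
    · induction a using comp.ind with
      | h a b => rfl
  · exact fun g => comp.ind (by rintro (a | a) b <;> rfl)
  · exact fun g => comp.ind (by rintro (a | a) b <;> rfl)

theorem comp_sum (X : Biset G J) (Y Y' : Biset J H) :
    Iso (comp X (sum Y Y')) (sum (comp X Y) (comp X Y')) := by
  refine Iso.mk'
    (comp.desc (fun a b => Sum.elim (fun b => Sum.inl (comp.mk X Y a b))
      (fun b => Sum.inr (comp.mk X Y' a b)) b) ?_)
    (Sum.elim (comp.desc (fun a b => comp.mk X (sum Y Y') a (Sum.inl b)) ?_)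
      (comp.desc (fun a b => comp.mk X (sum Y Y') a (Sum.inr b)) ?_)) ?_ ?_ ?_ ?_
  · rintro a j (b | b)
    · exact congrArg Sum.inl (comp.mk_smul X Y a b j)
    · exact congrArg Sum.inr (comp.mk_smul X Y' a b j)
  · intro a j b; exact comp.mk_smul X (sum Y Y') a (Sum.inl b) j
  · intro a j b; exact comp.mk_smul X (sum Y Y') a (Sum.inr b) j
  · exact comp.ind (by rintro a (b | b) <;> rfl)
  · rintro (a | a)
    · induction a using comp.ind with
      | h a b => rfl
    · induction a using comp.ind with
      | h a b => rfl
  · exact fun g => comp.ind (by rintro a (b | b) <;> rfl)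
  · exact fun g => comp.ind (by rintro a (b | b) <;> rfl)

theorem iso_of_isEmpty {X Y : Biset G H} (hX : X.carrier → False) (hY : Y.carrier → False) :
    Iso X Y :=
  Iso.mk' (fun a => (hX a).elim) (fun a => (hY a).elim) (fun a => (hX a).elim)
    (fun a => (hY a).elim) (fun _ a => (hX a).elim) (fun _ a => (hX a).elim)

theorem empty_comp (Y : Biset J H) : Iso (comp (empty G J) Y) (empty G H) :=
  iso_of_isEmpty (comp.ind fun a _ => PEmpty.elim a) (fun a => PEmpty.elim a)

theorem comp_empty (X : Biset G J) : Iso (comp X (empty J H)) (empty G H) :=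
  iso_of_isEmpty (comp.ind fun _ b => PEmpty.elim b) (fun a => PEmpty.elim a)

theorem empty_sum (X : Biset G H) : Iso (sum (empty G H) X) X :=
  Iso.mk' (Sum.elim (fun a => PEmpty.elim a) id) Sum.inr
    (by rintro (a | a); exacts [PEmpty.elim a, rfl]) (fun _ => rfl)
    (by rintro g (a | a); exacts [PEmpty.elim a, rfl])
    (by rintro g (a | a); exacts [PEmpty.elim a, rfl])

theorem sum_comm (X Y : Biset G H) : Iso (sum X Y) (sum Y X) :=
  Iso.mk' Sum.swap Sum.swap (by rintro (a | a) <;> rfl) (by rintro (a | a) <;> rfl)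
    (by rintro g (a | a) <;> rfl) (by rintro g (a | a) <;> rfl)

theorem sum_assoc (X Y Z : Biset G H) : Iso (sum (sum X Y) Z) (sum X (sum Y Z)) :=
  ⟨Equiv.sumAssoc _ _ _, by rintro g ((a | a) | a) <;> rfl, by rintro g ((a | a) | a) <;> rfl⟩

/-- The transitive `(G, H)`-biset `(G × H) / D`, where `g · (x, y)D · h = (gx, h⁻¹y)D`. -/
def transitive [Finite G] [Finite H] (D : Subgroup (G × H)) : Biset G H :=
  letI : MulAction G ((G × H) ⧸ D) :=
    { smul := fun g a => ((g, 1) : G × H) • a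
      one_smul := fun a => one_smul (G × H) a
      mul_smul := fun g g' a => by
        change ((g * g', 1) : G × H) • a = ((g, 1) : G × H) • ((g', 1) : G × H) • a
        rw [smul_smul]; simp }
  letI : MulAction Hᵐᵒᵖ ((G × H) ⧸ D) :=
    { smul := fun h a => ((1, h.unop⁻¹) : G × H) • a
      one_smul := fun a => by
        change ((1, (1 : Hᵐᵒᵖ).unop⁻¹) : G × H) • a = a
        simp only [MulOpposite.unop_one, inv_one]
        exact one_smul (G × H) a
      mul_smul := fun h h' a => by
        change ((1, (h * h').unop⁻¹) : G × H) • a =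
          ((1, h.unop⁻¹) : G × H) • ((1, h'.unop⁻¹) : G × H) • a
        rw [smul_smul]; simp }
  { carrier := (G × H) ⧸ D
    comm := ⟨fun g h a => by
      change ((g, 1) : G × H) • ((1, h.unop⁻¹) : G × H) • a =
        ((1, h.unop⁻¹) : G × H) • ((g, 1) : G × H) • a
      rw [smul_smul, smul_smul]; simp⟩ }

end Biset

/-- Isomorphism classes of finite `(G, H)`-bisets. -/
def BisetClass (G H : Type u) [Group G] [Group H] : Type (u + 1) :=
  Quotient (Biset.setoid G H)

namespace BisetClass

variable {G H J L : Type u} [Group G] [Group H] [Group J] [Group L]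

/-- The isomorphism class of a biset. -/
def mk (X : Biset G H) : BisetClass G H := Quotient.mk _ X

theorem sound {X Y : Biset G H} (h : Biset.Iso X Y) : mk X = mk Y := Quotient.sound h

/-- Zero is the class of the empty biset. -/
instance : Zero (BisetClass G H) := ⟨mk (Biset.empty G H)⟩

/-- Addition is disjoint union. -/
instance : Add (BisetClass G H) :=
  ⟨Quotient.map₂ Biset.sum fun _ _ h _ _ h' => Biset.sum_congr h h'⟩

instance : AddCommMonoid (BisetClass G H) where
  add_assoc := by rintro ⟨X⟩ ⟨Y⟩ ⟨Z⟩; exact sound (Biset.sum_assoc X Y Z)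
  zero_add := by rintro ⟨X⟩; exact sound (Biset.empty_sum X)
  add_zero := by
    rintro ⟨X⟩
    exact (sound (Biset.sum_comm X (Biset.empty G H))).trans (sound (Biset.empty_sum X))
  add_comm := by rintro ⟨X⟩ ⟨Y⟩; exact sound (Biset.sum_comm X Y)
  nsmul := nsmulRec

/-- The product of isomorphism classes of bisets is the class of `X ×_J Y`. -/
def compFun : BisetClass G J → BisetClass J H → BisetClass G H :=
  Quotient.map₂ Biset.comp fun _ _ h _ _ h' => Biset.comp_congr h h'

/-- The product of isomorphism classes of bisets, as a biadditive map. -/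
def comp : BisetClass G J →+ BisetClass J H →+ BisetClass G H where
  toFun a :=
    { toFun := compFun a
      map_zero' := by
        obtain ⟨X⟩ := a; exact sound (Biset.comp_empty X)
      map_add' := by
        obtain ⟨X⟩ := a; rintro ⟨Y⟩ ⟨Y'⟩; exact sound (Biset.comp_sum X Y Y') }
  map_zero' := by
    ext b; obtain ⟨Y⟩ := b; exact sound (Biset.empty_comp Y)
  map_add' := by
    rintro ⟨X⟩ ⟨X'⟩; ext b; obtain ⟨Y⟩ := b; exact sound (Biset.sum_comp X X' Y)

theorem comp_mk (X : Biset G J) (Y : Biset J H) : comp (mk X) (mk Y) = mk (Biset.comp X Y) := rfl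

theorem comp_assoc (a : BisetClass G J) (b : BisetClass J L) (c : BisetClass L H) :
    comp (comp a b) c = comp a (comp b c) := by
  obtain ⟨X⟩ := a; obtain ⟨Y⟩ := b; obtain ⟨Z⟩ := c
  exact sound (Biset.comp_assoc X Y Z)

/-- The class of the regular biset. -/
def one (G : Type u) [Group G] [Finite G] : BisetClass G G := mk (Biset.regular G)

theorem one_comp [Finite G] (a : BisetClass G H) : comp (one G) a = a := by
  obtain ⟨X⟩ := a; exact sound (Biset.regular_comp X)

theorem comp_one [Finite H] (a : BisetClass G H) : comp a (one H) = a := by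
  obtain ⟨X⟩ := a; exact sound (Biset.comp_regular X)

end BisetClass

/-- Formal sums of isomorphism classes of bisets over pairs of subgroups of `S`: such a sum is
recorded by its component at every pair `(A, B)`, a (possibly empty) class of
`(A, B)`-bisets. -/
def BisetSums (S : Type u) [Group S] : Type (u + 1) := ∀ A B : Subgroup S, BisetClass A B

namespace BisetSums

variable {S : Type u} [Group S]

instance : AddCommMonoid (BisetSums S) :=
  inferInstanceAs (AddCommMonoid (∀ A B : Subgroup S, BisetClass A B))

theorem add_apply (f g : BisetSums S) (A B : Subgroup S) : (f + g) A B = f A B + g A B := rfl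

variable [Finite S]

variable (S) in
/-- The finite set of all subgroups of `S`. -/
def subgroups : Finset (Subgroup S) := (Set.toFinite (Set.univ : Set (Subgroup S))).toFinset

theorem mem_subgroups (A : Subgroup S) : A ∈ subgroups S := by simp [subgroups]

open Classical in
/-- The sum of the `(A, A)`-bisets `A`. -/
def one : BisetSums S := fun A B => if h : A = B then h ▸ BisetClass.one A else 0

theorem one_self (A : Subgroup S) : one A A = BisetClass.one A := by simp [one]

theorem one_ne {A B : Subgroup S} (h : A ≠ B) : one A B = 0 := by simp [one, h]

/-- The product of an `(A, J)`-biset and a `(J', B)`-biset is `X ×_J Y` if `J = J'` and zero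
otherwise; this is extended biadditively. -/
instance : Semiring (BisetSums S) :=
  { (inferInstance : AddCommMonoid (BisetSums S)) with
    mul := fun f g A B => ∑ J ∈ subgroups S, BisetClass.comp (f A J) (g J B)
    one := one
    zero_mul := fun f => by
      funext A B
      exact Finset.sum_eq_zero fun J _ => DFunLike.congr_fun (map_zero BisetClass.comp) (f J B)
    mul_zero := fun f => by
      funext A B
      exact Finset.sum_eq_zero fun J _ => map_zero (BisetClass.comp (f A J))
    left_distrib := fun f g h => by
      funext A B
      exact (Finset.sum_congr rfl fun J _ => map_add (BisetClass.comp (f A J)) _ _).trans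
        Finset.sum_add_distrib
    right_distrib := fun f g h => by
      funext A B
      exact (Finset.sum_congr rfl fun J _ =>
        DFunLike.congr_fun (map_add BisetClass.comp (f A J) (g A J)) (h J B)).trans
        Finset.sum_add_distrib
    one_mul := fun f => by
      funext A B
      refine (Finset.sum_eq_single A (fun J _ h => ?_) fun h => (h (mem_subgroups A)).elim).trans ?_
      · change BisetClass.comp (one A J) (f J B) = 0
        rw [one_ne h.symm]; exact DFunLike.congr_fun (map_zero BisetClass.comp) _
      · change BisetClass.comp (one A A) (f A B) = f A B
        rw [one_self, BisetClass.one_comp]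
    mul_one := fun f => by
      funext A B
      refine (Finset.sum_eq_single B (fun J _ h => ?_) fun h => (h (mem_subgroups B)).elim).trans ?_
      · change BisetClass.comp (f A J) (one J B) = 0
        rw [one_ne h]; exact map_zero _
      · change BisetClass.comp (f A B) (one B B) = f A B
        rw [one_self, BisetClass.comp_one]
    mul_assoc := fun f g h => by
      funext A B
      change ∑ L ∈ subgroups S, BisetClass.comp
          (∑ J ∈ subgroups S, BisetClass.comp (f A J) (g J L)) (h L B) =
        ∑ J ∈ subgroups S, BisetClass.comp (f A J)
          (∑ L ∈ subgroups S, BisetClass.comp (g J L) (h L B))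
      simp only [map_sum, AddMonoidHom.finsetSum_apply, BisetClass.comp_assoc]
      exact Finset.sum_comm }

theorem mul_apply (f g : BisetSums S) (A B : Subgroup S) :
    (f * g) A B = ∑ J ∈ subgroups S, BisetClass.comp (f A J) (g J B) := rfl

open Classical in
/-- The formal sum consisting of a single class of `(A, B)`-bisets. -/
def single (A B : Subgroup S) (a : BisetClass A B) : BisetSums S :=
  Pi.single A (Pi.single B a)

end BisetSums

/-! ### Fusion systems -/

/-- The group homomorphism `H → K`, `x ↦ s x s⁻¹`, when `s H s⁻¹ ≤ K`. -/
def conjHom {S : Type u} [Group S] (s : S) (H K : Subgroup S)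
    (h : ∀ x ∈ H, s * x * s⁻¹ ∈ K) : H →* K where
  toFun x := ⟨s * x * s⁻¹, h x x.2⟩
  map_one' := by ext; simp
  map_mul' x y := by ext; simp

/-- The image of a homomorphism between subgroups of `S`, as a subgroup of `S`. -/
def image {S : Type u} [Group S] {H K : Subgroup S} (φ : H →* K) : Subgroup S :=
  (K.subtype.comp φ).range

/-- A (not necessarily saturated) fusion system over `S`: a category whose objects are the
subgroups of `S`, with the following properties. -/
structure FusionSystem (S : Type u) [Group S] where
  /-- The morphisms from `H` to `K`. -/
  Hom (H K : Subgroup S) : Set (H →* K)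
  injective : ∀ {H K : Subgroup S} {φ : H →* K}, φ ∈ Hom H K → Function.Injective φ
  comp_mem : ∀ {H K L : Subgroup S} {φ : H →* K} {ψ : K →* L},
    φ ∈ Hom H K → ψ ∈ Hom K L → ψ.comp φ ∈ Hom H L
  /-- Conjugation by an element of `S` followed by inclusion is a morphism. -/
  conj_mem : ∀ (s : S) (H K : Subgroup S) (h : ∀ x ∈ H, s * x * s⁻¹ ∈ K),
    conjHom s H K h ∈ Hom H K
  /-- A morphism, seen as an isomorphism onto its image, is a morphism, and so is the inverse of
  this isomorphism. -/
  image_mem : ∀ {H K : Subgroup S} {φ : H →* K}, φ ∈ Hom H K →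
    ∀ e : H ≃* image φ, (∀ x : H, ((e x : image φ) : S) = φ x) →
      e.toMonoidHom ∈ Hom H (image φ) ∧ e.symm.toMonoidHom ∈ Hom (image φ) H

namespace FusionSystem

variable {S : Type u} [Group S] (F : FusionSystem S)

theorem inclusion_mem {H K : Subgroup S} (h : H ≤ K) : Subgroup.inclusion h ∈ F.Hom H K := by
  have := F.conj_mem 1 H K (fun x hx => by simpa using h hx)
  convert this using 1
  ext x
  simp [conjHom]

theorem id_mem (H : Subgroup S) : MonoidHom.id H ∈ F.Hom H H :=
  F.inclusion_mem (le_refl H)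

/-- A morphism seen as an isomorphism onto its image. -/
def toImage {H K : Subgroup S} {φ : H →* K} (hφ : φ ∈ F.Hom H K) : H ≃* image φ :=
  MonoidHom.ofInjective (f := K.subtype.comp φ)
    (K.subtype_injective.comp (F.injective hφ))

theorem coe_toImage {H K : Subgroup S} {φ : H →* K} (hφ : φ ∈ F.Hom H K) (x : H) :
    ((F.toImage hφ x : image φ) : S) = φ x := rfl

theorem toImage_mem {H K : Subgroup S} {φ : H →* K} (hφ : φ ∈ F.Hom H K) :
    (F.toImage hφ).toMonoidHom ∈ F.Hom H (image φ) :=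
  (F.image_mem hφ _ (F.coe_toImage hφ)).1

theorem toImage_symm_mem {H K : Subgroup S} {φ : H →* K} (hφ : φ ∈ F.Hom H K) :
    (F.toImage hφ).symm.toMonoidHom ∈ F.Hom (image φ) H :=
  (F.image_mem hφ _ (F.coe_toImage hφ)).2

theorem image_le {H K : Subgroup S} (φ : H →* K) : image φ ≤ K := by
  rintro _ ⟨x, rfl⟩
  exact (φ x).2

/-- `H` and `K` are isomorphic in the fusion system. -/
def Conj (H K : Subgroup S) : Prop := ∃ e : H ≃* K, e.toMonoidHom ∈ F.Hom H K

/-- The automorphisms of `H` in the fusion system. -/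
def aut (H : Subgroup S) : Subgroup (MulAut H) where
  carrier := {e | e.toMonoidHom ∈ F.Hom H H}
  one_mem' := F.id_mem H
  mul_mem' {a b} ha hb := F.comp_mem hb ha
  inv_mem' {a} ha := by
    have hle : H ≤ image a.toMonoidHom := fun x hx =>
      ⟨a.symm ⟨x, hx⟩, congrArg Subtype.val (a.apply_symm_apply ⟨x, hx⟩)⟩
    have := F.comp_mem (F.inclusion_mem hle) (F.toImage_symm_mem ha)
    change a.symm.toMonoidHom ∈ F.Hom H H
    convert this using 1
    ext x
    apply congrArg Subtype.val
    change a.symm x = (F.toImage ha).symm (Subgroup.inclusion hle x)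
    rw [MulEquiv.eq_symm_apply]
    apply Subtype.ext
    rw [coe_toImage]
    exact congrArg Subtype.val (a.apply_symm_apply x)

/-- `H` is fully normalized. -/
def FullyNormalized (H : Subgroup S) : Prop :=
  ∀ K : Subgroup S, F.Conj H K →
    Nat.card (Subgroup.normalizer (K : Set S)) ≤ Nat.card (Subgroup.normalizer (H : Set S))

/-- The `φ`-normalizer `N_φ`: all `x ∈ N_S(H)` for which there is `z ∈ N_S(φ(H))` with
`φ(x h x⁻¹) = z φ(h) z⁻¹` for all `h ∈ H`. -/
def extender {H K : Subgroup S} (φ : H →* K) : Subgroup S where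
  carrier := {x | x ∈ Subgroup.normalizer (H : Set S) ∧
    ∃ z ∈ Subgroup.normalizer (image φ : Set S), ∀ h h' : H, (h' : S) = x * h * x⁻¹ →
      (φ h' : S) = z * φ h * z⁻¹}
  one_mem' := ⟨one_mem _, 1, one_mem _, fun h h' e => by
    have : h' = h := Subtype.ext (by simpa using e)
    simp [this]⟩
  mul_mem' := by
    rintro x y ⟨hx, z, hz, h1⟩ ⟨hy, w, hw, h2⟩
    refine ⟨mul_mem hx hy, z * w, mul_mem hz hw, fun h h' e => ?_⟩
    have hmem : y * h * y⁻¹ ∈ H := (hy (h : S)).1 h.2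
    rw [h1 ⟨_, hmem⟩ h' (by rw [e]; group), h2 h ⟨_, hmem⟩ rfl]
    group
  inv_mem' := by
    rintro x ⟨hx, z, hz, h1⟩
    refine ⟨inv_mem hx, z⁻¹, inv_mem hz, fun h h' e => ?_⟩
    rw [h1 h' h (by rw [e]; group)]
    group

/-- Saturation. -/
structure IsSaturated (p : ℕ) : Prop where
  /-- `Aut_S(S)` is a Sylow `p`-subgroup of `Aut_F(S)`. -/
  sylow : ∃ P : Sylow p (F.aut ⊤), (P : Subgroup (F.aut ⊤)).map (F.aut ⊤).subtype =
    (MulAut.conj : (⊤ : Subgroup S) →* MulAut (⊤ : Subgroup S)).range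
  /-- Every morphism with fully normalized image extends to its extender. -/
  extend : ∀ (H : Subgroup S) (φ : H →* (⊤ : Subgroup S)), φ ∈ F.Hom H ⊤ →
    F.FullyNormalized (image φ) →
      ∃ ψ ∈ F.Hom (extender φ) ⊤, ∀ (x : S) (hx : x ∈ H) (hx' : x ∈ extender φ),
        ψ ⟨x, hx'⟩ = φ ⟨x, hx⟩

/-- `H` is `F`-centric: `C_S(K) ≤ K` for every `K` isomorphic to `H` in `F`. -/
def IsCentric (H : Subgroup S) : Prop :=
  ∀ K : Subgroup S, F.Conj H K → Subgroup.centralizer (K : Set S) ≤ K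

/-- A fusion system `G` over `T` contains a fusion system `F` over `S`, where `S` is regarded as a
subgroup of `T` through the injective homomorphism `j`. -/
def IsContained {T : Type v} [Group T] (F : FusionSystem S) (G : FusionSystem T) (j : S →* T) :
    Prop :=
  Function.Injective j ∧ ∀ (H K : Subgroup S) (φ : H →* K), φ ∈ F.Hom H K →
    ∃ ψ ∈ G.Hom (H.map j) (K.map j), ∀ x : H,
      (ψ ⟨j x, Subgroup.mem_map_of_mem j x.2⟩ : T) = j (φ x)

/-! ### The orbit category -/

/-- Two morphisms `H → K` are identified in the orbit category when they differ by
conjugation by an element of `K`. -/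
def orbitSetoid (H K : Subgroup S) : Setoid (F.Hom H K) where
  r φ ψ := ∃ k : K, ∀ x : H, ψ.1 x = k * φ.1 x * k⁻¹
  iseqv :=
    { refl := fun φ => ⟨1, fun x => by simp⟩
      symm := by
        rintro φ ψ ⟨k, h⟩
        exact ⟨k⁻¹, fun x => by rw [h]; group⟩
      trans := by
        rintro φ ψ χ ⟨k, h⟩ ⟨l, h'⟩
        exact ⟨l * k, fun x => by rw [h', h]; group⟩ }

/-- The morphisms of the orbit category. -/
def OrbitHom (H K : Subgroup S) : Type u := Quotient (F.orbitSetoid H K)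

namespace OrbitHom

variable {F} {H K L : Subgroup S}

/-- The morphism of the orbit category represented by a morphism of the fusion system. -/
def mk {φ : H →* K} (hφ : φ ∈ F.Hom H K) : F.OrbitHom H K := Quotient.mk _ ⟨φ, hφ⟩

theorem mk_eq_iff {φ ψ : H →* K} (hφ : φ ∈ F.Hom H K) (hψ : ψ ∈ F.Hom H K) :
    mk hφ = mk hψ ↔ ∃ k : K, ∀ x : H, ψ x = k * φ x * k⁻¹ :=
  ⟨fun h => Quotient.exact h, fun h => Quotient.sound h⟩

theorem ind {P : F.OrbitHom H K → Prop} (h : ∀ (φ : H →* K) (hφ : φ ∈ F.Hom H K), P (mk hφ))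
    (f : F.OrbitHom H K) : P f :=
  Quotient.ind (fun φ => h φ.1 φ.2) f

/-- Composition `g ∘ f` in the orbit category. -/
def comp (g : F.OrbitHom K L) (f : F.OrbitHom H K) : F.OrbitHom H L :=
  Quotient.map₂ (sa := F.orbitSetoid K L) (sb := F.orbitSetoid H K) (sc := F.orbitSetoid H L)
    (fun ψ φ => ⟨ψ.1.comp φ.1, F.comp_mem φ.2 ψ.2⟩) (by
      rintro ψ ψ' ⟨l, h⟩ φ φ' ⟨k, h'⟩
      refine ⟨l * ψ.1 k, fun x => ?_⟩
      change ψ'.1 (φ'.1 x) = _ * ψ.1 (φ.1 x) * _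
      rw [h, h']
      simp only [map_mul, map_inv]
      group) g f

theorem comp_mk {φ : H →* K} {ψ : K →* L} (hφ : φ ∈ F.Hom H K) (hψ : ψ ∈ F.Hom K L) :
    comp (mk hψ) (mk hφ) = mk (F.comp_mem hφ hψ) := rfl

theorem comp_assoc {M : Subgroup S} (h : F.OrbitHom L M) (g : F.OrbitHom K L)
    (f : F.OrbitHom H K) : comp (comp h g) f = comp h (comp g f) := by
  induction h using ind
  induction g using ind
  induction f using ind
  rfl

/-- The class of an inclusion. -/
def incl (F : FusionSystem S) {H K : Subgroup S} (h : H ≤ K) : F.OrbitHom H K :=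
  mk (F.inclusion_mem h)

/-- A representative of a morphism of the orbit category. -/
def rep (f : F.OrbitHom H K) : H →* K := (Quotient.out f).1

theorem rep_mem (f : F.OrbitHom H K) : rep f ∈ F.Hom H K := (Quotient.out f).2

theorem mk_rep (f : F.OrbitHom H K) : mk (rep_mem f) = f := Quotient.out_eq f

end OrbitHom

/-- The `F`-centric subgroups of `S`, the objects of the centric orbit category. -/
structure Centric where
  grp : Subgroup S
  isCentric : F.IsCentric grp

instance : Category F.Centric where
  Hom H K := F.OrbitHom H.grp K.grp
  id H := OrbitHom.mk (F.id_mem H.grp)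
  comp f g := OrbitHom.comp g f
  id_comp f := by
    induction f using OrbitHom.ind
    rfl
  comp_id f := by
    induction f using OrbitHom.ind
    rfl
  assoc f g h := (OrbitHom.comp_assoc h g f).symm

theorem Centric.grp_injective : Function.Injective (Centric.grp (F := F)) := by
  rintro ⟨H, h⟩ ⟨K, k⟩ (rfl : H = K)
  rfl

instance [Finite S] : Finite F.Centric := Finite.of_injective _ (Centric.grp_injective F)

instance [Finite S] : Fintype F.Centric := Fintype.ofFinite _

instance [Finite S] (H K : Subgroup S) : Finite (F.OrbitHom H K) :=
  haveI : Finite (H →* K) := Finite.of_injective (fun f => (f : H → K)) DFunLike.coe_injective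
  inferInstanceAs (Finite (Quotient (F.orbitSetoid H K)))

/-- The additive extension of the centric orbit category: formal finite coproducts of
centric subgroups. -/
abbrev AddExt : Type (max u 1) :=
  ObjectProperty.FullSubcategory
    (fun X : Limits.FormalCoproduct.{0} F.Centric => Finite X.I)

/-- A centric subgroup as an object of the additive extension. -/
def Centric.toAddExt {F : FusionSystem S} (H : F.Centric) : F.AddExt :=
  ⟨(Limits.FormalCoproduct.incl F.Centric).obj H, inferInstanceAs (Finite PUnit)⟩

/-! ### The product of two centric subgroups -/

/-- The pairs `(A, φ)` with `A` an `F`-centric subgroup of `H` and `φ : A → K` a morphism in the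
orbit category. -/
structure ProdPair (H K : Subgroup S) where
  A : Subgroup S
  isCentric : F.IsCentric A
  le : A ≤ H
  hom : F.OrbitHom A K

/-- The subgroup `A ^ h = h⁻¹ A h`. -/
def conjBy (A : Subgroup S) (h : S) : Subgroup S := A.map (MulAut.conj h⁻¹).toMonoidHom

theorem conj_mem_of_mem_conjBy {A : Subgroup S} {h x : S} (hx : x ∈ conjBy A h) :
    h * x * h⁻¹ ∈ A := by
  obtain ⟨a, ha, rfl⟩ := hx
  have : h * (h⁻¹ * a * h) * h⁻¹ = a := by group
  simpa [MulAut.conj_apply, this] using ha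

/-- The class of conjugation `c_h : A ^ h → A`, `x ↦ h x h⁻¹`. -/
def conjClass (A : Subgroup S) (h : S) : F.OrbitHom (conjBy A h) A :=
  OrbitHom.mk (F.conj_mem h (conjBy A h) A fun _ hx => conj_mem_of_mem_conjBy hx)

/-- The preorder: `(A, φ) ≾ (B, ψ)` if there is `h ∈ H` with `A ^ h ≤ B` and
`φ ∘ c_h = ψ ∘ ι` as morphisms `A ^ h → K` in the orbit category. -/
instance (H K : Subgroup S) : Preorder (F.ProdPair H K) where
  le P Q := ∃ h ∈ H, ∃ hle : conjBy P.A h ≤ Q.A,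
    OrbitHom.comp P.hom (F.conjClass P.A h) = OrbitHom.comp Q.hom (OrbitHom.incl F hle)
  le_refl := by
    rintro ⟨A, hA, hle, φ⟩
    refine ⟨1, one_mem _, fun x hx => by simpa using conj_mem_of_mem_conjBy hx, ?_⟩
    congr 1
    refine (OrbitHom.mk_eq_iff _ _).2 ⟨1, fun x => ?_⟩
    ext
    simp [conjHom]
  le_trans := by
    rintro ⟨A, hA, hAH, φ⟩ ⟨B, hB, hBH, ψ⟩ ⟨C, hC, hCH, χ⟩ ⟨h, hh, h1, h2⟩ ⟨k, hk, h3, h4⟩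
    dsimp only at h1 h2 h3 h4
    have hAB : ∀ x ∈ conjBy A (h * k), k * x * k⁻¹ ∈ conjBy A h := by
      intro x hx
      have := conj_mem_of_mem_conjBy hx
      refine ⟨_, this, ?_⟩
      simp only [MulEquiv.coe_toMonoidHom, MulAut.conj_apply]
      group
    have hBC : conjBy A (h * k) ≤ conjBy B k := by
      intro x hx
      refine ⟨_, h1 (hAB x hx), ?_⟩
      simp only [MulEquiv.coe_toMonoidHom, MulAut.conj_apply]
      group
    refine ⟨h * k, mul_mem hh hk, hBC.trans h3, ?_⟩
    dsimp only
    have e1 : F.conjClass A (h * k) = OrbitHom.comp (F.conjClass A h)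
        (OrbitHom.mk (F.conj_mem k (conjBy A (h * k)) (conjBy A h) hAB)) :=
      (OrbitHom.mk_eq_iff _ _).2 ⟨1, fun x => by
        ext; simp only [conjHom, MonoidHom.comp_apply, MonoidHom.coe_mk, OneHom.coe_mk]; simp
        group⟩
    have e2 : OrbitHom.comp (OrbitHom.incl F h1)
        (OrbitHom.mk (F.conj_mem k (conjBy A (h * k)) (conjBy A h) hAB)) =
        OrbitHom.comp (F.conjClass B k) (OrbitHom.incl F hBC) :=
      (OrbitHom.mk_eq_iff _ _).2 ⟨1, fun x => by ext; simp [conjHom]⟩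
    have e3 : OrbitHom.incl F (hBC.trans h3) =
        OrbitHom.comp (OrbitHom.incl F h3) (OrbitHom.incl F hBC) := rfl
    rw [e1, ← OrbitHom.comp_assoc, h2, OrbitHom.comp_assoc, e2, ← OrbitHom.comp_assoc, h4, e3,
      OrbitHom.comp_assoc]

/-- The maximal pairs up to the equivalence `P ≾ Q ∧ Q ≾ P`: the index set of `[H × K]`. -/
def ProdIndex (H K : Subgroup S) : Type u :=
  Antisymmetrization {P : F.ProdPair H K // IsMax P} (· ≤ ·)

/-- The set `[H × K]` consists of one representative of each equivalence class of maximal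
pairs. -/
def ProdIndex.rep {F : FusionSystem S} {H K : Subgroup S} (q : F.ProdIndex H K) :
    F.ProdPair H K :=
  (Quotient.out q).1

instance [Finite S] (H K : Subgroup S) : Finite (F.ProdPair H K) := by
  refine Finite.of_injective
    (fun P => (⟨P.A, P.hom⟩ : Σ A : Subgroup S, F.OrbitHom A K)) ?_
  rintro ⟨A, _, _, φ⟩ ⟨B, _, _, ψ⟩ h
  cases h
  rfl

instance [Finite S] (H K : Subgroup S) : Fintype (F.ProdIndex H K) :=
  haveI : Finite (F.ProdIndex H K) :=
    inferInstanceAs (Finite (Quotient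
      (AntisymmRel.setoid {P : F.ProdPair H K // IsMax P} (· ≤ ·))))
  Fintype.ofFinite _

end FusionSystem

/-! ### The centric Burnside ring -/

namespace AddExt

variable {S : Type u} [Group S] {F : FusionSystem S}

/-- The coproduct of two objects of the additive extension. -/
def sum (X Y : F.AddExt) : F.AddExt :=
  ⟨⟨X.obj.I ⊕ Y.obj.I, Sum.elim X.obj.obj Y.obj.obj⟩, by
    have := X.property
    have := Y.property
    exact inferInstanceAs (Finite (X.obj.I ⊕ Y.obj.I))⟩

/-- The empty coproduct. -/
def empty (F : FusionSystem S) : F.AddExt :=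
  ⟨⟨PEmpty, fun i => i.elim⟩, inferInstanceAs (Finite PEmpty)⟩

/-- A bijection of index sets with isomorphisms of the components is an isomorphism. -/
theorem iso_of_components {X Y : F.AddExt} (e : X.obj.I ≃ Y.obj.I)
    (h : ∀ i, Nonempty (X.obj.obj i ≅ Y.obj.obj (e i))) : Nonempty (X ≅ Y) :=
  ⟨ObjectProperty.isoMk _
    (Limits.FormalCoproduct.isoOfComponents e fun i => (h i).some)⟩

theorem components_of_iso {X Y : F.AddExt} (f : X ≅ Y) :
    ∃ e : X.obj.I ≃ Y.obj.I, ∀ i, Nonempty (X.obj.obj i ≅ Y.obj.obj (e i)) := by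
  let g : X.obj ≅ Y.obj := (ObjectProperty.ι _).mapIso f
  obtain ⟨hf, hφ⟩ := (Limits.FormalCoproduct.hom_ext_iff _ _).1 g.hom_inv_id
  obtain ⟨kf, kφ⟩ := (Limits.FormalCoproduct.hom_ext_iff _ _).1 g.inv_hom_id
  refine ⟨⟨g.hom.f, g.inv.f, fun i => congrFun hf i, fun i => congrFun kf i⟩, fun i => ?_⟩
  have h1 : g.inv.f (g.hom.f i) = i := congrFun hf i
  have nat : ∀ i i' (h : i' = i), g.hom.φ i' ≫ eqToHom (by rw [h]) =
      eqToHom (by rw [h]) ≫ g.hom.φ i := by rintro _ _ rfl; simp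
  have e1 := hφ i
  have e2 := kφ (g.hom.f i)
  simp only [Limits.FormalCoproduct.category_comp_φ, Limits.FormalCoproduct.category_id_φ,
    Category.assoc] at e1 e2
  rw [nat i _ h1] at e2
  exact ⟨⟨g.hom.φ i, g.inv.φ (g.hom.f i) ≫ eqToHom (by rw [h1]), e1, by
    rw [Category.assoc]; exact e2⟩⟩

theorem nonempty_iso_iff {X Y : F.AddExt} : Nonempty (X ≅ Y) ↔
    ∃ e : X.obj.I ≃ Y.obj.I, ∀ i, Nonempty (X.obj.obj i ≅ Y.obj.obj (e i)) :=
  ⟨fun ⟨f⟩ => components_of_iso f, fun ⟨e, h⟩ => iso_of_components e h⟩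

end AddExt

/-- Isomorphism classes of objects of the additive extension of the centric orbit category. -/
def BurnsideClass {S : Type u} [Group S] (F : FusionSystem S) : Type (max u 1) :=
  Quotient (isIsomorphicSetoid F.AddExt)

namespace BurnsideClass

variable {S : Type u} [Group S] {F : FusionSystem S}

/-- The isomorphism class of an object. -/
def mk (X : F.AddExt) : BurnsideClass F := Quotient.mk (isIsomorphicSetoid F.AddExt) X

theorem sound {X Y : F.AddExt} (h : Nonempty (X ≅ Y)) : mk X = mk Y :=
  Quotient.sound (s := isIsomorphicSetoid F.AddExt) h

theorem ind {P : BurnsideClass F → Prop} (h : ∀ X, P (mk X)) (a : BurnsideClass F) : P a :=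
  Quotient.ind (s := isIsomorphicSetoid F.AddExt) h a

instance : Zero (BurnsideClass F) := ⟨mk (AddExt.empty F)⟩

/-- Addition is induced by coproducts. -/
instance : Add (BurnsideClass F) :=
  ⟨Quotient.map₂ (sa := isIsomorphicSetoid F.AddExt) (sb := isIsomorphicSetoid F.AddExt)
    (sc := isIsomorphicSetoid F.AddExt) AddExt.sum (by
      intro X X' h Y Y' h'
      obtain ⟨e, he⟩ := AddExt.nonempty_iso_iff.1 h
      obtain ⟨f, hf⟩ := AddExt.nonempty_iso_iff.1 h'
      exact AddExt.iso_of_components (Equiv.sumCongr e f) (by rintro (i | i); exacts [he i, hf i]))⟩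

theorem mk_add_mk (X Y : F.AddExt) : mk X + mk Y = mk (AddExt.sum X Y) := rfl

theorem zero_add' (a : BurnsideClass F) : 0 + a = a := by
  induction a using ind with
  | h X =>
    exact sound (AddExt.iso_of_components (Equiv.emptySum PEmpty X.obj.I) (by
      rintro (i | i); exacts [i.elim, ⟨Iso.refl _⟩]))

theorem add_comm' (a b : BurnsideClass F) : a + b = b + a := by
  induction a using ind with
  | h X =>
  induction b using ind with
  | h Y =>
    exact sound (AddExt.iso_of_components (Equiv.sumComm X.obj.I Y.obj.I) (by
      rintro (i | i); exacts [⟨Iso.refl _⟩, ⟨Iso.refl _⟩]))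

instance : AddCommMonoid (BurnsideClass F) where
  add_assoc a b c := by
    induction a using ind with
    | h X =>
    induction b using ind with
    | h Y =>
    induction c using ind with
    | h Z =>
      exact sound (AddExt.iso_of_components (Equiv.sumAssoc X.obj.I Y.obj.I Z.obj.I) (by
        rintro ((i | i) | i); exacts [⟨Iso.refl _⟩, ⟨Iso.refl _⟩, ⟨Iso.refl _⟩]))
  zero_add := zero_add'
  add_zero a := (add_comm' a 0).trans (zero_add' a)
  add_comm := add_comm'
  nsmul := nsmulRec

open Classical in
/-- The isomorphism class of the categorical product `H × K` in the additive extension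
(zero if there were no product). -/
def prodClass (H K : F.Centric) : BurnsideClass F :=
  if _ : Limits.HasBinaryProduct H.toAddExt K.toAddExt then
    mk (H.toAddExt ⨯ K.toAddExt) else 0

theorem prodClass_congr {H H' K K' : F.Centric} (h : Nonempty (H ≅ H')) (k : Nonempty (K ≅ K')) :
    prodClass H K = prodClass H' K' := by
  obtain ⟨h⟩ := h
  obtain ⟨k⟩ := k
  have h' : H.toAddExt ≅ H'.toAddExt :=
    ObjectProperty.isoMk _ ((Limits.FormalCoproduct.incl F.Centric).mapIso h)
  have k' : K.toAddExt ≅ K'.toAddExt :=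
    ObjectProperty.isoMk _ ((Limits.FormalCoproduct.incl F.Centric).mapIso k)
  have e : Limits.pair H.toAddExt K.toAddExt ≅ Limits.pair H'.toAddExt K'.toAddExt :=
    Limits.mapPairIso h' k'
  unfold prodClass
  by_cases hp : Limits.HasBinaryProduct H.toAddExt K.toAddExt
  · have hp' : Limits.HasBinaryProduct H'.toAddExt K'.toAddExt := Limits.hasLimit_of_iso e
    rw [dif_pos hp, dif_pos hp']
    exact sound ⟨Limits.prod.mapIso h' k'⟩
  · have hp' : ¬ Limits.HasBinaryProduct H'.toAddExt K'.toAddExt :=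
      fun t => hp (Limits.hasLimit_of_iso e.symm)
    rw [dif_neg hp, dif_neg hp']

/-- The sum over all pairs of components of two objects of the classes of their products. -/
def mulObj (X Y : F.AddExt) : BurnsideClass F :=
  haveI := X.property
  haveI := Y.property
  letI := Fintype.ofFinite X.obj.I
  letI := Fintype.ofFinite Y.obj.I
  ∑ i : X.obj.I, ∑ j : Y.obj.I, prodClass (X.obj.obj i) (Y.obj.obj j)

theorem mulObj_eq (X Y : F.AddExt) (i1 : Fintype X.obj.I) (i2 : Fintype Y.obj.I) :
    mulObj X Y = ∑ i : X.obj.I, ∑ j : Y.obj.I, prodClass (X.obj.obj i) (Y.obj.obj j) := by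
  unfold mulObj
  congr!

theorem mulObj_congr {X X' Y Y' : F.AddExt} (h : Nonempty (X ≅ X')) (h' : Nonempty (Y ≅ Y')) :
    mulObj X Y = mulObj X' Y' := by
  obtain ⟨e, he⟩ := AddExt.nonempty_iso_iff.1 h
  obtain ⟨f, hf⟩ := AddExt.nonempty_iso_iff.1 h'
  have := X.property; have := Y.property; have := X'.property; have := Y'.property
  have := Fintype.ofFinite X.obj.I; have := Fintype.ofFinite Y.obj.I
  have := Fintype.ofFinite X'.obj.I; have := Fintype.ofFinite Y'.obj.I
  rw [mulObj_eq X Y inferInstance inferInstance, mulObj_eq X' Y' inferInstance inferInstance]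
  exact Fintype.sum_equiv e _ _ fun i => Fintype.sum_equiv f _ _ fun j =>
    prodClass_congr (he i) (hf j)

theorem mulObj_sum (X Y Z : F.AddExt) :
    mulObj X (AddExt.sum Y Z) = mulObj X Y + mulObj X Z := by
  have := X.property; have := Y.property; have := Z.property
  have := Fintype.ofFinite X.obj.I; have := Fintype.ofFinite Y.obj.I
  have := Fintype.ofFinite Z.obj.I
  rw [mulObj_eq X Y inferInstance inferInstance, mulObj_eq X Z inferInstance inferInstance,
    mulObj_eq X (AddExt.sum Y Z) inferInstance
      (inferInstanceAs (Fintype (Y.obj.I ⊕ Z.obj.I))), ← Finset.sum_add_distrib]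
  exact Finset.sum_congr rfl fun i _ => Fintype.sum_sum_type _

theorem sum_mulObj (X Y Z : F.AddExt) :
    mulObj (AddExt.sum X Y) Z = mulObj X Z + mulObj Y Z := by
  have := X.property; have := Y.property; have := Z.property
  have := Fintype.ofFinite X.obj.I; have := Fintype.ofFinite Y.obj.I
  have := Fintype.ofFinite Z.obj.I
  rw [mulObj_eq X Z inferInstance inferInstance, mulObj_eq Y Z inferInstance inferInstance,
    mulObj_eq (AddExt.sum X Y) Z (inferInstanceAs (Fintype (X.obj.I ⊕ Y.obj.I))) inferInstance]
  exact Fintype.sum_sum_type _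

theorem mulObj_empty (X : F.AddExt) : mulObj X (AddExt.empty F) = 0 := by
  have := X.property
  have := Fintype.ofFinite X.obj.I
  rw [mulObj_eq X (AddExt.empty F) inferInstance (inferInstanceAs (Fintype PEmpty))]
  exact Finset.sum_eq_zero fun i _ => rfl

theorem empty_mulObj (X : F.AddExt) : mulObj (AddExt.empty F) X = 0 := by
  have := X.property
  have := Fintype.ofFinite X.obj.I
  rw [mulObj_eq (AddExt.empty F) X (inferInstanceAs (Fintype PEmpty)) inferInstance]
  rfl

/-- The multiplication is induced by the categorical product: it is the biadditive operation with
`[H] * [K] = [H × K]` for centric subgroups `H` and `K`. -/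
instance : Mul (BurnsideClass F) :=
  ⟨Quotient.lift₂ (s₁ := isIsomorphicSetoid F.AddExt) (s₂ := isIsomorphicSetoid F.AddExt) mulObj
    (fun _ _ _ _ h h' => mulObj_congr h h')⟩

theorem mk_mul_mk (X Y : F.AddExt) : mk X * mk Y = mulObj X Y := rfl

instance : NonUnitalNonAssocSemiring (BurnsideClass F) :=
  { (inferInstance : AddCommMonoid (BurnsideClass F)) with
    zero_mul := fun a => by
      induction a using ind with
      | h X => exact empty_mulObj X
    mul_zero := fun a => by
      induction a using ind with
      | h X => exact mulObj_empty X
    left_distrib := fun a b c => by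
      induction a using ind with
      | h X =>
      induction b using ind with
      | h Y =>
      induction c using ind with
      | h Z => exact mulObj_sum X Y Z
    right_distrib := fun a b c => by
      induction a using ind with
      | h X =>
      induction b using ind with
      | h Y =>
      induction c using ind with
      | h Z => exact sum_mulObj X Y Z }

end BurnsideClass

/-- The centric Burnside ring of `F` over `R`: the base change to `R` of the Grothendieck
ring of the isomorphism classes of the additive extension of the centric orbit category. -/
abbrev BurnsideRing (R : Type v) [CommRing R] {S : Type u} [Group S] (F : FusionSystem S) :
    Type (max v u 1) :=
  GrothendieckAlgebra R (BurnsideClass F)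

/-- The class of an object of the additive extension in the centric Burnside ring. -/
def BurnsideRing.cls (R : Type v) [CommRing R] {S : Type u} [Group S] {F : FusionSystem S}
    (X : F.AddExt) : BurnsideRing R F :=
  GrothendieckAlgebra.of R (BurnsideClass.mk X)

/-! ### The Mackey algebra -/

section Mackey

variable {S : Type u} [Group S] [Finite S]

/-- The class of the `(L, A)`-biset `(L × A) / Δ(C, f, g)`, where
`Δ(C, f, g) = {(f x, g x) : x ∈ C}`. -/
def diagClass {C L A : Subgroup S} (f : C →* L) (g : C →* A) : BisetClass L A :=
  BisetClass.mk (Biset.transitive (f.prod g).range)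

/-- The restriction `R_H^K`, the class of the `(H, K)`-biset `(H × K) / Δ(H, Id)`. -/
def resGen {H K : Subgroup S} (h : H ≤ K) : BisetSums S :=
  BisetSums.single H K (diagClass (MonoidHom.id H) (Subgroup.inclusion h))

/-- The induction `I_H^K`, the class of the `(K, H)`-biset `(K × H) / Δ(H, Id)`. -/
def indGen {H K : Subgroup S} (h : H ≤ K) : BisetSums S :=
  BisetSums.single K H (diagClass (Subgroup.inclusion h) (MonoidHom.id H))

/-- The conjugation `c_φ` by an isomorphism `φ : H → K`, the class of the `(K, H)`-biset
`(K × H) / Δ(H, φ)`, where `Δ(H, φ) = {(φ x, x) : x ∈ H}`. -/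
def conjGen {H K : Subgroup S} (φ : H ≃* K) : BisetSums S :=
  BisetSums.single K H (diagClass φ.toMonoidHom (MonoidHom.id H))

/-- The restrictions, the inductions, and the conjugations by isomorphisms of `F`. -/
inductive IsGen (F : FusionSystem S) : BisetSums S → Prop
  | res {H K : Subgroup S} (h : H ≤ K) : IsGen F (resGen h)
  | ind {H K : Subgroup S} (h : H ≤ K) : IsGen F (indGen h)
  | conj {H K : Subgroup S} (φ : H ≃* K) (hφ : φ.toMonoidHom ∈ F.Hom H K) : IsGen F (conjGen φ)

/-- The subsemiring generated by restrictions, inductions and conjugations. -/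
abbrev genSubsemiring (F : FusionSystem S) : Subsemiring (BisetSums S) :=
  Subsemiring.closure {a | IsGen F a}

variable (R : Type v) [CommRing R] (F : FusionSystem S)

/-- The Mackey algebra of `F` over `R`: the base change to `R` of the Grothendieck ring of this
subsemiring. -/
abbrev MackeyAlgebra : Type (max v (u + 1)) := GrothendieckAlgebra R (genSubsemiring F)

namespace MackeyAlgebra

/-- An element of the Mackey algebra given by a generator. -/
def gen (a : BisetSums S) (ha : IsGen F a) : MackeyAlgebra R F :=
  GrothendieckAlgebra.of R (⟨a, Subsemiring.subset_closure ha⟩ : genSubsemiring F)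

/-- The element `R_H^K` of the Mackey algebra. -/
def res {H K : Subgroup S} (h : H ≤ K) : MackeyAlgebra R F := gen R F _ (IsGen.res h)

/-- The element `I_H^K` of the Mackey algebra. -/
def ind {H K : Subgroup S} (h : H ≤ K) : MackeyAlgebra R F := gen R F _ (IsGen.ind h)

/-- The element `c_φ` of the Mackey algebra, for an isomorphism `φ` of `F`. -/
def conj {H K : Subgroup S} (φ : H ≃* K) (hφ : φ.toMonoidHom ∈ F.Hom H K) :
    MackeyAlgebra R F := gen R F _ (IsGen.conj φ hφ)

/-- The idempotent `I_H^H`. -/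
def idem (H : Subgroup S) : MackeyAlgebra R F := ind R F (le_refl H)

/-- The element `I_{φ(A)}^K c_φ`, for a morphism `φ : A → K` of the orbit category (computed with a
representative of `φ`). -/
def indConj {A K : Subgroup S} (φ : F.OrbitHom A K) : MackeyAlgebra R F :=
  ind R F (FusionSystem.image_le φ.rep) * conj R F (F.toImage φ.rep_mem) (F.toImage_mem φ.rep_mem)

/-- The element `c_{φ⁻¹} R_{φ(A)}^K`, for a morphism `φ : A → K` of the orbit category (computed with
a representative of `φ`). -/
def conjRes {A K : Subgroup S} (φ : F.OrbitHom A K) : MackeyAlgebra R F :=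
  conj R F (F.toImage φ.rep_mem).symm (F.toImage_symm_mem φ.rep_mem) *
    res R F (FusionSystem.image_le φ.rep)

/-- The generators of the Mackey algebra of the fusion system `F_H(H)` on a subgroup `H` of `S`,
inside the Mackey algebra of `F`. -/
inductive IsInnerGen (H : Subgroup S) : MackeyAlgebra R F → Prop
  | res {A B : Subgroup S} (h : A ≤ B) (hB : B ≤ H) : IsInnerGen H (res R F h)
  | ind {A B : Subgroup S} (h : A ≤ B) (hB : B ≤ H) : IsInnerGen H (ind R F h)
  | conj {A B : Subgroup S} (hA : A ≤ H) (hB : B ≤ H) (φ : A ≃* B)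
      (hφ : φ.toMonoidHom ∈ F.Hom A B) (x : S) (hx : x ∈ H)
      (h : ∀ a : A, (φ a : S) = x * a * x⁻¹) : IsInnerGen H (conj R F φ hφ)

/-- The Mackey algebra of `F_H(H)`, as a (non-unital) subalgebra of the Mackey algebra of `F`. -/
def inner (H : Subgroup S) : NonUnitalSubalgebra R (MackeyAlgebra R F) :=
  NonUnitalAlgebra.adjoin R {a | IsInnerGen R F H a}

open Classical in
/-- The identity `∑_{K ≤ H} I_K^K` of the Mackey algebra of `F_H(H)`. -/
def innerOne (H : Subgroup S) : MackeyAlgebra R F :=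
  ∑ K ∈ (BisetSums.subgroups S).filter (· ≤ H), idem R F K

/-- The two-sided ideal generated by the idempotents of the non-centric subgroups. -/
def noncentricIdeal : TwoSidedIdeal (MackeyAlgebra R F) :=
  TwoSidedIdeal.span {a | ∃ K : Subgroup S, ¬ F.IsCentric K ∧ a = idem R F K}

end MackeyAlgebra

/-- The quotient of the Mackey algebra by the ideal generated by the idempotents of the
non-centric subgroups. -/
abbrev CentricMackeyAlgebra : Type (max v (u + 1)) :=
  MackeyAlgebra R F ⧸ (MackeyAlgebra.noncentricIdeal R F).asIdeal

/-! ### The maps `θ_H` and `θ^H` -/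

variable (H : Subgroup S) (M : Type w) [AddCommGroup M] [Module (MackeyAlgebra R F) M]

/-- The Mackey functor `M_H`: the restriction `1 · M` of `M` to `F_H(H)`, induced to `F`, that is
`μ 1 ⊗ 1 M`, where `μ` is the Mackey algebra of `F`, the tensor product is over the Mackey algebra
of `F_H(H)`, and `1` is the identity of the latter. -/
abbrev ResIndFunctor : Type (max v (u + 1) w) :=
  ResInd (MackeyAlgebra.inner R F H : Set (MackeyAlgebra R F)) (MackeyAlgebra.innerOne R F H) M

/-- The map `θ_H : M_H → M`, `y ⊗ x ↦ y x`. -/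
def thetaDown : ResIndFunctor R F H M →ₗ[MackeyAlgebra R F] M :=
  ResInd.eval _ _ M

/-- The map `θ^H : M → M_H`, for `F`-centric `M`. It sends `z ∈ I_K^K M`, for `K` centric, to the sum
over `(A, φ) ∈ [H × K]` of the elements `I_{φ(A)}^K c_φ ⊗ c_{φ⁻¹} R_{φ(A)}^K z`. -/
def thetaUp : M →+ ResIndFunctor R F H M :=
  ∑ K : F.Centric, ∑ q : F.ProdIndex H K.grp,
    (ResInd.tmulHom _ _ (MackeyAlgebra.indConj R F q.rep.hom)).comp
      (DistribSMul.toAddMonoidHom M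
        (MackeyAlgebra.conjRes R F q.rep.hom * MackeyAlgebra.idem R F K.grp))

end Mackey

/-- A Mackey functor `M` over `F` is `G`-centric if `I_K^K M = 0` for all `K ≤ S` that are not
`G`-centric, where `F` is a fusion system over `S` contained in `G` through `j`. -/
def IsCentricModule {S : Type u} [Group S] [Finite S] (R : Type v) [CommRing R]
    (F : FusionSystem S) {T : Type w} [Group T] (G : FusionSystem T) (j : S →* T)
    (M : Type x) [AddCommGroup M] [Module (MackeyAlgebra R F) M] : Prop :=
  ∀ K : Subgroup S, ¬ G.IsCentric (K.map j) → ∀ m : M, MackeyAlgebra.idem R F K • m = 0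

/-- A ring is `p`-local if all primes other than `p` are invertible in it. -/
def IsPLocal (p : ℕ) (R : Type v) [CommRing R] : Prop :=
  ∀ q : ℕ, q.Prime → q ≠ p → IsUnit (q : R)

/-- `e` is an identity element for the multiplication of `B`. -/
def IsIdentity {B : Type v} [Mul B] (e : B) : Prop := ∀ b : B, e * b = b ∧ b * e = b

end

end CentricMackey

open CentricMackey

namespace CentricMackey

noncomputable section

open scoped TensorProduct

section

/-! ### Normalizers in finite `p`-groups -/

/-! Saturation is given in a weak form: `Aut_S(S)` is Sylow in `Aut_F(S)`, and morphisms with fully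
normalized image extend to their extender. It follows that fully normalized subgroups are fully
automized (`IsSaturated.exists_sylow_eq_range`), and then two facts about an `F`-centric `P`: a
morphism on `P` extends to every subgroup of `N_S(P)` on which the evident obstruction vanishes
(`IsSaturated.exists_extension`), and restriction to `P` is injective on morphisms up to conjugation
(`IsSaturated.exists_conj`). So two extensions of one morphism have a common extension, and the
coproduct of the groups `A` over `[H × K]` represents `Hom(-, H) × Hom(-, K)`
(`IsSaturated.prodMap_bijective`). This gives the products.

After that everything is done by counting. The marks `[X] ↦ |Hom(P, X)|` are multiplicative, and
they separate the elements of the Grothendieck ring because the table of marks is triangular. On the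
Mackey side a finite `K`-set `X` gives the biset `X × K`, whose class modulo the ideal `I` depends
only on the numbers of fixed points of the centric `P ≤ K` (`bar_eq_of_fixCard`). The bridge is
`IsSaturated.fixCard_prodSet`: the `K`-set `∐ K / φ(A)` over `[H × K]` has `|Hom(P, H)|` fixed
points under `P`, a number that does not involve `K`. This `K`-set is the component at `K` of
`θ_H(θ^H(1))`, so it may be replaced by the restriction to `K` of one `S`-set. Elements coming from
`S`-sets add and multiply like the `S`-sets, commute with restrictions and inductions for formal
reasons, and commute with conjugations because the marks are invariant under `F`-isomorphism. Hence
`Γ` is a homomorphism into the center.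

Identity: orbit counting for `N_S(P)` acting on `Hom(P, H)` gives congruences between marks, from
which an element with constant mark `n` prime to `p` is built one isomorphism class at a time
(`GrothendieckRing.exists_const_mark_on`). Over a `p`-local ring it can be divided by `n`.

Injectivity: sending a `(K, K)`-biset to the sum of the classes of its point stabilizers defines an
additive map from `μ(F) / I` to the Burnside ring. It kills `I` because all bisets in `μ(F)` have
stabilizers that are graphs of morphisms of `F`, so a biset that factors through a group that is not
centric has no centric stabilizer. Composed with `Γ` it is multiplication by `[K]`
(`stabBar_burnsideHom`), and an element that is not a zero divisor is a combination of such `[K]`.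

For the second part, `G`-centric implies `F`-centric, so `M` is a module over `μ(F) / I`, on which
the center acts by endomorphisms; and `θ_H θ^H` is multiplication by the same element of `μ(F)` on
every module (`thetaDown_thetaUp`). -/

theorem exists_mem_normalizer_of_lt {p : ℕ} [Fact p.Prime] {G : Type u} [Group G]
    {A U : Subgroup G} [Finite U] (hU : IsPGroup p U) (h : A < U) :
    ∃ g ∈ U, g ∉ A ∧ g ∈ Subgroup.normalizer (A : Set G) := by
  have := hU.isNilpotent
  have hlt : A.subgroupOf U < ⊤ := by
    rw [lt_top_iff_ne_top, Ne, Subgroup.subgroupOf_eq_top]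
    exact fun h' => h.not_ge h'
  obtain ⟨g, hg, hg'⟩ := SetLike.exists_of_lt (Group.normalizerCondition_of_isNilpotent _ hlt)
  refine ⟨g, g.2, fun hA => hg' hA, ?_⟩
  rw [Subgroup.mem_normalizer_iff] at hg ⊢
  intro a
  constructor
  · intro ha
    exact (hg ⟨a, h.le ha⟩).1 ha
  · intro ha
    have haU : a ∈ U := by
      have := U.mul_mem (U.mul_mem (U.inv_mem g.2) (h.le ha)) g.2
      convert this using 1
      group
    exact (hg ⟨a, haU⟩).2 ha

theorem mem_normalizer_of_forall {G : Type u} [Group G] [Finite G] {A : Subgroup G} {g : G}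
    (h : ∀ a ∈ A, g * a * g⁻¹ ∈ A) : g ∈ Subgroup.normalizer (A : Set G) :=
  Subgroup.mem_normalizer_fintype h

theorem lt_inf_normalizer {p : ℕ} [Fact p.Prime] {G : Type u} [Group G] [Finite G]
    (hG : IsPGroup p G) {A U : Subgroup G} (h : A < U) :
    A < U ⊓ Subgroup.normalizer (A : Set G) := by
  obtain ⟨g, hg, hgA, hn⟩ := exists_mem_normalizer_of_lt (hG.to_subgroup U) h
  exact lt_of_le_of_ne (le_inf h.le Subgroup.le_normalizer)
    fun e => hgA (e ▸ (⟨hg, hn⟩ : g ∈ U ⊓ Subgroup.normalizer (A : Set G)))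

namespace FusionSystem

variable {S : Type u} [Group S] (F : FusionSystem S)

/-! ### Morphisms of a fusion system as maps on the ambient group -/

/-- The restriction of `f : S → S` to `H` is a morphism of the fusion system. -/
def IsMor (H : Subgroup S) (f : S → S) : Prop :=
  ∃ φ ∈ F.Hom H ⊤, ∀ x : H, (φ x : S) = f x

open Classical in
/-- Extension by one of a homomorphism of subgroups to a function on the ambient group. -/
def extendFun {H K : Subgroup S} (φ : H →* K) (x : S) : S :=
  if h : x ∈ H then φ ⟨x, h⟩ else 1

theorem extendFun_coe {H K : Subgroup S} (φ : H →* K) (x : H) : extendFun φ x = φ x := by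
  simp [extendFun]

theorem extendFun_of_mem {H K : Subgroup S} (φ : H →* K) {x : S} (h : x ∈ H) :
    extendFun φ x = φ ⟨x, h⟩ := by
  simp [extendFun, h]

/-- The image of a subgroup under a function. -/
def im (H : Subgroup S) (f : S → S) : Subgroup S := Subgroup.closure (f '' H)

theorem im_congr {H : Subgroup S} {f g : S → S} (h : ∀ x ∈ H, f x = g x) : im H f = im H g := by
  rw [im, im, Set.image_congr h]

variable {F}

theorem isMor_extendFun {H K : Subgroup S} {φ : H →* K} (hφ : φ ∈ F.Hom H K) :
    F.IsMor H (extendFun φ) :=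
  ⟨_, F.comp_mem hφ (F.inclusion_mem le_top), fun x => (extendFun_coe φ x).symm⟩

/-- Membership in `F` depends only on the values: a morphism factors through the isomorphism onto
its image, and the image includes into any subgroup containing it. This is what makes it possible to
treat morphisms as plain maps `S → S` and ignore codomains. -/
theorem mem_hom_of_coe_eq {H K L : Subgroup S} {φ : H →* K} {ψ : H →* L} (hφ : φ ∈ F.Hom H K)
    (h : ∀ x, (ψ x : S) = φ x) : ψ ∈ F.Hom H L := by
  have hle : image φ ≤ L := by
    rintro _ ⟨x, rfl⟩
    have := (ψ x).2
    rw [h x] at this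
    exact this
  have := F.comp_mem (F.toImage_mem hφ) (F.inclusion_mem hle)
  convert this using 1
  ext x
  exact h x

namespace IsMor

variable {H K : Subgroup S} {f g : S → S}

theorem exists_hom (hf : F.IsMor H f) (h : ∀ x ∈ H, f x ∈ K) :
    ∃ φ ∈ F.Hom H K, ∀ x : H, (φ x : S) = f x := by
  obtain ⟨φ, hφ, hx⟩ := hf
  have hK : ∀ x : H, (φ x : S) ∈ K := fun x => hx x ▸ h x x.2
  refine ⟨(((⊤ : Subgroup S).subtype.comp φ).codRestrict K hK), mem_hom_of_coe_eq hφ ?_, hx⟩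
  intro x
  rfl

theorem congr (hf : F.IsMor H f) (h : ∀ x ∈ H, g x = f x) : F.IsMor H g := by
  obtain ⟨φ, hφ, hx⟩ := hf
  exact ⟨φ, hφ, fun x => (hx x).trans (h x x.2).symm⟩

theorem map_mul (hf : F.IsMor H f) {x y : S} (hx : x ∈ H) (hy : y ∈ H) :
    f (x * y) = f x * f y := by
  obtain ⟨φ, hφ, h⟩ := hf
  have := congrArg (Subtype.val) (_root_.map_mul φ ⟨x, hx⟩ ⟨y, hy⟩)
  simpa [h] using this

theorem map_one (hf : F.IsMor H f) : f 1 = 1 := by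
  obtain ⟨φ, hφ, h⟩ := hf
  have := h 1
  simpa using this.symm

theorem map_inv (hf : F.IsMor H f) {x : S} (hx : x ∈ H) : f x⁻¹ = (f x)⁻¹ := by
  rw [eq_inv_iff_mul_eq_one, ← hf.map_mul (H.inv_mem hx) hx, inv_mul_cancel, hf.map_one]

theorem map_conj (hf : F.IsMor H f) {x y : S} (hx : x ∈ H) (hy : y ∈ H) :
    f (x * y * x⁻¹) = f x * f y * (f x)⁻¹ := by
  rw [hf.map_mul (H.mul_mem hx hy) (H.inv_mem hx), hf.map_mul hx hy, hf.map_inv hx]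

theorem injOn (hf : F.IsMor H f) {x y : S} (hx : x ∈ H) (hy : y ∈ H) (h : f x = f y) :
    x = y := by
  obtain ⟨φ, hφ, e⟩ := hf
  have := F.injective hφ (a₁ := ⟨x, hx⟩) (a₂ := ⟨y, hy⟩)
    (Subtype.ext ((e ⟨x, hx⟩).trans (h.trans (e ⟨y, hy⟩).symm)))
  exact congrArg Subtype.val this

theorem mono (hf : F.IsMor H f) (h : K ≤ H) : F.IsMor K f := by
  obtain ⟨φ, hφ, hx⟩ := hf
  exact ⟨_, F.comp_mem (F.inclusion_mem h) hφ, fun x => hx _⟩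

theorem comp (hf : F.IsMor H f) (hg : F.IsMor K g) (h : ∀ x ∈ H, f x ∈ K) :
    F.IsMor H (fun x => g (f x)) := by
  obtain ⟨φ, hφ, hx⟩ := hf.exists_hom h
  obtain ⟨ψ, hψ, hy⟩ := hg
  exact ⟨_, F.comp_mem hφ hψ, fun x => (hy _).trans (congrArg g (hx x))⟩

theorem coe_im (hf : F.IsMor H f) : (im H f : Set S) = f '' H := by
  obtain ⟨φ, hφ, hx⟩ := hf
  have : f '' H = (image φ : Set S) := by
    ext y
    constructor
    · rintro ⟨x, h, rfl⟩
      exact ⟨⟨x, h⟩, hx _⟩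
    · rintro ⟨x, rfl⟩
      exact ⟨x, x.2, (hx x).symm⟩
  rw [im, this, Subgroup.closure_eq]

theorem mem_im (hf : F.IsMor H f) {y : S} : y ∈ im H f ↔ ∃ x ∈ H, f x = y := by
  rw [← SetLike.mem_coe, hf.coe_im]
  rfl

theorem mem_im_of_mem (hf : F.IsMor H f) {x : S} (hx : x ∈ H) : f x ∈ im H f :=
  hf.mem_im.2 ⟨x, hx, rfl⟩

theorem im_le (hf : F.IsMor H f) (h : ∀ x ∈ H, f x ∈ K) : im H f ≤ K := by
  intro y hy
  obtain ⟨x, hx, rfl⟩ := hf.mem_im.1 hy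
  exact h x hx

theorem exists_inv (hf : F.IsMor H f) :
    ∃ g, F.IsMor (im H f) g ∧ (∀ x ∈ H, g (f x) = x) ∧ (∀ y ∈ im H f, g y ∈ H) ∧
      ∀ y ∈ im H f, f (g y) = y := by
  have hf' := hf
  obtain ⟨φ, hφ, hx⟩ := hf
  have him : im H f = image φ := by
    ext y
    rw [hf'.mem_im]
    constructor
    · rintro ⟨x, h, rfl⟩
      exact ⟨⟨x, h⟩, hx _⟩
    · rintro ⟨x, rfl⟩
      exact ⟨x, x.2, (hx x).symm⟩
  have key : ∀ x ∈ H, extendFun (F.toImage hφ).symm.toMonoidHom (f x) = x := by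
    intro x h
    have hm : f x ∈ image φ := him ▸ hf'.mem_im_of_mem h
    rw [extendFun_of_mem _ hm]
    have : (F.toImage hφ).symm ⟨f x, hm⟩ = ⟨x, h⟩ := by
      rw [MulEquiv.symm_apply_eq]
      exact Subtype.ext (hx ⟨x, h⟩).symm
    exact congrArg Subtype.val this
  refine ⟨extendFun (F.toImage hφ).symm.toMonoidHom,
    by rw [him]; exact isMor_extendFun (F.toImage_symm_mem hφ), key, ?_, ?_⟩
  · intro y hy
    obtain ⟨x, h, rfl⟩ := hf'.mem_im.1 hy
    rwa [key x h]
  · intro y hy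
    obtain ⟨x, h, rfl⟩ := hf'.mem_im.1 hy
    rw [key x h]

theorem card_im (hf : F.IsMor H f) : Nat.card (im H f) = Nat.card H := by
  refine Nat.card_congr (Equiv.ofBijective
    (fun x : H => (⟨f x, hf.mem_im_of_mem x.2⟩ : im H f)) ⟨?_, ?_⟩).symm
  · intro x y h
    exact Subtype.ext (hf.injOn x.2 y.2 (congrArg Subtype.val h))
  · rintro ⟨y, hy⟩
    obtain ⟨x, hx, rfl⟩ := hf.mem_im.1 hy
    exact ⟨⟨x, hx⟩, rfl⟩

theorem im_im (hf : F.IsMor H f) (hg : F.IsMor (im H f) g) :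
    im (im H f) g = im H (fun x => g (f x)) := by
  ext y
  rw [hg.mem_im, (hf.comp hg fun x hx => hf.mem_im_of_mem hx).mem_im]
  constructor
  · rintro ⟨z, hz, rfl⟩
    obtain ⟨x, hx, rfl⟩ := hf.mem_im.1 hz
    exact ⟨x, hx, rfl⟩
  · rintro ⟨x, hx, rfl⟩
    exact ⟨f x, hf.mem_im_of_mem hx, rfl⟩

end IsMor

variable (F) in
theorem isMor_conj (s : S) (H : Subgroup S) : F.IsMor H (fun x => s * x * s⁻¹) :=
  ⟨_, F.conj_mem s H ⊤ fun _ _ => Subgroup.mem_top _, fun _ => rfl⟩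

theorem conj_iff {H K : Subgroup S} : F.Conj H K ↔ ∃ f, F.IsMor H f ∧ im H f = K := by
  constructor
  · rintro ⟨e, he⟩
    refine ⟨_, isMor_extendFun he, ?_⟩
    ext y
    rw [(isMor_extendFun he).mem_im]
    constructor
    · rintro ⟨x, hx, rfl⟩
      rw [extendFun_of_mem _ hx]
      exact SetLike.coe_mem _
    · intro hy
      refine ⟨e.symm ⟨y, hy⟩, (e.symm ⟨y, hy⟩).2, ?_⟩
      rw [extendFun_coe]
      exact congrArg Subtype.val (e.apply_symm_apply ⟨y, hy⟩)
  · rintro ⟨f, hf, rfl⟩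
    obtain ⟨φ, hφ, h⟩ := hf.exists_hom (K := im H f) fun x hx => hf.mem_im_of_mem hx
    refine ⟨MulEquiv.ofBijective φ ⟨F.injective hφ, ?_⟩, hφ⟩
    rintro ⟨y, hy⟩
    obtain ⟨x, hx, rfl⟩ := hf.mem_im.1 hy
    exact ⟨⟨x, hx⟩, Subtype.ext (h _)⟩

theorem Conj.symm {H K : Subgroup S} (h : F.Conj H K) : F.Conj K H := by
  obtain ⟨f, hf, rfl⟩ := conj_iff.1 h
  obtain ⟨g, hg, h1, h2, h3⟩ := hf.exists_inv
  refine conj_iff.2 ⟨g, hg, ?_⟩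
  ext y
  rw [hg.mem_im]
  exact ⟨by rintro ⟨x, hx, rfl⟩; exact h2 x hx,
    fun hy => ⟨f y, hf.mem_im_of_mem hy, h1 y hy⟩⟩

theorem Conj.trans {H K L : Subgroup S} (h : F.Conj H K) (h' : F.Conj K L) : F.Conj H L := by
  obtain ⟨e, he⟩ := h
  obtain ⟨e', he'⟩ := h'
  exact ⟨e.trans e', F.comp_mem he he'⟩

theorem Conj.card_eq {H K : Subgroup S} (h : F.Conj H K) : Nat.card H = Nat.card K :=
  Nat.card_congr h.choose.toEquiv

theorem IsMor.conj_im {H : Subgroup S} {f : S → S} (hf : F.IsMor H f) : F.Conj H (im H f) :=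
  conj_iff.2 ⟨f, hf, rfl⟩

/-! ### Centric subgroups -/

theorem IsCentric.of_conj {H K : Subgroup S} (hH : F.IsCentric H) (h : F.Conj H K) :
    F.IsCentric K := fun L hL => hH L (h.trans hL)

theorem IsCentric.im {H : Subgroup S} {f : S → S} (hH : F.IsCentric H) (hf : F.IsMor H f) :
    F.IsCentric (im H f) := hH.of_conj hf.conj_im

/-- Centralizers shrink when the group grows: for `L = f(K)` one has `C_S(L) ≤ C_S(f(H)) ≤ f(H) ≤
L`. -/
theorem IsCentric.mono {H K : Subgroup S} (hH : F.IsCentric H) (h : H ≤ K) : F.IsCentric K := by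
  intro L hL
  obtain ⟨f, hf, rfl⟩ := conj_iff.1 hL
  have hle : FusionSystem.im H f ≤ FusionSystem.im K f :=
    (hf.mono h).im_le fun x hx => hf.mem_im_of_mem (h hx)
  exact (Subgroup.centralizer_le hle).trans ((hH _ (hf.mono h).conj_im).trans hle)

theorem IsCentric.of_mor {H K : Subgroup S} {f : S → S} (hH : F.IsCentric H) (hf : F.IsMor H f)
    (h : ∀ x ∈ H, f x ∈ K) : F.IsCentric K := (hH.im hf).mono (hf.im_le h)

theorem Conj.refl (H : Subgroup S) : F.Conj H H := ⟨MulEquiv.refl H, F.id_mem H⟩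

theorem IsCentric.mem_of_commute {H : Subgroup S} (hH : F.IsCentric H) {s : S}
    (h : ∀ x ∈ H, s * x * s⁻¹ = x) : s ∈ H := by
  refine hH H (Conj.refl H) ?_
  rw [Subgroup.mem_centralizer_iff]
  intro x hx
  nth_rewrite 1 [← h x hx]
  group

/-- Two elements of `S` that conjugate a centric image in the same way differ by an element
of the image. -/
theorem IsCentric.inv_mul_mem {H : Subgroup S} {f : S → S} (hH : F.IsCentric H)
    (hf : F.IsMor H f) {s t : S} (h : ∀ x ∈ H, s * f x * s⁻¹ = t * f x * t⁻¹) :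
    s⁻¹ * t ∈ FusionSystem.im H f := by
  refine (hH.im hf).mem_of_commute fun y hy => ?_
  obtain ⟨x, hx, rfl⟩ := hf.mem_im.1 hy
  have := h x hx
  calc s⁻¹ * t * f x * (s⁻¹ * t)⁻¹ = s⁻¹ * (t * f x * t⁻¹) * s := by group
    _ = f x := by rw [← this]; group

end FusionSystem

end

section

namespace FusionSystem

variable {S : Type u} [Group S] {F : FusionSystem S}

/-! ### Consequences of saturation -/

theorem symm_mem {H K : Subgroup S} {e : H ≃* K} (he : e.toMonoidHom ∈ F.Hom H K) :
    e.symm.toMonoidHom ∈ F.Hom K H := by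
  obtain ⟨g, hg, h1, -, -⟩ := (isMor_extendFun he).exists_inv
  have him : K ≤ im H (extendFun e.toMonoidHom) := by
    intro y hy
    rw [(isMor_extendFun he).mem_im]
    refine ⟨e.symm ⟨y, hy⟩, (e.symm ⟨y, hy⟩).2, ?_⟩
    rw [extendFun_coe]
    exact congrArg Subtype.val (e.apply_symm_apply ⟨y, hy⟩)
  have key : ∀ y : K, g y = e.symm y := fun y => by
    have := h1 (e.symm y) (e.symm y).2
    rw [extendFun_coe] at this
    rw [← this]
    exact congrArg g (congrArg Subtype.val (e.apply_symm_apply y)).symm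
  obtain ⟨φ, hφ, h⟩ := (hg.mono him).exists_hom (K := H) fun x hx => by
    rw [key ⟨x, hx⟩]; exact SetLike.coe_mem _
  exact mem_hom_of_coe_eq hφ fun y => ((h y).trans (key y)).symm

theorem mem_aut {H : Subgroup S} {e : MulAut H} :
    e ∈ F.aut H ↔ e.toMonoidHom ∈ F.Hom H H := Iff.rfl

/-- An endomorphism of `H` given by a function is an automorphism. -/
theorem IsMor.exists_aut [Finite S] {H : Subgroup S} {f : S → S} (hf : F.IsMor H f)
    (h : ∀ x ∈ H, f x ∈ H) : ∃ e : F.aut H, ∀ x : H, ((e : MulAut H) x : S) = f x := by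
  obtain ⟨φ, hφ, hx⟩ := hf.exists_hom h
  exact ⟨⟨MulEquiv.ofBijective φ (Finite.injective_iff_bijective.1 (F.injective hφ)), hφ⟩, hx⟩

theorem aut_ext {H : Subgroup S} {a b : F.aut H}
    (h : ∀ x : H, ((a : MulAut H) x : S) = (b : MulAut H) x) : a = b :=
  Subtype.ext (MulEquiv.ext fun x => Subtype.ext (h x))

variable (F) in
/-- The action of the normalizer of `H` on `H` by automorphisms of the fusion system. -/
def normalizerHom (H : Subgroup S) : Subgroup.normalizer (H : Set S) →* F.aut H :=
  (Subgroup.normalizerMonoidHom H).codRestrict (F.aut H) fun n =>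
    mem_hom_of_coe_eq (F.conj_mem (n : S) H ⊤ fun _ _ => Subgroup.mem_top _) fun _ => rfl

theorem normalizerHom_apply {H : Subgroup S} (n : Subgroup.normalizer (H : Set S)) (x : H) :
    ((F.normalizerHom H n : MulAut H) x : S) = n * x * (n : S)⁻¹ := rfl

theorem mem_range_normalizerHom [Finite S] {H : Subgroup S} {e : F.aut H} {s : S}
    (h : ∀ x : H, ((e : MulAut H) x : S) = s * x * s⁻¹) : e ∈ (F.normalizerHom H).range :=
  ⟨⟨s, mem_normalizer_of_forall fun x hx => by
    rw [← h ⟨x, hx⟩]; exact SetLike.coe_mem _⟩, aut_ext fun x => (h x).symm⟩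

/-- Conjugation with an isomorphism of the fusion system. -/
def autCongr {H K : Subgroup S} (e : H ≃* K) (he : e.toMonoidHom ∈ F.Hom H K) :
    F.aut H →* F.aut K where
  toFun a := ⟨e.symm.trans ((a : MulAut H).trans e),
    F.comp_mem (symm_mem he) (F.comp_mem a.2 he)⟩
  map_one' := aut_ext fun x => by simp
  map_mul' a b := aut_ext fun x => by simp

theorem exists_fullyNormalized [Finite S] (F : FusionSystem S) (H : Subgroup S) :
    ∃ K, F.Conj H K ∧ F.FullyNormalized K := by
  obtain ⟨K, hK, h⟩ := Set.exists_max_image {K | F.Conj H K}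
    (fun K => Nat.card (Subgroup.normalizer (K : Set S))) (Set.toFinite _) ⟨H, Conj.refl H⟩
  exact ⟨K, hK, fun L hL => h L (Conj.trans hK hL)⟩

/-- Carry `U` over to a `p`-subgroup of `F.aut R`, move it into the Sylow subgroup `Aut_S(R)` by
conjugation in `F.aut R`, and absorb the conjugating element into the isomorphism `Q → R`. The
elements of `U` then become conjugations by elements of `N_S(R)`. -/
theorem exists_mor_of_sylow {p : ℕ} [Fact p.Prime] [Finite S] {Q R : Subgroup S}
    (h : F.Conj Q R) (P : Sylow p (F.aut R)) (hP : (P : Subgroup (F.aut R)) =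
      (F.normalizerHom R).range) {U : Subgroup (F.aut Q)} (hU : IsPGroup p U) :
    ∃ f, F.IsMor Q f ∧ im Q f = R ∧ ∀ a ∈ U, ∃ y ∈ Subgroup.normalizer (R : Set S),
      ∀ x : Q, f ((a : MulAut Q) x) = y * f x * y⁻¹ := by
  obtain ⟨e, he⟩ := h
  obtain ⟨P', hP'⟩ := (hU.map (autCongr e he)).exists_le_sylow
  obtain ⟨g, hg⟩ := MulAction.exists_smul_eq (F.aut R) P' P
  have hc : (e.trans (g : MulAut R)).toMonoidHom ∈ F.Hom Q R := F.comp_mem he g.2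
  refine ⟨_, isMor_extendFun hc, ?_, fun a ha => ?_⟩
  · ext y
    rw [(isMor_extendFun hc).mem_im]
    constructor
    · rintro ⟨x, hx, rfl⟩
      rw [extendFun_of_mem _ hx]
      exact SetLike.coe_mem _
    · intro hy
      refine ⟨_, ((e.trans (g : MulAut R)).symm ⟨y, hy⟩).2, ?_⟩
      rw [extendFun_coe]
      exact congrArg Subtype.val ((e.trans (g : MulAut R)).apply_symm_apply ⟨y, hy⟩)
  · have h1 : g * autCongr e he a * g⁻¹ ∈ (F.normalizerHom R).range := by
      rw [← hP, ← hg, Sylow.coe_subgroup_smul]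
      exact Subgroup.smul_mem_pointwise_smul _ (MulAut.conj g) _
        (hP' (Subgroup.mem_map_of_mem _ ha))
    obtain ⟨n, hn⟩ := h1
    refine ⟨n, n.2, fun x => ?_⟩
    rw [extendFun_coe, extendFun_coe]
    have := normalizerHom_apply (F := F) n ((g : MulAut R) (e x))
    rw [hn] at this
    rw [MulEquiv.toMonoidHom_eq_coe, MonoidHom.coe_coe, MulEquiv.trans_apply,
      MulEquiv.trans_apply, ← this]
    simp [autCongr]

/-- The extension axiom for maps on `S`. Here `z` only has to induce the right conjugation; that it
normalizes the image is automatic, since `x` normalizes `H`. -/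
theorem IsSaturated.exists_extension_of_fullyNormalized {p : ℕ} (hF : F.IsSaturated p)
    {H N : Subgroup S} {f : S → S} (hf : F.IsMor H f) (hn : F.FullyNormalized (im H f))
    (hHN : H ≤ N) (hN : N ≤ Subgroup.normalizer (H : Set S))
    (h : ∀ x ∈ N, ∃ z, ∀ a ∈ H, f (x * a * x⁻¹) = z * f a * z⁻¹) :
    ∃ g, F.IsMor N g ∧ ∀ x ∈ H, g x = f x := by
  have hf' := hf
  obtain ⟨φ, hφ, hx⟩ := hf
  have him : image φ = im H f := by
    ext y
    rw [hf'.mem_im]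
    constructor
    · rintro ⟨x, rfl⟩
      exact ⟨x, x.2, (hx x).symm⟩
    · rintro ⟨x, h, rfl⟩
      exact ⟨⟨x, h⟩, hx _⟩
  obtain ⟨ψ, hψ, hext⟩ := hF.extend H φ hφ (him ▸ hn)
  have hle : N ≤ extender φ := by
    intro x hxN
    obtain ⟨z, hz⟩ := h x hxN
    have hxn := hN hxN
    rw [Subgroup.mem_normalizer_iff] at hxn
    refine ⟨hN hxN, z, ?_, fun a a' e => ?_⟩
    · rw [him, Subgroup.mem_normalizer_iff]
      intro y
      constructor
      · intro hy
        obtain ⟨a, ha, rfl⟩ := hf'.mem_im.1 hy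
        rw [← hz a ha]
        exact hf'.mem_im_of_mem ((hxn a).1 ha)
      · intro hy
        obtain ⟨b, hb, e⟩ := hf'.mem_im.1 hy
        have hb' : x⁻¹ * b * x ∈ H := by
          rw [hxn]; convert hb using 1; group
        have := hz _ hb'
        have e2 : x * (x⁻¹ * b * x) * x⁻¹ = b := by group
        rw [e2, e] at this
        have : y = f (x⁻¹ * b * x) := by
          simpa using this
        rw [this]
        exact hf'.mem_im_of_mem hb'
    · rw [hx, hx, e, hz a a.2]
  refine ⟨extendFun ψ, (isMor_extendFun hψ).mono hle, fun x hxH => ?_⟩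
  rw [extendFun_of_mem _ (hle (hHN hxH)), hext x hxH, hx]

theorem IsSaturated.sylow_top {p : ℕ} [Finite S] (hF : F.IsSaturated p) :
    ∃ P : Sylow p (F.aut ⊤), (P : Subgroup (F.aut ⊤)) = (F.normalizerHom ⊤).range := by
  obtain ⟨P, hP⟩ := hF.sylow
  refine ⟨P, ?_⟩
  ext a
  have : a ∈ (P : Subgroup (F.aut ⊤)) ↔ (a : MulAut (⊤ : Subgroup S)) ∈
      (MulAut.conj : (⊤ : Subgroup S) →* MulAut (⊤ : Subgroup S)).range := by
    rw [← hP]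
    simp
  rw [this]
  constructor
  · rintro ⟨s, hs⟩
    exact mem_range_normalizerHom (s := s) fun x => by rw [← hs]; rfl
  · rintro ⟨n, rfl⟩
    exact ⟨⟨n, Subgroup.mem_top _⟩, MulEquiv.ext fun x => rfl⟩

/-- A fully normalized subgroup is fully automized. -/
theorem IsSaturated.exists_sylow_eq_range {p : ℕ} [Fact p.Prime] [Finite S] (hS : IsPGroup p S)
    (hF : F.IsSaturated p) (R : Subgroup S) (hR : F.FullyNormalized R) :
    ∃ P : Sylow p (F.aut R), (P : Subgroup (F.aut R)) = (F.normalizerHom R).range := by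
  -- Downward induction on the order of `R`; the case `R = ⊤` is the Sylow axiom.
  induction hk : Nat.card S - Nat.card R using Nat.strong_induction_on generalizing R with
  | h k ih =>
  by_cases htop : R = ⊤
  · subst htop; exact hF.sylow_top
  have hp : IsPGroup p (F.normalizerHom R).range := by
    have := (hS.to_subgroup (Subgroup.normalizer (R : Set S))).of_surjective
      (F.normalizerHom R).rangeRestrict (F.normalizerHom R).rangeRestrict_surjective
    exact this
  obtain ⟨P, hP⟩ := hp.exists_le_sylow
  refine ⟨P, le_antisymm ?_ hP⟩
  by_contra hnle
  have hlt : (F.normalizerHom R).range < P := lt_of_le_not_ge hP hnle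
  have : Finite (MulAut R) := Finite.of_injective (fun e => (e : R → R)) DFunLike.coe_injective
  -- If `Aut_S(R)` were a proper subgroup of the Sylow subgroup `P`, some `a` of `p`-power order
  -- outside it would normalize it. The rest shows that such an `a` is conjugation by an element of
  -- `S`, a contradiction.
  obtain ⟨a, haP, hna, han⟩ := exists_mem_normalizer_of_lt P.isPGroup' hlt
  apply hna
  -- `N` is the normalizer of `R`
  obtain ⟨N, hN⟩ : ∃ N, N = Subgroup.normalizer (R : Set S) := ⟨_, rfl⟩
  have hRN : R ≤ N := hN ▸ Subgroup.le_normalizer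
  have hRlt : R < N := by
    have := lt_inf_normalizer hS (lt_top_iff_ne_top.2 htop)
    rwa [top_inf_eq, ← hN] at this
  have hcard : Nat.card S - Nat.card N < k := by
    have h1 : Nat.card R < Nat.card N := by
      exact Set.ncard_lt_ncard (s := (R : Set S)) (t := N) hRlt (Set.toFinite _)
    have h2 : Nat.card N ≤ Nat.card S := Nat.card_le_card_of_injective _ N.subtype_injective
    omega
  set f := extendFun (a : MulAut R).toMonoidHom with hfdef
  have hf : F.IsMor R f := isMor_extendFun a.2
  have hfa : ∀ x : R, f x = (a : MulAut R) x := fun x => extendFun_coe _ x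
  have him : im R f = R := by
    ext y
    rw [hf.mem_im]
    constructor
    · rintro ⟨x, hx, rfl⟩
      rw [hfa ⟨x, hx⟩]; exact SetLike.coe_mem _
    · intro hy
      refine ⟨_, ((a : MulAut R).symm ⟨y, hy⟩).2, ?_⟩
      rw [hfa]
      exact congrArg Subtype.val ((a : MulAut R).apply_symm_apply ⟨y, hy⟩)
  -- extend `a` to `N`
  obtain ⟨g, hg, hgf⟩ := hF.exists_extension_of_fullyNormalized (N := N) hf (him.symm ▸ hR)
    hRN hN.le (by
      intro x hx
      have hmem : a * F.normalizerHom R ⟨x, hN ▸ hx⟩ * a⁻¹ ∈ (F.normalizerHom R).range :=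
        (Subgroup.mem_normalizer_iff.1 han _).1 ⟨_, rfl⟩
      obtain ⟨z, hz⟩ := hmem
      refine ⟨z, fun b hb => ?_⟩
      have e1 := normalizerHom_apply (F := F) z ((a : MulAut R) ⟨b, hb⟩)
      rw [hz] at e1
      have e2 : f b = (a : MulAut R) ⟨b, hb⟩ := hfa ⟨b, hb⟩
      rw [e2, ← e1]
      have hm : x * b * x⁻¹ ∈ R := (Subgroup.mem_normalizer_iff.1 (hN ▸ hx) b).1 hb
      have e3 : f (x * b * x⁻¹) = (a : MulAut R) ⟨x * b * x⁻¹, hm⟩ := hfa ⟨_, hm⟩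
      rw [e3]
      simp only [Subgroup.coe_mul, MulAut.mul_apply, InvMemClass.coe_inv,
        MulAut.inv_apply_self]
      rfl)
  have hgR : ∀ x ∈ R, g x ∈ R := fun x hx => by
    rw [hgf x hx, hfa ⟨x, hx⟩]; exact SetLike.coe_mem _
  have hgN : ∀ x ∈ N, g x ∈ N := by
    intro x hx
    rw [hN]
    refine mem_normalizer_of_forall fun y hy => ?_
    rw [← him] at hy
    obtain ⟨b, hb, rfl⟩ := hf.mem_im.1 hy
    rw [← hgf b hb, ← hg.map_conj hx (hRN hb)]
    exact hgR _ ((Subgroup.mem_normalizer_iff.1 (hN ▸ hx) b).1 hb)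
  obtain ⟨b, hb⟩ := hg.exists_aut hgN
  have hpow : ∀ (n : ℕ) (x : S) (hx : x ∈ R),
      (((b ^ n : F.aut N) : MulAut N) ⟨x, hRN hx⟩ : S) =
        ((a ^ n : F.aut R) : MulAut R) ⟨x, hx⟩ := by
    intro n
    induction n with
    | zero => intro x hx; simp
    | succ n ihn =>
      intro x hx
      rw [pow_succ, pow_succ]
      simp only [Subgroup.coe_mul, MulAut.mul_apply]
      have e : (b : MulAut N) ⟨x, hRN hx⟩ = ⟨(a : MulAut R) ⟨x, hx⟩, hRN (SetLike.coe_mem _)⟩ :=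
        Subtype.ext ((hb _).trans ((hgf x hx).trans (hfa ⟨x, hx⟩)))
      rw [e]
      exact ihn _ _
  -- a power of `b` of `p`-power order that restricts to `a`
  have : Finite (MulAut N) := Finite.of_injective (fun e => (e : N → N)) DFunLike.coe_injective
  obtain ⟨i, m, hm, hbm⟩ := Nat.exists_eq_pow_mul_and_not_dvd (orderOf_pos b).ne' p
    (Fact.out : p.Prime).one_lt.ne'
  obtain ⟨t, ht⟩ := IsPGroup.iff_orderOf.1 P.isPGroup' ⟨a, haP⟩
  have hta : a ^ (p ^ t) = 1 := by
    rw [← ht, Subgroup.orderOf_mk]; exact pow_orderOf_eq_one a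
  have hcop : Nat.Coprime m (p ^ t) :=
    ((Nat.Prime.coprime_iff_not_dvd Fact.out).2 hm).symm.pow_right t
  -- Since `j ≡ 0` modulo the prime-to-`p` part `m` of the order of `b`, the power `b ^ j` has
  -- `p`-power order; since `j ≡ 1` modulo the order `p ^ t` of `a`, one has `a ^ j = a`.
  obtain ⟨j, hj0, hj1⟩ := Nat.chineseRemainder hcop 0 1
  obtain ⟨c, hc⟩ := Nat.modEq_zero_iff_dvd.1 hj0
  have hbj : (b ^ j) ^ (p ^ i) = 1 := by
    rw [← pow_mul, hc]
    have : m * c * p ^ i = (p ^ i * m) * c := by ring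
    rw [this, ← hbm, pow_mul, pow_orderOf_eq_one, one_pow]
  have haj : a ^ j = a := by
    have := pow_eq_pow_iff_modEq.2 (hj1.of_dvd (orderOf_dvd_of_pow_eq_one hta))
    simpa using this
  have hU : IsPGroup p (Subgroup.zpowers (b ^ j)) := by
    rintro ⟨c, n, rfl⟩
    refine ⟨i, Subtype.ext ?_⟩
    change ((b ^ j) ^ n) ^ (p ^ i) = 1
    rw [← zpow_natCast, ← zpow_mul, mul_comm, zpow_mul, zpow_natCast, hbj, one_zpow]
  -- `N` is larger than `R`, so by induction `Aut_S(N')` is Sylow and a suitable `τ : N → N'` turns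
  -- `b ^ j` into conjugation by some `y ∈ S`.
  obtain ⟨N', hNN', hN'⟩ := F.exists_fullyNormalized N
  obtain ⟨P', hP'⟩ := ih _ hcard N' hN' (by rw [hNN'.card_eq])
  obtain ⟨τ, hτ, him', hτ'⟩ := exists_mor_of_sylow hNN' P' hP' hU
  obtain ⟨y, -, hy⟩ := hτ' _ (Subgroup.mem_zpowers _)
  have hy' : ∀ x (hx : x ∈ R), τ ((a : MulAut R) ⟨x, hx⟩) = y * τ x * y⁻¹ := by
    intro x hx
    rw [← hy ⟨x, hRN hx⟩, hpow, haj]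
  have hτR := hτ.mono hRN
  have hyn : y ∈ Subgroup.normalizer (im R τ : Set S) := by
    refine mem_normalizer_of_forall fun z hz => ?_
    obtain ⟨x, hx, rfl⟩ := hτR.mem_im.1 hz
    rw [← hy' x hx]
    exact hτR.mem_im_of_mem (SetLike.coe_mem _)
  have hle : im N τ ≤ Subgroup.normalizer (im R τ : Set S) := by
    refine hτ.im_le fun x hx => mem_normalizer_of_forall fun z hz => ?_
    obtain ⟨r, hr, rfl⟩ := hτR.mem_im.1 hz
    rw [← hτ.map_conj hx (hRN hr)]
    exact hτR.mem_im_of_mem ((Subgroup.mem_normalizer_iff.1 (hN ▸ hx) r).1 hr)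
  -- Full normalization of `R` enters here: `N_S(τ(R))` has at most `|N_S(R)| = |τ(N)|` elements, so
  -- the inclusion is an equality. Hence `y = τ(n)`, and `a` is conjugation by `n`.
  have heq : im N τ = Subgroup.normalizer (im R τ : Set S) := by
    refine Subgroup.eq_of_le_of_card_ge hle ?_
    rw [hτ.card_im, hN]
    exact hR _ hτR.conj_im
  rw [← heq] at hyn
  obtain ⟨n, hn, rfl⟩ := hτ.mem_im.1 hyn
  refine mem_range_normalizerHom (s := n) fun x => ?_
  have hc : n * x * n⁻¹ ∈ N := N.mul_mem (N.mul_mem hn (hRN x.2)) (N.inv_mem hn)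
  refine hτ.injOn (hRN (SetLike.coe_mem _)) hc ?_
  rw [hy' x x.2, hτ.map_conj hn (hRN x.2)]

end FusionSystem

end

section

theorem card_lt_of_lt {G : Type u} [Group G] [Finite G] {A B : Subgroup G} (h : A < B) :
    Nat.card A < Nat.card B :=
  Set.ncard_lt_ncard (s := (A : Set G)) (t := B) h (Set.toFinite _)

theorem card_le_of_le {G : Type u} [Group G] [Finite G] {A B : Subgroup G} (h : A ≤ B) :
    Nat.card A ≤ Nat.card B :=
  Set.ncard_le_ncard (s := (A : Set G)) (t := B) h (Set.toFinite _)

namespace FusionSystem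

variable {S : Type u} [Group S] {F : FusionSystem S}

/-! ### Extension of morphisms defined on centric subgroups -/

/-- Move `Q = f(P)` to a fully normalized `R` by a morphism that extends to `β` on all of `N_S(Q)`.
The axiom extends `β ∘ f` to some `ψ` on `N`. For `x ∈ N` both `ψ(x)` and `β(z)` act in the same way
on the centric group `β(f(P))`, so they differ by an element of it. Thus `ψ(N)` lies in the image of
`β`, and `β⁻¹ ∘ ψ` extends `f`. -/
theorem IsSaturated.exists_extension {p : ℕ} [Fact p.Prime] [Finite S] (hS : IsPGroup p S)
    (hF : F.IsSaturated p) {P N : Subgroup S} {f : S → S} (hP : F.IsCentric P)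
    (hf : F.IsMor P f) (hPN : P ≤ N) (hN : N ≤ Subgroup.normalizer (P : Set S))
    (h : ∀ x ∈ N, ∃ z, ∀ a ∈ P, f (x * a * x⁻¹) = z * f a * z⁻¹) :
    ∃ g, F.IsMor N g ∧ ∀ x ∈ P, g x = f x := by
  obtain ⟨Q, hQ⟩ : ∃ Q, Q = im P f := ⟨_, rfl⟩
  obtain ⟨R, hQR, hR⟩ := F.exists_fullyNormalized Q
  obtain ⟨T, hT⟩ := hF.exists_sylow_eq_range hS R hR
  have hU : IsPGroup p (F.normalizerHom Q).range :=
    (hS.to_subgroup (Subgroup.normalizer (Q : Set S))).of_surjective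
      (F.normalizerHom Q).rangeRestrict (F.normalizerHom Q).rangeRestrict_surjective
  obtain ⟨α, hα, him, hα'⟩ := exists_mor_of_sylow hQR T hT hU
  obtain ⟨β, hβ, hβα⟩ := hF.exists_extension_of_fullyNormalized hα (him.symm ▸ hR)
    Subgroup.le_normalizer le_rfl (by
      intro n hn
      obtain ⟨y, -, hy⟩ := hα' _ ⟨⟨n, hn⟩, rfl⟩
      exact ⟨y, fun a ha => hy ⟨a, ha⟩⟩)
  have hfQ : ∀ x ∈ P, f x ∈ Q := fun x hx => hQ ▸ hf.mem_im_of_mem hx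
  have hz : ∀ x ∈ N, ∃ z ∈ Subgroup.normalizer (Q : Set S), ∀ a ∈ P,
      f (x * a * x⁻¹) = z * f a * z⁻¹ := by
    intro x hx
    obtain ⟨z, hz⟩ := h x hx
    refine ⟨z, mem_normalizer_of_forall fun y hy => ?_, hz⟩
    rw [hQ] at hy
    obtain ⟨a, ha, rfl⟩ := hf.mem_im.1 hy
    rw [← hz a ha]
    exact hfQ _ ((Subgroup.mem_normalizer_iff.1 (hN hx) a).1 ha)
  have hQn : ∀ x ∈ Q, x ∈ Subgroup.normalizer (Q : Set S) := fun x hx =>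
    Subgroup.le_normalizer hx
  have hβf : F.IsMor P (fun x => β (f x)) := hf.comp hβ fun x hx => hQn _ (hfQ x hx)
  have hβf' : ∀ x ∈ P, β (f x) = α (f x) := fun x hx => hβα _ (hfQ x hx)
  have himβ : im P (fun x => β (f x)) = R := by
    rw [im_congr hβf', ← hf.im_im (hQ ▸ hα), ← hQ, him]
  have key : ∀ x ∈ N, ∃ z ∈ Subgroup.normalizer (Q : Set S), ∀ a ∈ P,
      β (f (x * a * x⁻¹)) = β z * β (f a) * (β z)⁻¹ := by
    intro x hx
    obtain ⟨z, hzn, hz⟩ := hz x hx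
    refine ⟨z, hzn, fun a ha => ?_⟩
    rw [hz a ha, hβ.map_conj hzn (hQn _ (hfQ a ha))]
  obtain ⟨ψ, hψ, hψβ⟩ := hF.exists_extension_of_fullyNormalized hβf (himβ.symm ▸ hR) hPN hN
    (fun x hx => let ⟨z, _, hz⟩ := key x hx; ⟨β z, hz⟩)
  obtain ⟨γ, hγ, h1, -, h3⟩ := hβ.exists_inv
  have hψN : ∀ x ∈ N, ψ x ∈ im (Subgroup.normalizer (Q : Set S)) β := by
    intro x hx
    obtain ⟨z, hzn, hz⟩ := key x hx
    have := hP.inv_mul_mem hβf (s := ψ x) (t := β z) fun a ha => by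
      rw [← hz a ha]
      have e := hψ.map_conj hx (hPN ha)
      have hm := (Subgroup.mem_normalizer_iff.1 (hN hx) a).1 ha
      simp only [hψβ a ha, hψβ _ hm] at e
      exact e.symm
    obtain ⟨a, ha, e⟩ := hβf.mem_im.1 this
    have e' : ψ x = β z * (β (f a))⁻¹ := by rw [e]; group
    rw [e']
    exact Subgroup.mul_mem _ (hβ.mem_im_of_mem hzn)
      (Subgroup.inv_mem _ (hβ.mem_im_of_mem (hQn _ (hfQ a ha))))
  refine ⟨_, hψ.comp hγ hψN, fun x hx => ?_⟩
  rw [hψβ x hx, h1 _ (hQn _ (hfQ x hx))]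

/-- Two morphisms on `P` differ by conjugation with an element of `K`. -/
def ConjOn (K P : Subgroup S) (f g : S → S) : Prop := ∃ k ∈ K, ∀ x ∈ P, g x = k * f x * k⁻¹

namespace ConjOn

variable {K P Q : Subgroup S} {f g h : S → S}

theorem of_eq (e : ∀ x ∈ P, g x = f x) : ConjOn K P f g := ⟨1, K.one_mem, fun x hx => by simp [e x hx]⟩

theorem refl : ConjOn K P f f := of_eq fun _ _ => rfl

theorem symm (e : ConjOn K P f g) : ConjOn K P g f := by
  obtain ⟨k, hk, e⟩ := e
  exact ⟨k⁻¹, K.inv_mem hk, fun x hx => by rw [e x hx]; group⟩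

theorem trans (e : ConjOn K P f g) (e' : ConjOn K P g h) : ConjOn K P f h := by
  obtain ⟨k, hk, e⟩ := e
  obtain ⟨l, hl, e'⟩ := e'
  exact ⟨l * k, K.mul_mem hl hk, fun x hx => by rw [e' x hx, e x hx]; group⟩

theorem mono (e : ConjOn K P f g) (hle : Q ≤ P) : ConjOn K Q f g := by
  obtain ⟨k, hk, e⟩ := e
  exact ⟨k, hk, fun x hx => e x (hle hx)⟩

end ConjOn

theorem IsMor.conj_apply {P : Subgroup S} {f : S → S} (hf : F.IsMor P f) (k : S) :
    F.IsMor P (fun x => k * f x * k⁻¹) :=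
  hf.comp (F.isMor_conj k ⊤) fun _ _ => Subgroup.mem_top _

theorem IsMor.apply_conj {P : Subgroup S} {f : S → S} (hf : F.IsMor P f) {k : S} (hk : k ∈ P) :
    F.IsMor P (fun x => f (k * x * k⁻¹)) :=
  (hf.conj_apply (f k)).congr fun _ hx => hf.map_conj hk hx

/-- Centricity puts `g(Q)` inside `f(Q)`, so `b = f⁻¹ ∘ g` is an automorphism of `Q` that is trivial
on `P`. As `x⁻¹ b(x)` centralizes `P`, it lies in `P`; this forces `b` to have `p`-power order. Some
`τ` on `Q` then turns `b` into conjugation by an element `y` of `S`. This `y` centralizes the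
centric group `τ(P)`, so `y = τ(z)` with `z ∈ P`, and `b` is conjugation by `z`. -/
theorem IsSaturated.exists_conj_of_normal {p : ℕ} [Fact p.Prime] [Finite S] (hS : IsPGroup p S)
    (hF : F.IsSaturated p) {P Q : Subgroup S} {f g : S → S} (hP : F.IsCentric P) (hPQ : P ≤ Q)
    (hQ : Q ≤ Subgroup.normalizer (P : Set S)) (hf : F.IsMor Q f) (hg : F.IsMor Q g)
    (h : ∀ x ∈ P, g x = f x) : ∃ z ∈ P, ∀ x ∈ Q, g x = f (z * x * z⁻¹) := by
  have hn : ∀ x ∈ Q, ∀ a ∈ P, x * a * x⁻¹ ∈ P := fun x hx a ha =>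
    (Subgroup.mem_normalizer_iff.1 (hQ hx) a).1 ha
  have hgf : ∀ x ∈ Q, g x ∈ im Q f := by
    intro x hx
    have := hP.inv_mul_mem (hf.mono hPQ) (s := g x) (t := f x) fun a ha => by
      rw [← hf.map_conj hx (hPQ ha), ← h _ (hn x hx a ha), hg.map_conj hx (hPQ ha), h a ha]
    obtain ⟨a, ha, e⟩ := (hf.mono hPQ).mem_im.1 this
    have e' : g x = f x * (f a)⁻¹ := by rw [e]; group
    rw [e']
    exact Subgroup.mul_mem _ (hf.mem_im_of_mem hx)
      (Subgroup.inv_mem _ (hf.mem_im_of_mem (hPQ ha)))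
  obtain ⟨f', hf', h1, h2, h3⟩ := hf.exists_inv
  have hψ := hg.comp hf' hgf
  obtain ⟨b, hb⟩ := hψ.exists_aut fun x hx => h2 _ (hgf x hx)
  have hbP : ∀ x (hx : x ∈ P), ((b : MulAut Q) ⟨x, hPQ hx⟩ : S) = x := fun x hx => by
    rw [hb, h x hx, h1 x (hPQ hx)]
  have hζ : ∀ x : Q, (x : S)⁻¹ * (b : MulAut Q) x ∈ P := by
    intro x
    refine hP.mem_of_commute fun a ha => ?_
    have e1 := hbP _ (hn x x.2 a ha)
    have e2 : (b : MulAut Q) ⟨x * a * (x : S)⁻¹, hPQ (hn x x.2 a ha)⟩ =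
        (b : MulAut Q) x * (b : MulAut Q) ⟨a, hPQ ha⟩ * ((b : MulAut Q) x)⁻¹ := by
      rw [← map_inv, ← map_mul, ← map_mul]; rfl
    rw [e2] at e1
    simp only [Subgroup.coe_mul, InvMemClass.coe_inv, hbP a ha] at e1
    calc _ = (x : S)⁻¹ * ((b : MulAut Q) x * a * (((b : MulAut Q) x : Q) : S)⁻¹) * x := by group
      _ = a := by rw [e1]; group
  -- The element `x⁻¹ b(x)` lies in `P` and is therefore fixed by `b`, so each further application
  -- of `b` contributes the same factor.
  have hpow : ∀ (n : ℕ) (x : Q), (((b ^ n : F.aut Q) : MulAut Q) x : S) =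
      x * ((x : S)⁻¹ * (b : MulAut Q) x) ^ n := by
    intro n
    induction n with
    | zero => intro x; simp
    | succ n ih =>
      intro x
      rw [pow_succ]
      simp only [Subgroup.coe_mul, MulAut.mul_apply]
      rw [ih]
      have e : (((b : MulAut Q) x : Q) : S)⁻¹ * (b : MulAut Q) ((b : MulAut Q) x) =
          (x : S)⁻¹ * (b : MulAut Q) x := by
        have e1 := hbP _ (hζ x)
        have e2 : (⟨_, hPQ (hζ x)⟩ : Q) = x⁻¹ * (b : MulAut Q) x := rfl
        rw [e2, map_mul, map_inv] at e1
        exact e1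
      rw [e, pow_succ', ← mul_assoc]
      group
  obtain ⟨n, hnS⟩ := IsPGroup.iff_card.1 hS
  have hbn : b ^ (p ^ n) = 1 := aut_ext fun x => by
    rw [hpow, ← hnS, pow_card_eq_one']
    simp
  have hU : IsPGroup p (Subgroup.zpowers b) := by
    rintro ⟨c, m, rfl⟩
    refine ⟨n, Subtype.ext ?_⟩
    change (b ^ m) ^ (p ^ n) = 1
    rw [← zpow_natCast, ← zpow_mul, mul_comm, zpow_mul, zpow_natCast, hbn, one_zpow]
  obtain ⟨R, hQR, hR⟩ := F.exists_fullyNormalized Q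
  obtain ⟨T, hT⟩ := hF.exists_sylow_eq_range hS R hR
  obtain ⟨τ, hτ, -, hτ'⟩ := exists_mor_of_sylow hQR T hT hU
  obtain ⟨y, -, hy⟩ := hτ' _ (Subgroup.mem_zpowers _)
  have hyP : y ∈ im P τ := by
    refine (hP.im (hτ.mono hPQ)).mem_of_commute fun c hc => ?_
    obtain ⟨a, ha, rfl⟩ := (hτ.mono hPQ).mem_im.1 hc
    rw [← hy ⟨a, hPQ ha⟩, hbP a ha]
  obtain ⟨z, hz, rfl⟩ := (hτ.mono hPQ).mem_im.1 hyP
  refine ⟨z, hz, fun x hx => ?_⟩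
  have : ((b : MulAut Q) ⟨x, hx⟩ : S) = z * x * z⁻¹ := by
    refine hτ.injOn (SetLike.coe_mem _)
      (Q.mul_mem (Q.mul_mem (hPQ hz) hx) (Q.inv_mem (hPQ hz))) ?_
    rw [hy ⟨x, hx⟩, hτ.map_conj (hPQ hz) hx]
  rw [← this, hb, h3 _ (hgf x hx)]

/-- Restriction to a centric subgroup is injective on morphisms up to conjugation. -/
theorem IsSaturated.exists_conj {p : ℕ} [Fact p.Prime] [Finite S] (hS : IsPGroup p S)
    (hF : F.IsSaturated p) {P Q : Subgroup S} {f g : S → S} (hP : F.IsCentric P) (hPQ : P ≤ Q)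
    (hf : F.IsMor Q f) (hg : F.IsMor Q g)
    (h : ∀ x ∈ P, g x = f x) : ∃ z ∈ Q, ∀ x ∈ Q, g x = f (z * x * z⁻¹) := by
  induction hk : Nat.card S - Nat.card P using Nat.strong_induction_on generalizing P f with
  | h k ih =>
  rcases hPQ.eq_or_lt with rfl | hlt
  · exact ⟨1, P.one_mem, fun x hx => by simp [h x hx]⟩
  have hlt' := lt_inf_normalizer hS hlt
  obtain ⟨z, hz, hz'⟩ := hF.exists_conj_of_normal hS hP hlt'.le inf_le_right
    (hf.mono inf_le_left) (hg.mono inf_le_left) h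
  have h1 := card_lt_of_lt hlt'
  have h2 : Nat.card (Q ⊓ Subgroup.normalizer (P : Set S) : Subgroup S) ≤ Nat.card S :=
    Nat.card_le_card_of_injective _ (Subgroup.subtype_injective _)
  -- After `f` is replaced by `f ∘ c_z`, the two maps agree on `Q ∩ N_S(P)`, which is strictly
  -- larger than `P`.
  obtain ⟨w, hw, hw'⟩ := ih _ (by omega) (hP.mono hlt'.le) inf_le_left
    (hf.apply_conj (hPQ hz)) hz' rfl
  refine ⟨z * w, Q.mul_mem (hPQ hz) hw, fun x hx => ?_⟩
  rw [hw' x hx]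
  congr 1
  group

theorem IsSaturated.conjOn_of_conjOn {p : ℕ} [Fact p.Prime] [Finite S] (hS : IsPGroup p S)
    (hF : F.IsSaturated p) {K P Q : Subgroup S} {f g : S → S} (hP : F.IsCentric P) (hPQ : P ≤ Q)
    (hf : F.IsMor Q f) (hg : F.IsMor Q g) (hfK : ∀ x ∈ Q, f x ∈ K)
    (h : ConjOn K P f g) : ConjOn K Q f g := by
  obtain ⟨k, hk, e⟩ := h
  obtain ⟨z, hz, hz'⟩ := hF.exists_conj hS hP hPQ (hf.conj_apply k) hg e
  refine ⟨k * f z, K.mul_mem hk (hfK z hz), fun x hx => ?_⟩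
  rw [hz' x hx, hf.map_conj hz hx]
  group

/-- The elements of `H` that normalize `P` and act on `P` through `f` like an element of `K`. -/
def transporter (H K P : Subgroup S) (f : S → S) : Subgroup S where
  carrier := {x | x ∈ H ∧ x ∈ Subgroup.normalizer (P : Set S) ∧
    ∃ z ∈ K, ∀ a ∈ P, f (x * a * x⁻¹) = z * f a * z⁻¹}
  one_mem' := ⟨one_mem _, one_mem _, 1, one_mem _, fun a _ => by simp⟩
  mul_mem' := by
    rintro x y ⟨hx, hxn, z, hz, h⟩ ⟨hy, hyn, w, hw, h'⟩
    refine ⟨mul_mem hx hy, mul_mem hxn hyn, z * w, mul_mem hz hw, fun a ha => ?_⟩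
    have e : x * y * a * (x * y)⁻¹ = x * (y * a * y⁻¹) * x⁻¹ := by group
    rw [e, h _ ((Subgroup.mem_normalizer_iff.1 hyn a).1 ha), h' a ha]
    group
  inv_mem' := by
    rintro x ⟨hx, hxn, z, hz, h⟩
    refine ⟨inv_mem hx, inv_mem hxn, z⁻¹, inv_mem hz, fun a ha => ?_⟩
    have hm := (Subgroup.mem_normalizer_iff.1 (inv_mem hxn) a).1 ha
    have := h _ hm
    have e : x * (x⁻¹ * a * x⁻¹⁻¹) * x⁻¹ = a := by group
    rw [e] at this
    rw [this]
    group

/-- The extension takes values in `K`: `g(x)` acts on `f(P)` like an element `z` of `K`, so by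
centricity the two differ by an element of `f(P) ≤ K`. -/
theorem IsSaturated.exists_extension_transporter {p : ℕ} [Fact p.Prime] [Finite S]
    (hS : IsPGroup p S) (hF : F.IsSaturated p) {H K P : Subgroup S} {f : S → S}
    (hP : F.IsCentric P) (hf : F.IsMor P f) (hPH : P ≤ H) (hfK : ∀ x ∈ P, f x ∈ K) :
    P ≤ transporter H K P f ∧ ∃ g, F.IsMor (transporter H K P f) g ∧ (∀ x ∈ P, g x = f x) ∧
      ∀ x ∈ transporter H K P f, g x ∈ K := by
  have hle : P ≤ transporter H K P f := fun x hx =>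
    ⟨hPH hx, Subgroup.le_normalizer hx, f x, hfK x hx, fun a ha => hf.map_conj hx ha⟩
  obtain ⟨g, hg, hgf⟩ := hF.exists_extension hS hP hf hle (fun x hx => hx.2.1)
    (fun x hx => let ⟨z, _, h⟩ := hx.2.2; ⟨z, h⟩)
  refine ⟨hle, g, hg, hgf, fun x hx => ?_⟩
  obtain ⟨-, hxn, z, hz, h⟩ := id hx
  have := hP.inv_mul_mem hf (s := g x) (t := z) fun a ha => by
    rw [← h a ha, ← hgf a ha, ← hg.map_conj hx (hle ha),
      hgf _ ((Subgroup.mem_normalizer_iff.1 hxn a).1 ha)]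
  have h1 := hf.im_le hfK this
  have e : g x = z * ((g x)⁻¹ * z)⁻¹ := by group
  rw [e]
  exact K.mul_mem hz (K.inv_mem h1)

/-- Two extensions of a morphism from a centric subgroup have a common extension. -/
theorem IsSaturated.exists_common_extension {p : ℕ} [Fact p.Prime] [Finite S]
    (hS : IsPGroup p S) (hF : F.IsSaturated p) {H K P A B : Subgroup S} {f g : S → S}
    (hP : F.IsCentric P) (hPA : P ≤ A) (hPB : P ≤ B) (hA : A ≤ H) (hB : B ≤ H)
    (hf : F.IsMor A f) (hfK : ∀ x ∈ A, f x ∈ K) (hg : F.IsMor B g) (hgK : ∀ x ∈ B, g x ∈ K)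
    (h : ConjOn K P f g) :
    ∃ D d, A ≤ D ∧ B ≤ D ∧ D ≤ H ∧ F.IsMor D d ∧ (∀ x ∈ D, d x ∈ K) ∧ ConjOn K A f d ∧
      ConjOn K B g d := by
  induction hk : Nat.card S - Nat.card P using Nat.strong_induction_on
    generalizing P A B f g with
  | h k ih =>
  rcases hPA.eq_or_lt with rfl | hPA'
  · exact ⟨B, g, hPB, le_rfl, hB, hg, hgK, h, .refl⟩
  rcases hPB.eq_or_lt with rfl | hPB'
  · exact ⟨A, f, le_rfl, hPA, hA, hf, hfK, .refl, h.symm⟩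
  -- The restriction of `f` to `P` extends to a map `n` on its transporter `N`, which contains the
  -- normalizers of `P` in both `A` and `B`. These are strictly larger than `P`, so the induction
  -- can glue first `f` with `n`, along the normalizer in `A`, and then the result with `g`, along
  -- the normalizer in `B`.
  obtain ⟨hPN, n, hn, hnf, hnK⟩ := hF.exists_extension_transporter hS hP (hf.mono hPA)
    (hPA.trans hA) (fun x hx => hfK x (hPA hx))
  set N := transporter H K P f
  have lA := lt_inf_normalizer hS hPA'
  have lB := lt_inf_normalizer hS hPB'
  have hAN : A ⊓ Subgroup.normalizer (P : Set S) ≤ N := fun x hx =>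
    ⟨hA hx.1, hx.2, f x, hfK x hx.1, fun a ha => hf.map_conj hx.1 (hPA ha)⟩
  have hBN : B ⊓ Subgroup.normalizer (P : Set S) ≤ N := by
    intro x hx
    obtain ⟨k, hk, e⟩ := h
    refine ⟨hB hx.1, hx.2, k⁻¹ * g x * k, K.mul_mem (K.mul_mem (K.inv_mem hk) (hgK x hx.1)) hk,
      fun a ha => ?_⟩
    have e1 := hg.map_conj hx.1 (hPB ha)
    rw [e a ha, e _ ((Subgroup.mem_normalizer_iff.1 hx.2 a).1 ha)] at e1
    calc _ = k⁻¹ * (k * f (x * a * x⁻¹) * k⁻¹) * k := by group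
      _ = _ := by rw [e1]; group
  have hcard : ∀ Q : Subgroup S, P < Q → Nat.card S - Nat.card Q < k := by
    intro Q hQ
    have h1 := card_lt_of_lt hQ
    have h2 : Nat.card Q ≤ Nat.card S :=
      Nat.card_le_card_of_injective _ (Subgroup.subtype_injective _)
    omega
  have hNH : N ≤ H := fun x hx => hx.1
  have c1 : ConjOn K (A ⊓ Subgroup.normalizer (P : Set S)) f n :=
    hF.conjOn_of_conjOn hS hP lA.le (hf.mono inf_le_left) (hn.mono hAN)
      (fun x hx => hfK x hx.1) (.of_eq hnf)
  obtain ⟨D, d, hAD, hND, hDH, hd, hdK, cA, cN⟩ := ih _ (hcard _ lA) (hP.mono lA.le) inf_le_left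
    hAN hA hNH hf hfK hn hnK c1 rfl
  -- `d` and `g` are known to be conjugate only on `P`; uniqueness of extensions from a centric
  -- subgroup transfers this to `B ∩ N_S(P)`.
  have c2 : ConjOn K (B ⊓ Subgroup.normalizer (P : Set S)) d g :=
    hF.conjOn_of_conjOn hS hP lB.le (hd.mono (hBN.trans hND)) (hg.mono inf_le_left)
      (fun x hx => hdK x (hND (hBN hx))) ((cA.mono hPA).symm.trans h)
  obtain ⟨D', d', hDD', hBD', hD'H, hd', hdK', cD, cB⟩ := ih _ (hcard _ lB) (hP.mono lB.le)
    (hBN.trans hND) inf_le_left hDH hB hd hdK hg hgK c2 rfl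
  exact ⟨D', d', hAD.trans hDD', hBD', hD'H, hd', hdK', cA.trans (cD.mono hAD), cB⟩

end FusionSystem

end

section

namespace FusionSystem

variable {S : Type u} [Group S] {F : FusionSystem S}

/-! ### Morphisms of the orbit category as maps on the ambient group -/

namespace OrbitHom

variable {H K L : Subgroup S}

/-- A map on `S` that represents a morphism of the orbit category. -/
def fn (a : F.OrbitHom H K) : S → S := extendFun a.rep

theorem isMor_fn (a : F.OrbitHom H K) : F.IsMor H a.fn := isMor_extendFun a.rep_mem

theorem fn_mem (a : F.OrbitHom H K) {x : S} (hx : x ∈ H) : a.fn x ∈ K := by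
  rw [fn, extendFun_of_mem _ hx]
  exact SetLike.coe_mem _

theorem mk_eq_mk_iff {φ ψ : H →* K} (hφ : φ ∈ F.Hom H K) (hψ : ψ ∈ F.Hom H K) :
    (mk hφ : F.OrbitHom H K) = mk hψ ↔ ConjOn K H (extendFun φ) (extendFun ψ) := by
  rw [mk_eq_iff]
  constructor
  · rintro ⟨k, h⟩
    refine ⟨k, k.2, fun x hx => ?_⟩
    rw [extendFun_of_mem _ hx, extendFun_of_mem _ hx, h]
    rfl
  · rintro ⟨k, hk, h⟩
    refine ⟨⟨k, hk⟩, fun x => Subtype.ext ?_⟩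
    have := h x x.2
    rwa [extendFun_coe, extendFun_coe] at this

theorem eq_iff {a b : F.OrbitHom H K} : a = b ↔ ConjOn K H a.fn b.fn := by
  conv_lhs => rw [← mk_rep a, ← mk_rep b]
  exact mk_eq_mk_iff _ _

theorem mk_fn {φ : H →* K} (hφ : φ ∈ F.Hom H K) : ConjOn K H (extendFun φ) (mk hφ).fn :=
  (mk_eq_mk_iff hφ (rep_mem _)).1 (mk_rep _).symm

/-- The morphism represented by a map on `S`. -/
def ofFun (f : S → S) (hf : F.IsMor H f) (h : ∀ x ∈ H, f x ∈ K) : F.OrbitHom H K :=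
  mk (hf.exists_hom h).choose_spec.1

theorem ofFun_fn {f : S → S} (hf : F.IsMor H f) (h : ∀ x ∈ H, f x ∈ K) :
    ConjOn K H f (ofFun f hf h).fn := by
  refine ConjOn.trans (.of_eq fun x hx => ?_) (mk_fn (hf.exists_hom h).choose_spec.1)
  rw [extendFun_of_mem _ hx]
  exact (hf.exists_hom h).choose_spec.2 ⟨x, hx⟩

theorem comp_fn (b : F.OrbitHom K L) (a : F.OrbitHom H K) :
    ConjOn L H (fun x => b.fn (a.fn x)) (comp b a).fn := by
  conv_rhs => rw [← mk_rep a, ← mk_rep b, comp_mk]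
  refine ConjOn.trans (.of_eq fun x hx => ?_) (mk_fn _)
  rw [fn, fn, extendFun_of_mem _ hx, extendFun_of_mem _ hx, extendFun_coe]
  rfl

theorem incl_fn (h : H ≤ K) : ConjOn K H (fun x => x) (incl F h).fn :=
  ConjOn.trans (.of_eq fun x hx => by rw [extendFun_of_mem _ hx]; rfl) (mk_fn _)

end OrbitHom

theorem ConjOn.comp {K L P : Subgroup S} {f g : S → S} (h : ConjOn K P f g) (b : F.OrbitHom K L)
    (hf : ∀ x ∈ P, f x ∈ K) : ConjOn L P (fun x => b.fn (f x)) (fun x => b.fn (g x)) := by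
  obtain ⟨k, hk, e⟩ := h
  exact ⟨b.fn k, b.fn_mem hk, fun x hx => by
    change b.fn (g x) = _
    rw [e x hx, b.isMor_fn.map_conj hk (hf x hx)]⟩

theorem mem_conjBy {A : Subgroup S} {h x : S} : x ∈ conjBy A h ↔ h * x * h⁻¹ ∈ A := by
  refine ⟨conj_mem_of_mem_conjBy, fun hx => ⟨_, hx, ?_⟩⟩
  simp only [MulEquiv.coe_toMonoidHom, MulAut.conj_apply]
  group

theorem conjClass_fn (A : Subgroup S) (h : S) :
    ConjOn A (conjBy A h) (fun x => h * x * h⁻¹) (F.conjClass A h).fn :=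
  ConjOn.trans (.of_eq fun x hx => by rw [extendFun_of_mem _ hx]; rfl) (OrbitHom.mk_fn _)

theorem card_conjBy (A : Subgroup S) (h : S) : Nat.card (conjBy A h) = Nat.card A :=
  Nat.card_congr (A.equivMapOfInjective _ (MulAut.conj h⁻¹).injective).toEquiv.symm

/-! ### Maximal pairs -/

theorem prodPair_le_iff {H K : Subgroup S} {P Q : F.ProdPair H K} :
    P ≤ Q ↔ ∃ h ∈ H, conjBy P.A h ≤ Q.A ∧
      ConjOn K (conjBy P.A h) (fun x => P.hom.fn (h * x * h⁻¹)) Q.hom.fn := by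
  have key : ∀ (h : S) (hle : conjBy P.A h ≤ Q.A),
      (OrbitHom.comp P.hom (F.conjClass P.A h) = OrbitHom.comp Q.hom (OrbitHom.incl F hle)) ↔
      ConjOn K (conjBy P.A h) (fun x => P.hom.fn (h * x * h⁻¹)) Q.hom.fn := by
    intro h hle
    have c1 := ((conjClass_fn (F := F) P.A h).comp P.hom
      fun x hx => mem_conjBy.1 hx).trans (OrbitHom.comp_fn _ _)
    have c2 := ((OrbitHom.incl_fn (F := F) hle).comp Q.hom fun x hx => hle hx).trans
      (OrbitHom.comp_fn _ _)
    rw [OrbitHom.eq_iff]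
    exact ⟨fun h => c1.trans (h.trans c2.symm), fun h => c1.symm.trans (h.trans c2)⟩
  constructor
  · rintro ⟨h, hh, hle, e⟩
    exact ⟨h, hh, hle, (key h hle).1 e⟩
  · rintro ⟨h, hh, hle, e⟩
    exact ⟨h, hh, hle, (key h hle).2 e⟩

theorem ProdPair.card_le [Finite S] {H K : Subgroup S} {P Q : F.ProdPair H K} (h : P ≤ Q) :
    Nat.card P.A ≤ Nat.card Q.A := by
  obtain ⟨h, -, hle, -⟩ := prodPair_le_iff.1 h
  rw [← card_conjBy P.A h]
  exact card_le_of_le hle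

/-- The pair given by a map on `S`. -/
def ProdPair.ofFun {H K A : Subgroup S} (hA : F.IsCentric A) (hAH : A ≤ H) (f : S → S)
    (hf : F.IsMor A f) (h : ∀ x ∈ A, f x ∈ K) : F.ProdPair H K :=
  ⟨A, hA, hAH, OrbitHom.ofFun f hf h⟩

theorem ProdPair.le_ofFun {H K D : Subgroup S} {P : F.ProdPair H K} (hD : F.IsCentric D)
    (hDH : D ≤ H) (d : S → S) (hd : F.IsMor D d) (hdK : ∀ x ∈ D, d x ∈ K) {h : S} (hh : h ∈ H)
    (hle : conjBy P.A h ≤ D) (c : ConjOn K (conjBy P.A h) (fun x => P.hom.fn (h * x * h⁻¹)) d) :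
    P ≤ ProdPair.ofFun hD hDH d hd hdK :=
  prodPair_le_iff.2 ⟨h, hh, hle, c.trans ((OrbitHom.ofFun_fn hd hdK).mono hle)⟩

theorem conjBy_one (A : Subgroup S) : conjBy A 1 = A := by
  ext x; rw [mem_conjBy]; simp

theorem ProdPair.eq_of_isMax [Finite S] {H K D : Subgroup S} {P : F.ProdPair H K} (hP : IsMax P)
    (hPD : P.A ≤ D) (hDH : D ≤ H) {d : S → S} (hd : F.IsMor D d) (hdK : ∀ x ∈ D, d x ∈ K)
    (c : ConjOn K P.A P.hom.fn d) : D = P.A := by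
  have h1 : P ≤ ProdPair.ofFun (P.isCentric.mono hPD) hDH d hd hdK :=
    ProdPair.le_ofFun _ _ _ _ _ H.one_mem (by rwa [conjBy_one]) (by
      simpa [conjBy_one] using c)
  exact (Subgroup.eq_of_le_of_card_ge hPD (ProdPair.card_le (hP h1))).symm

theorem ProdIndex.isMax_rep {H K : Subgroup S} (q : F.ProdIndex H K) : IsMax q.rep :=
  (Quotient.out q).2

theorem ProdIndex.eq_of_le {H K : Subgroup S} {q q' : F.ProdIndex H K} (h : q.rep ≤ q'.rep) :
    q = q' := by
  rw [← Quotient.out_eq q, ← Quotient.out_eq q']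
  exact Quotient.sound ⟨h, q.isMax_rep h⟩

theorem ProdIndex.exists_le [Finite S] {H K : Subgroup S} (P : F.ProdPair H K) :
    ∃ q : F.ProdIndex H K, P ≤ q.rep := by
  obtain ⟨Q, hPQ, hQ⟩ := Finite.exists_le_maximal (p := fun _ : F.ProdPair H K => True)
    (a := P) trivial
  have hm : IsMax Q := fun R hR => hQ.2 trivial hR
  refine ⟨Quotient.mk _ ⟨Q, hm⟩, hPQ.trans ?_⟩
  exact (Quotient.mk_out (s := AntisymmRel.setoid {P : F.ProdPair H K // IsMax P} (· ≤ ·))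
    ⟨Q, hm⟩).2

/-- The two projections of the components of the product of `H` and `K`, on morphisms from `P`. -/
def prodMap (H K P : Subgroup S) (t : Σ q : F.ProdIndex H K, F.OrbitHom P q.rep.A) :
    F.OrbitHom P H × F.OrbitHom P K :=
  (OrbitHom.comp (OrbitHom.incl F t.1.rep.le) t.2, OrbitHom.comp t.1.rep.hom t.2)

theorem prodMap_fst_fn {H K P : Subgroup S} (q : F.ProdIndex H K) (c : F.OrbitHom P q.rep.A) :
    ConjOn H P c.fn (prodMap H K P ⟨q, c⟩).1.fn := by
  refine ConjOn.trans ?_ (OrbitHom.comp_fn (OrbitHom.incl F q.rep.le) c)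
  obtain ⟨k, hk, e⟩ := OrbitHom.incl_fn (F := F) q.rep.le
  exact ⟨k, hk, fun x hx => e _ (c.fn_mem hx)⟩

theorem prodMap_snd_fn {H K P : Subgroup S} (q : F.ProdIndex H K) (c : F.OrbitHom P q.rep.A) :
    ConjOn K P (fun x => q.rep.hom.fn (c.fn x)) (prodMap H K P ⟨q, c⟩).2.fn :=
  OrbitHom.comp_fn _ _

/-- Two factorizations of one pair of morphisms, through `q` and `q'`, show that the maximal pair
`q` and a conjugate of the maximal pair `q'` restrict to the same morphism on the centric group
`c(P)`, up to conjugation in `K`. A common extension and maximality give `q = q'`, and maximality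
once more gives `c = c'`. -/
theorem IsSaturated.prodMap_injective {p : ℕ} [Fact p.Prime] [Finite S]
    (hS : IsPGroup p S) (hF : F.IsSaturated p) {H K P : Subgroup S} (hP : F.IsCentric P) :
    Function.Injective (prodMap (F := F) H K P) := by
  rintro ⟨q, c⟩ ⟨q', c'⟩ h
  have h1 : ConjOn H P c.fn c'.fn :=
    (prodMap_fst_fn q c).trans ((OrbitHom.eq_iff.1 (congrArg Prod.fst h)).trans
      (prodMap_fst_fn q' c').symm)
  have h2 : ConjOn K P (fun x => q.rep.hom.fn (c.fn x)) (fun x => q'.rep.hom.fn (c'.fn x)) :=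
    (prodMap_snd_fn q c).trans ((OrbitHom.eq_iff.1 (congrArg Prod.snd h)).trans
      (prodMap_snd_fn q' c').symm)
  obtain ⟨s, hs, e1⟩ := h1
  have hP' := hP.im c.isMor_fn
  have hle1 : im P c.fn ≤ q.rep.A := c.isMor_fn.im_le fun x hx => c.fn_mem hx
  have hle2 : im P c.fn ≤ conjBy q'.rep.A s := c.isMor_fn.im_le fun x hx =>
    mem_conjBy.2 (by rw [← e1 x hx]; exact c'.fn_mem hx)
  have hH' : conjBy q'.rep.A s ≤ H := by
    intro x hx
    have := H.mul_mem (H.mul_mem (H.inv_mem hs) (q'.rep.le (mem_conjBy.1 hx))) hs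
    convert this using 1
    group
  have hmor : F.IsMor (conjBy q'.rep.A s) (fun x => q'.rep.hom.fn (s * x * s⁻¹)) :=
    (F.isMor_conj s _).comp q'.rep.hom.isMor_fn fun x hx => mem_conjBy.1 hx
  have hconj : ConjOn K (im P c.fn) q.rep.hom.fn (fun x => q'.rep.hom.fn (s * x * s⁻¹)) := by
    obtain ⟨k, hk, e2⟩ := h2
    refine ⟨k, hk, fun y hy => ?_⟩
    obtain ⟨x, hx, rfl⟩ := c.isMor_fn.mem_im.1 hy
    rw [← e2 x hx]
    exact congrArg _ (e1 x hx).symm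
  obtain ⟨D, d, hAD, hBD, hDH, hd, hdK, cA, cB⟩ := hF.exists_common_extension hS hP' hle1 hle2
    q.rep.le hH' q.rep.hom.isMor_fn (fun x hx => q.rep.hom.fn_mem hx) hmor
    (fun x hx => q'.rep.hom.fn_mem (mem_conjBy.1 hx)) hconj
  have hDA := ProdPair.eq_of_isMax q.isMax_rep hAD hDH hd hdK cA
  have hq : q' = q := by
    apply ProdIndex.eq_of_le
    have l1 : q'.rep ≤ ProdPair.ofFun (q.rep.isCentric.mono hAD) hDH d hd hdK :=
      ProdPair.le_ofFun _ _ _ _ _ hs hBD cB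
    have l2 : q.rep ≤ ProdPair.ofFun (q.rep.isCentric.mono hAD) hDH d hd hdK :=
      ProdPair.le_ofFun _ _ _ _ _ H.one_mem (by rwa [conjBy_one])
        (by simpa [conjBy_one] using cA)
    exact l1.trans (q.isMax_rep l2)
  subst hq
  subst hDA
  have hsA : conjBy q'.rep.A s = q'.rep.A :=
    Subgroup.eq_of_le_of_card_ge hBD (card_conjBy _ _).ge
  have hmemA : ∀ x ∈ q'.rep.A, s * x * s⁻¹ ∈ q'.rep.A := fun x hx => by
    rw [← hsA] at hx; exact mem_conjBy.1 hx
  -- The element `s` with `c' = s c s⁻¹` normalizes `A` and acts on it through `φ` like an element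
  -- of `K`, so it lies in the transporter of `A`. As `φ` extends to the transporter, maximality
  -- makes the transporter equal to `A`, and `s ∈ A` identifies `c` with `c'`.
  obtain ⟨k, hk, e⟩ := cA.trans (hsA ▸ cB).symm
  have hst : s ∈ transporter H K q'.rep.A q'.rep.hom.fn :=
    ⟨hs, mem_normalizer_of_forall hmemA, k, hk, fun a ha => e a ha⟩
  obtain ⟨hle, g, hg, hgf, hgK⟩ := hF.exists_extension_transporter hS q'.rep.isCentric
    q'.rep.hom.isMor_fn q'.rep.le (K := K) (fun x hx => q'.rep.hom.fn_mem hx)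
  have := ProdPair.eq_of_isMax q'.isMax_rep hle (fun x hx => hx.1) hg hgK (.of_eq hgf)
  rw [this] at hst
  congr 1
  exact OrbitHom.eq_iff.2 ⟨s, hst, e1⟩

/-- The pair `(a(P), b ∘ a⁻¹)` lies below some maximal pair, through which `a` and `b` factor. Only
finiteness is needed here, not saturation. -/
theorem prodMap_surjective [Finite S] {H K P : Subgroup S} (hP : F.IsCentric P) :
    Function.Surjective (prodMap (F := F) H K P) := by
  rintro ⟨a, b⟩
  obtain ⟨a', ha', h1, h2, h3⟩ := a.isMor_fn.exists_inv
  have hle : im P a.fn ≤ H := a.isMor_fn.im_le fun x hx => a.fn_mem hx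
  have hm := ha'.comp b.isMor_fn h2
  have hmK : ∀ y ∈ im P a.fn, b.fn (a' y) ∈ K := fun y hy => b.fn_mem (h2 y hy)
  obtain ⟨q, hq⟩ := ProdIndex.exists_le (ProdPair.ofFun (hP.im a.isMor_fn) hle _ hm hmK)
  obtain ⟨s, hs, hle', c⟩ := prodPair_le_iff.1 hq
  have hsA : ∀ x ∈ P, s⁻¹ * a.fn x * s⁻¹⁻¹ ∈ conjBy (im P a.fn) s := fun x hx => by
    rw [mem_conjBy]
    convert a.isMor_fn.mem_im_of_mem hx using 1
    group
  have hA : ∀ x ∈ P, s⁻¹ * a.fn x * s⁻¹⁻¹ ∈ q.rep.A := fun x hx => hle' (hsA x hx)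
  refine ⟨⟨q, OrbitHom.ofFun _ (a.isMor_fn.conj_apply s⁻¹) hA⟩, Prod.ext ?_ ?_⟩
  · refine OrbitHom.eq_iff.2 ((prodMap_fst_fn _ _).symm.trans ?_)
    obtain ⟨k, hk, e⟩ := OrbitHom.ofFun_fn (a.isMor_fn.conj_apply s⁻¹) hA
    refine ConjOn.symm ⟨k * s⁻¹, H.mul_mem (q.rep.le hk) (H.inv_mem hs), fun x hx => ?_⟩
    rw [e x hx]
    group
  · refine OrbitHom.eq_iff.2 ((prodMap_snd_fn _ _).symm.trans ?_)
    have c1 := (OrbitHom.ofFun_fn (a.isMor_fn.conj_apply s⁻¹) hA).comp q.rep.hom hA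
    refine c1.symm.trans ?_
    have c2 := (((OrbitHom.ofFun_fn hm hmK)))
    obtain ⟨k, hk, e⟩ := c
    obtain ⟨l, hl, e'⟩ := c2
    refine ConjOn.symm ⟨k * l, K.mul_mem hk hl, fun x hx => ?_⟩
    refine (e _ (hsA x hx)).trans ?_
    have e3 : s * (s⁻¹ * a.fn x * s⁻¹⁻¹) * s⁻¹ = a.fn x := by group
    change k * (OrbitHom.ofFun _ hm hmK).fn _ * k⁻¹ = _
    rw [e3, e' _ (a.isMor_fn.mem_im_of_mem hx)]
    beta_reduce
    rw [h1 x hx]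
    group

/-- The components of the product of `H` and `K` represent pairs of morphisms. -/
theorem IsSaturated.prodMap_bijective {p : ℕ} [Fact p.Prime] [Finite S]
    (hS : IsPGroup p S) (hF : F.IsSaturated p) {H K P : Subgroup S} (hP : F.IsCentric P) :
    Function.Bijective (prodMap (F := F) H K P) :=
  ⟨hF.prodMap_injective hS hP, prodMap_surjective hP⟩

end FusionSystem

end

/-! ### Fixed points of the `K`-set attached to the product of `H` and `K` -/

section

/-- Two quotients of one type by the same relation. It allows counting with a common type of
representatives instead of writing down a bijection. -/
theorem card_eq_of_surjective {W : Type u} {X : Type v} {Y : Type w} {f : W → X} {g : W → Y}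
    (hf : Function.Surjective f) (hg : Function.Surjective g)
    (h : ∀ a b, f a = f b ↔ g a = g b) : Nat.card X = Nat.card Y := by
  have e : Setoid.ker f = Setoid.ker g := Setoid.ext fun a b => h a b
  exact Nat.card_congr ((Setoid.quotientKerEquivOfSurjective f hf).symm.trans
    ((Quotient.congr (Equiv.refl W) fun a b => h a b).trans
      (Setoid.quotientKerEquivOfSurjective g hg)))

theorem smul_mk_eq_iff {G : Type u} [Group G] {Q : Subgroup G} {g x : G} :
    g • (x : G ⧸ Q) = x ↔ x⁻¹ * g * x ∈ Q := by
  change ((g * x : G) : G ⧸ Q) = x ↔ _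
  rw [eq_comm, QuotientGroup.eq, mul_assoc]

/-- The number of fixed points of `P ≤ K` on a `K`-set. -/
def fixCard {S : Type u} [Group S] (P : Subgroup S) {K : Subgroup S} (X : Type v)
    [MulAction K X] : ℕ :=
  Nat.card {x : X // ∀ k : K, (k : S) ∈ P → k • x = x}

namespace FusionSystem

variable {S : Type u} [Group S] {F : FusionSystem S}

/-- The subgroup `φ(A)` of `K`, for a component `(A, φ)` of the product of `H` and `K`. -/
def ProdIndex.image {H K : Subgroup S} (q : F.ProdIndex H K) : Subgroup S :=
  CentricMackey.image q.rep.hom.rep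

theorem OrbitHom.image_rep {H K : Subgroup S} (a : F.OrbitHom H K) :
    CentricMackey.image a.rep = im H a.fn := by
  ext y
  rw [a.isMor_fn.mem_im]
  constructor
  · rintro ⟨x, rfl⟩
    exact ⟨x, x.2, extendFun_coe _ _⟩
  · rintro ⟨x, h, rfl⟩
    exact ⟨⟨x, h⟩, (extendFun_of_mem _ h).symm⟩

/-- The `K`-set `∐ K / φ(A)`, over the components `(A, φ)` of the product of `H` and `K`. -/
abbrev ProdSet (F : FusionSystem S) (H K : Subgroup S) : Type u :=
  Σ q : F.ProdIndex H K, K ⧸ (q.image.subgroupOf K)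

/-- `P` fixes the coset `k φ(A)` exactly when `k⁻¹ P k ≤ φ(A)`, and then `x ↦ φ⁻¹(k⁻¹ x k)` is a
morphism `c : P → A` for which `φ ∘ c` is the class of the inclusion `P ≤ K`. So fixed points
correspond to the pairs `(q, c)` whose second projection is that inclusion, and by the bijectivity
of `prodMap` these correspond to their first projections, the morphisms `P → H`. -/
theorem IsSaturated.fixCard_prodSet {p : ℕ} [Fact p.Prime] [Finite S]
    (hS : IsPGroup p S) (hF : F.IsSaturated p) {H K P : Subgroup S} (hP : F.IsCentric P)
    (hPK : P ≤ K) : fixCard (K := K) P (F.ProdSet H K) = Nat.card (F.OrbitHom P H) := by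
  classical
  have hinv := fun q : F.ProdIndex H K => q.rep.hom.isMor_fn.exists_inv
  choose r hr hr1 hr2 hr3 using hinv
  have him : ∀ q : F.ProdIndex H K, q.image = im q.rep.A q.rep.hom.fn := fun q =>
    OrbitHom.image_rep _
  -- Representatives of fixed cosets; `f` below takes the coset and `g` takes the morphism `P → H`.
  let W := {t : Σ _ : F.ProdIndex H K, K // ∀ x ∈ P, (t.2 : S)⁻¹ * x * t.2 ∈ t.1.image}
  have hmor : ∀ t : W, F.IsMor P (fun x => r t.1.1 ((t.1.2 : S)⁻¹ * x * t.1.2)) := fun t => by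
    refine ((F.isMor_conj (t.1.2 : S)⁻¹ P).comp (hr t.1.1) fun x hx => ?_).congr fun x hx => ?_
    · rw [inv_inv, ← him]; exact t.2 x hx
    · rw [inv_inv]
  have hmem : ∀ t : W, ∀ x ∈ P, r t.1.1 ((t.1.2 : S)⁻¹ * x * t.1.2) ∈ t.1.1.rep.A :=
    fun t x hx => hr2 _ _ (by rw [← him]; exact t.2 x hx)
  let c : ∀ t : W, F.OrbitHom P t.1.1.rep.A := fun t => OrbitHom.ofFun _ (hmor t) (hmem t)
  have hc : ∀ t : W, ConjOn t.1.1.rep.A P (fun x => r t.1.1 ((t.1.2 : S)⁻¹ * x * t.1.2))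
    (c t).fn := fun t => OrbitHom.ofFun_fn _ _
  have hsnd : ∀ t : W, (prodMap H K P ⟨t.1.1, c t⟩).2 = OrbitHom.incl F hPK := fun t => by
    refine OrbitHom.eq_iff.2 ((prodMap_snd_fn _ _).symm.trans
      ((((hc t).comp t.1.1.rep.hom (hmem t)).symm.trans ?_).trans (OrbitHom.incl_fn hPK)))
    refine ⟨t.1.2, t.1.2.2, fun x hx => ?_⟩
    dsimp only
    rw [hr3 _ _ (by rw [← him]; exact t.2 x hx)]
    group
  let f : W → {x : F.ProdSet H K // ∀ k : K, (k : S) ∈ P → k • x = x} := fun t =>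
    ⟨⟨t.1.1, (t.1.2 : K ⧸ _)⟩, fun k hk => by
      rw [Sigma.smul_mk]
      congr 1
      exact smul_mk_eq_iff.2 (t.2 k hk)⟩
  let g : W → F.OrbitHom P H := fun t => (prodMap H K P ⟨t.1.1, c t⟩).1
  refine card_eq_of_surjective (f := f) (g := g) ?_ ?_ ?_
  · rintro ⟨⟨q, y⟩, hy⟩
    obtain ⟨k, rfl⟩ := QuotientGroup.mk_surjective y
    refine ⟨⟨⟨q, k⟩, fun x hx => ?_⟩, rfl⟩
    have := hy ⟨x, hPK hx⟩ hx
    rw [Sigma.smul_mk] at this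
    have := eq_of_heq (Sigma.mk.inj this).2
    have h3 := smul_mk_eq_iff.1 this
    exact h3
  · intro a
    obtain ⟨⟨q, d⟩, hd⟩ := prodMap_surjective hP (a, OrbitHom.incl F hPK)
    have h2 : ConjOn K P (fun x => q.rep.hom.fn (d.fn x)) (fun x => x) :=
      (prodMap_snd_fn q d).trans (by rw [hd]; exact (OrbitHom.incl_fn hPK).symm)
    obtain ⟨k, hk, e⟩ := h2
    have e' : ∀ x ∈ P, k⁻¹ * x * k = q.rep.hom.fn (d.fn x) := fun x hx => by
      have := e x hx
      dsimp only at this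
      nth_rewrite 1 [this]
      group
    have ht : ∀ x ∈ P, k⁻¹ * x * k ∈ q.image := fun x hx => by
      rw [e' x hx, him]
      exact q.rep.hom.isMor_fn.mem_im_of_mem (d.fn_mem hx)
    refine ⟨⟨⟨q, ⟨k, hk⟩⟩, ht⟩, ?_⟩
    have hcd : c ⟨⟨q, ⟨k, hk⟩⟩, ht⟩ = d := OrbitHom.eq_iff.2 ((hc _).symm.trans (.of_eq
      fun x hx => by
        dsimp only
        rw [e' x hx, hr1 _ _ (d.fn_mem hx)]))
    change (prodMap H K P ⟨q, c ⟨⟨q, ⟨k, hk⟩⟩, ht⟩⟩).1 = a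
    rw [hcd, hd]
  · intro s t
    have hg : g s = g t ↔ (⟨s.1.1, c s⟩ : Σ q : F.ProdIndex H K, F.OrbitHom P q.rep.A) =
        ⟨t.1.1, c t⟩ := by
      rw [← (hF.prodMap_injective hS hP (H := H) (K := K)).eq_iff, Prod.ext_iff, hsnd, hsnd]
      exact ⟨fun h => ⟨h, rfl⟩, fun h => h.1⟩
    rw [hg]
    obtain ⟨⟨q, k, hk⟩, hs⟩ := s
    obtain ⟨⟨q', l, hl⟩, ht⟩ := t
    by_cases hqq : q = q'
    swap
    · exact ⟨fun h => (hqq (congrArg (fun t => t.1.1) h)).elim,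
        fun h => (hqq (congrArg Sigma.fst h)).elim⟩
    subst hqq
    have hf : f ⟨⟨q, ⟨k, hk⟩⟩, hs⟩ = f ⟨⟨q, ⟨l, hl⟩⟩, ht⟩ ↔ k⁻¹ * l ∈ q.image := by
      rw [Subtype.ext_iff, Sigma.mk.inj_iff, heq_iff_eq, QuotientGroup.eq,
        Subgroup.mem_subgroupOf]
      simp
    rw [hf, Sigma.mk.inj_iff, heq_iff_eq, OrbitHom.eq_iff]
    have hcc : ConjOn q.rep.A P (c ⟨⟨q, ⟨k, hk⟩⟩, hs⟩).fn (c ⟨⟨q, ⟨l, hl⟩⟩, ht⟩).fn ↔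
        ConjOn q.rep.A P (fun x => r q (k⁻¹ * x * k)) (fun x => r q (l⁻¹ * x * l)) :=
      ⟨fun h => (hc ⟨⟨q, ⟨k, hk⟩⟩, hs⟩).trans (h.trans (hc ⟨⟨q, ⟨l, hl⟩⟩, ht⟩).symm),
        fun h => (hc ⟨⟨q, ⟨k, hk⟩⟩, hs⟩).symm.trans (h.trans (hc ⟨⟨q, ⟨l, hl⟩⟩, ht⟩))⟩
    rw [hcc]
    have hm := q.rep.hom.isMor_fn
    constructor
    · intro h
      refine ⟨rfl, ?_⟩
      rw [him, hm.mem_im] at h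
      obtain ⟨a, ha, e⟩ := h
      refine ⟨a⁻¹, inv_mem ha, fun x hx => ?_⟩
      have h1 : l⁻¹ * x * l = (q.rep.hom.fn a)⁻¹ * (k⁻¹ * x * k) * (q.rep.hom.fn a)⁻¹⁻¹ := by
        rw [e]; group
      have h2 : (q.rep.hom.fn a)⁻¹ ∈ im q.rep.A q.rep.hom.fn := inv_mem (hm.mem_im_of_mem ha)
      dsimp only
      rw [h1, (hr q).map_conj h2 (by rw [← him]; exact hs x hx), (hr q).map_inv
        (hm.mem_im_of_mem ha), hr1 q a ha]
    · rintro ⟨-, a, ha, e⟩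
      have h1 : ∀ x ∈ P, l⁻¹ * x * l = q.rep.hom.fn a * (k⁻¹ * x * k) * (q.rep.hom.fn a)⁻¹ := by
        intro x hx
        have hs' : k⁻¹ * x * k ∈ im q.rep.A q.rep.hom.fn := by rw [← him]; exact hs x hx
        have ht' : l⁻¹ * x * l ∈ im q.rep.A q.rep.hom.fn := by rw [← him]; exact ht x hx
        have := congrArg q.rep.hom.fn (e x hx)
        rwa [hr3 _ _ ht', hm.map_conj ha (hr2 _ _ hs'), hr3 _ _ hs'] at this
      -- This element centralizes `P`, so centricity puts it in `P`. Since `P` fixes the coset of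
      -- `l`, it follows that `k` and `l` represent the same coset.
      have hw : l * q.rep.hom.fn a * k⁻¹ ∈ P := by
        refine hP.mem_of_commute fun x hx => ?_
        calc _ = l * (q.rep.hom.fn a * (k⁻¹ * x * k) * (q.rep.hom.fn a)⁻¹) * l⁻¹ := by group
          _ = x := by rw [← h1 x hx]; group
      have h2 := ht _ hw
      have h3 : q.rep.hom.fn a ∈ q.image := by rw [him]; exact hm.mem_im_of_mem ha
      convert mul_mem (inv_mem h3) h2 using 1
      group

end FusionSystem

end

/-! ### Binary products and marks in the additive extension -/

section

/-- A linear relation between rows of a triangular table of marks holds for every invariant. -/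
theorem sum_eq_zero_of_marks {ι : Type u} {C : Type v} {V : Type w} [AddCommGroup V]
    {m : C → C → ℕ} {size : C → ℕ} {r : C → C → Prop} (h1 : ∀ P, m P P ≠ 0)
    (h2 : ∀ P H, m P H ≠ 0 → size P ≤ size H ∧ (size H ≤ size P → r P H))
    (h3 : ∀ P H H', r H H' → m P H = m P H') {f : C → V} (h4 : ∀ H H', r H H' → f H = f H')
    (c : ι → ℤ) (h : ι → C) (s : Finset ι) (hs : ∀ P, ∑ i ∈ s, c i * (m P (h i) : ℤ) = 0) :
    ∑ i ∈ s, c i • f (h i) = 0 := by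
  classical
  induction hk : s.card using Nat.strong_induction_on generalizing s with
  | h k ih =>
  rcases s.eq_empty_or_nonempty with rfl | hne
  · simp
  obtain ⟨i0, hi0, hmax⟩ := s.exists_max_image (fun i => size (h i)) hne
  -- `Q` has maximal size, so at `Q` only the members of its own class have a nonzero mark. The
  -- relation at `Q` makes their coefficients sum to zero, the whole class drops out, and the
  -- induction continues with fewer terms.
  set Q := h i0
  have hrQ : r Q Q := (h2 Q Q (h1 Q)).2 le_rfl
  have hout : ∀ i ∈ s, ¬ r Q (h i) → m Q (h i) = 0 := fun i hi hr => by
    by_contra hm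
    exact hr ((h2 _ _ hm).2 (hmax i hi))
  have hc : ∑ i ∈ s with r Q (h i), c i = 0 := by
    have := hs Q
    rw [← Finset.sum_filter_add_sum_filter_not s (fun i => r Q (h i)),
      Finset.sum_eq_zero (s := s.filter fun i => ¬ r Q (h i)) fun i hi => by
        rw [Finset.mem_filter] at hi; simp [hout i hi.1 hi.2], add_zero,
      Finset.sum_congr rfl fun i hi => by
        rw [← h3 Q Q (h i) (Finset.mem_filter.1 hi).2], ← Finset.sum_mul] at this
    exact (mul_eq_zero.1 this).resolve_right (by exact_mod_cast h1 Q)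
  have key : ∀ P, ∑ i ∈ s with ¬ r Q (h i), c i * (m P (h i) : ℤ) = 0 := fun P => by
    have := hs P
    rwa [← Finset.sum_filter_add_sum_filter_not s (fun i => r Q (h i)),
      Finset.sum_congr rfl fun i hi => by
        rw [← h3 P Q (h i) (Finset.mem_filter.1 hi).2], ← Finset.sum_mul, hc, zero_mul,
      zero_add] at this
  rw [← Finset.sum_filter_add_sum_filter_not s (fun i => r Q (h i)),
    ih _ (by
      rw [← hk]
      refine Finset.card_lt_card (Finset.filter_ssubset.2 ⟨i0, hi0, ?_⟩)
      simpa using hrQ) _ key rfl, add_zero,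
    Finset.sum_congr rfl fun i hi => by
      rw [← h4 Q (h i) (Finset.mem_filter.1 hi).2], ← Finset.sum_smul, hc, zero_smul]

variable {S : Type u} [Group S] {F : FusionSystem S}

namespace FusionSystem

theorem Centric.nonempty_iso {H K : F.Centric} (h : F.Conj H.grp K.grp) : Nonempty (H ≅ K) := by
  obtain ⟨e, he⟩ := h
  refine ⟨⟨OrbitHom.mk he, OrbitHom.mk (symm_mem he), ?_, ?_⟩⟩
  · refine (OrbitHom.mk_eq_iff _ _).2 ⟨1, fun x => ?_⟩
    simp
  · refine (OrbitHom.mk_eq_iff _ _).2 ⟨1, fun x => ?_⟩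
    simp

theorem OrbitHom.card_le [Finite S] {H K : Subgroup S} (a : F.OrbitHom H K) :
    Nat.card H ≤ Nat.card K := by
  rw [← a.isMor_fn.card_im]
  exact card_le_of_le (a.isMor_fn.im_le fun x hx => a.fn_mem hx)

theorem OrbitHom.conj [Finite S] {H K : Subgroup S} (a : F.OrbitHom H K)
    (h : Nat.card K ≤ Nat.card H) : F.Conj H K := by
  have := a.isMor_fn.conj_im
  rwa [Subgroup.eq_of_le_of_card_ge (a.isMor_fn.im_le fun x hx => a.fn_mem hx)
    (a.isMor_fn.card_im ▸ h)] at this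

instance [Finite S] (H K : F.Centric) : Finite (H ⟶ K) :=
  inferInstanceAs (Finite (F.OrbitHom H.grp K.grp))

end FusionSystem

namespace AddExt

/-- A morphism is given by morphisms from the components of its source to components of its
target. -/
def homEquiv (X Y : F.AddExt) : (X ⟶ Y) ≃ ∀ i, Σ j, X.obj.obj i ⟶ Y.obj.obj j where
  toFun f i := ⟨f.hom.f i, f.hom.φ i⟩
  invFun s := ObjectProperty.homMk ⟨fun i => (s i).1, fun i => (s i).2⟩
  left_inv _ := rfl
  right_inv _ := rfl

/-! ### Binary products -/

/-- A component of the product of two objects. -/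
def prodComp [Finite S] (X Y : F.AddExt) (i : X.obj.I) (j : Y.obj.I)
    (n : Fin (Nat.card (F.ProdIndex (X.obj.obj i).grp (Y.obj.obj j).grp))) :
    F.ProdIndex (X.obj.obj i).grp (Y.obj.obj j).grp :=
  (Finite.equivFin _).symm n

/-- The product of two objects. -/
def prodObj [Finite S] (X Y : F.AddExt) : F.AddExt :=
  -- Index types of formal coproducts live in `Type`, whereas `F.ProdIndex` lives in `Type u`; hence
  -- the numbering by `Fin`.
  ⟨⟨Σ i : X.obj.I, Σ j : Y.obj.I,
      Fin (Nat.card (F.ProdIndex (X.obj.obj i).grp (Y.obj.obj j).grp)),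
    fun t => ⟨(prodComp X Y t.1 t.2.1 t.2.2).rep.A, (prodComp X Y t.1 t.2.1 t.2.2).rep.isCentric⟩⟩,
    by
      have := X.property
      have := Y.property
      exact inferInstanceAs (Finite (Σ _ : X.obj.I, Σ _ : Y.obj.I, Fin _))⟩

/-- The first projection of the product. -/
def prodFst [Finite S] (X Y : F.AddExt) : prodObj X Y ⟶ X :=
  (homEquiv _ _).symm fun t => ⟨t.1, FusionSystem.OrbitHom.incl F
    (prodComp X Y t.1 t.2.1 t.2.2).rep.le⟩

/-- The second projection of the product. -/
def prodSnd [Finite S] (X Y : F.AddExt) : prodObj X Y ⟶ Y :=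
  (homEquiv _ _).symm fun t => ⟨t.2.1, (prodComp X Y t.1 t.2.1 t.2.2).rep.hom⟩

/-- The bijectivity of `prodMap`, collected over all pairs of components. It yields both the
universal property of the product and the multiplicativity of marks. -/
theorem prodObj_components_bijective {p : ℕ} [Fact p.Prime] [Finite S]
    (hS : IsPGroup p S) (hF : F.IsSaturated p) (X Y : F.AddExt) (P : F.Centric) :
    Function.Bijective (fun t : Σ j, P ⟶ (prodObj X Y).obj.obj j =>
      ((⟨(prodFst X Y).hom.f t.1, t.2 ≫ (prodFst X Y).hom.φ t.1⟩ : Σ j, P ⟶ X.obj.obj j),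
       (⟨(prodSnd X Y).hom.f t.1, t.2 ≫ (prodSnd X Y).hom.φ t.1⟩ : Σ j, P ⟶ Y.obj.obj j))) := by
  constructor
  · rintro ⟨⟨i, j, n⟩, c⟩ ⟨⟨i', j', n'⟩, c'⟩ h
    obtain ⟨hi, hc⟩ := Sigma.mk.inj (congrArg Prod.fst h)
    obtain ⟨hj, hc'⟩ := Sigma.mk.inj (congrArg Prod.snd h)
    change i = i' at hi
    change j = j' at hj
    subst hi
    subst hj
    have key : (⟨prodComp X Y i j n, c⟩ : Σ q : F.ProdIndex (X.obj.obj i).grp (Y.obj.obj j).grp,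
        F.OrbitHom P.grp q.rep.A) = ⟨prodComp X Y i j n', c'⟩ :=
      hF.prodMap_injective hS P.isCentric (Prod.ext (eq_of_heq hc) (eq_of_heq hc'))
    have hn : n = n' := (Finite.equivFin _).symm.injective (congrArg Sigma.fst key)
    subst hn
    congr 1
    exact eq_of_heq (Sigma.mk.inj key).2
  · rintro ⟨⟨i, a⟩, ⟨j, b⟩⟩
    obtain ⟨⟨q, c⟩, h⟩ := FusionSystem.prodMap_surjective (H := (X.obj.obj i).grp)
      (K := (Y.obj.obj j).grp) P.isCentric (a, b)
    obtain ⟨n, rfl⟩ := (Finite.equivFin _).symm.surjective q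
    exact ⟨⟨⟨i, j, n⟩, c⟩, Prod.ext (congrArg (Sigma.mk i) (congrArg Prod.fst h))
      (congrArg (Sigma.mk j) (congrArg Prod.snd h))⟩

theorem prodObj_bijective {p : ℕ} [Fact p.Prime] [Finite S]
    (hS : IsPGroup p S) (hF : F.IsSaturated p) (X Y Z : F.AddExt) :
    Function.Bijective (fun m : Z ⟶ prodObj X Y => (m ≫ prodFst X Y, m ≫ prodSnd X Y)) := by
  have hb := fun i => prodObj_components_bijective hS hF X Y (Z.obj.obj i)
  constructor
  · intro m m' h
    apply (homEquiv _ _).injective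
    funext i
    refine (hb i).1 (Prod.ext ?_ ?_)
    · exact congrFun (congrArg (homEquiv _ _) (congrArg Prod.fst h)) i
    · exact congrFun (congrArg (homEquiv _ _) (congrArg Prod.snd h)) i
  · rintro ⟨a, b⟩
    choose t ht using fun i => (hb i).2 (homEquiv _ _ a i, homEquiv _ _ b i)
    refine ⟨(homEquiv _ _).symm t, Prod.ext ?_ ?_⟩
    · apply (homEquiv _ _).injective
      funext i
      exact congrArg Prod.fst (ht i)
    · apply (homEquiv _ _).injective
      funext i
      exact congrArg Prod.snd (ht i)

/-- The object `prodObj X Y` is a product of `X` and `Y`. -/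
def prodIsLimit {p : ℕ} [Fact p.Prime] [Finite S]
    (hS : IsPGroup p S) (hF : F.IsSaturated p) (X Y : F.AddExt) :
    Limits.IsLimit (Limits.BinaryFan.mk (prodFst X Y) (prodSnd X Y)) :=
  Limits.BinaryFan.isLimitMk
    (fun s => ((prodObj_bijective hS hF X Y s.pt).2 (s.fst, s.snd)).choose)
    (fun s => congrArg Prod.fst
      ((prodObj_bijective hS hF X Y s.pt).2 (s.fst, s.snd)).choose_spec)
    (fun s => congrArg Prod.snd
      ((prodObj_bijective hS hF X Y s.pt).2 (s.fst, s.snd)).choose_spec)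
    (fun s m h1 h2 => (prodObj_bijective hS hF X Y s.pt).1 (by
      refine Eq.trans (b := (s.fst, s.snd)) (Prod.ext h1 h2) ?_
      exact ((prodObj_bijective hS hF X Y s.pt).2 (s.fst, s.snd)).choose_spec.symm))

theorem hasBinaryProducts {p : ℕ} [Fact p.Prime] [Finite S]
    (hS : IsPGroup p S) (hF : F.IsSaturated p) : Limits.HasBinaryProducts F.AddExt := by
  have : ∀ {X Y : F.AddExt}, Limits.HasLimit (Limits.pair X Y) := fun {X Y} =>
    ⟨⟨⟨_, prodIsLimit hS hF X Y⟩⟩⟩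
  exact Limits.hasBinaryProducts_of_hasLimit_pair _

theorem nonempty_prod_iso {p : ℕ} [Fact p.Prime] [Finite S]
    (hS : IsPGroup p S) (hF : F.IsSaturated p) (X Y : F.AddExt)
    [Limits.HasBinaryProduct X Y] : Nonempty ((X ⨯ Y) ≅ prodObj X Y) :=
  ⟨(Limits.limit.isLimit _).conePointUniqueUpToIso (prodIsLimit hS hF X Y)⟩

/-! ### Marks -/

/-- The number of morphisms from `P` to `X`. -/
def mark (P : F.Centric) (X : F.AddExt) : ℕ := Nat.card (Σ j, P ⟶ X.obj.obj j)

theorem mark_congr {P : F.Centric} {X Y : F.AddExt} (e : Nonempty (X ≅ Y)) :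
    mark P X = mark P Y := by
  obtain ⟨e⟩ := e
  have c : ∀ Z : F.AddExt, (P.toAddExt ⟶ Z) ≃ Σ j, P ⟶ Z.obj.obj j := fun Z =>
    (homEquiv P.toAddExt Z).trans
      ((Equiv.funUnique PUnit (Σ j, P ⟶ Z.obj.obj j)))
  exact Nat.card_congr ((c X).symm.trans ((Iso.homToEquiv e).trans (c Y)))

theorem mark_congr_left {P Q : F.Centric} (e : Nonempty (P ≅ Q)) (X : F.AddExt) :
    mark P X = mark Q X := by
  obtain ⟨e⟩ := e
  exact Nat.card_congr (Equiv.sigmaCongrRight fun j => Iso.homFromEquiv e)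

theorem mark_eq_sum [Finite S] (P : F.Centric) (X : F.AddExt) [Fintype X.obj.I] :
    mark P X = ∑ i, Nat.card (P ⟶ X.obj.obj i) := Nat.card_sigma

theorem mark_toAddExt [Finite S] (P H : F.Centric) : mark P H.toAddExt = Nat.card (P ⟶ H) := by
  have : Fintype H.toAddExt.obj.I := inferInstanceAs (Fintype PUnit)
  exact Nat.card_congr (Equiv.uniqueSigma (fun _ : PUnit => P ⟶ H))

theorem mark_sum [Finite S] (P : F.Centric) (X Y : F.AddExt) :
    mark P (sum X Y) = mark P X + mark P Y := by
  have := X.property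
  have := Y.property
  have := Fintype.ofFinite X.obj.I
  have := Fintype.ofFinite Y.obj.I
  let : Fintype (sum X Y).obj.I := inferInstanceAs (Fintype (X.obj.I ⊕ Y.obj.I))
  rw [mark_eq_sum, mark_eq_sum, mark_eq_sum]
  exact Fintype.sum_sum_type (α₁ := X.obj.I) (α₂ := Y.obj.I) _

theorem mark_prodObj {p : ℕ} [Fact p.Prime] [Finite S]
    (hS : IsPGroup p S) (hF : F.IsSaturated p) (P : F.Centric) (X Y : F.AddExt) :
    mark P (prodObj X Y) = mark P X * mark P Y :=
  (Nat.card_congr (Equiv.ofBijective _ (prodObj_components_bijective hS hF X Y P))).trans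
    (Nat.card_prod _ _)

end AddExt

namespace BurnsideClass

/-- The number of morphisms from `P`, as an additive function. -/
def mark [Finite S] (P : F.Centric) : BurnsideClass F →+ ℕ where
  toFun := Quotient.lift (s := isIsomorphicSetoid F.AddExt) (AddExt.mark P)
    fun _ _ h => AddExt.mark_congr h
  map_zero' := by
    have : IsEmpty (Σ j, P ⟶ (AddExt.empty F).obj.obj j) := ⟨fun t => PEmpty.elim t.1⟩
    exact Nat.card_of_isEmpty
  map_add' a b := by
    induction a using ind with
    | h X =>
    induction b using ind with
    | h Y => exact AddExt.mark_sum P X Y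

theorem mark_mk [Finite S] (P : F.Centric) (X : F.AddExt) : mark P (mk X) = AddExt.mark P X := rfl

theorem mk_eq_sum_aux (I : Type) [Fintype I] : ∀ o : I → F.Centric,
    mk (⟨⟨I, o⟩, inferInstanceAs (Finite I)⟩ : F.AddExt) = ∑ i, mk (o i).toAddExt := by
  refine Fintype.induction_empty_option (P := fun I _ => ∀ o : I → F.Centric,
    mk (⟨⟨I, o⟩, inferInstanceAs (Finite I)⟩ : F.AddExt) = ∑ i, mk (o i).toAddExt) ?_ ?_ ?_ I
  · intro I J _ e h o
    let := Fintype.ofEquiv J e.symm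
    refine Eq.trans ?_ ((h (fun i => o (e i))).trans
      (Fintype.sum_equiv e (fun i => mk (o (e i)).toAddExt) (fun i => mk (o i).toAddExt)
        fun i => rfl))
    exact (sound (AddExt.iso_of_components e fun i => ⟨Iso.refl _⟩)).symm
  · intro o
    exact sound (AddExt.iso_of_components (Equiv.equivOfIsEmpty PEmpty PEmpty) fun i => i.elim)
  · intro I _ h o
    rw [Fintype.sum_option, ← h (fun i => o (some i)), mk_add_mk]
    exact sound (AddExt.iso_of_components ((Equiv.optionEquivSumPUnit I).trans (Equiv.sumComm _ _))
      (by rintro (_ | i); exacts [⟨Iso.refl _⟩, ⟨Iso.refl _⟩]))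

/-- Reduces additive statements about arbitrary objects to single centric subgroups. -/
theorem mk_eq_sum (X : F.AddExt) [Fintype X.obj.I] :
    mk X = ∑ i, mk (X.obj.obj i).toAddExt :=
  mk_eq_sum_aux X.obj.I X.obj.obj

/-- Since products exist, the default value in `prodClass` never occurs, and the product may be
computed as `AddExt.prodObj`. -/
theorem mark_prodClass {p : ℕ} [Fact p.Prime] [Finite S]
    (hS : IsPGroup p S) (hF : F.IsSaturated p) (P H K : F.Centric) :
    mark P (prodClass H K) = Nat.card (P ⟶ H) * Nat.card (P ⟶ K) := by
  have := AddExt.hasBinaryProducts hS hF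
  have hp : Limits.HasBinaryProduct H.toAddExt K.toAddExt := inferInstance
  rw [prodClass, dif_pos hp, sound (AddExt.nonempty_prod_iso hS hF _ _), mark_mk,
    AddExt.mark_prodObj hS hF, AddExt.mark_toAddExt, AddExt.mark_toAddExt]

theorem mark_mul {p : ℕ} [Fact p.Prime] [Finite S]
    (hS : IsPGroup p S) (hF : F.IsSaturated p) (P : F.Centric) (a b : BurnsideClass F) :
    mark P (a * b) = mark P a * mark P b := by
  induction a using ind with
  | h X =>
  induction b using ind with
  | h Y =>
  have := X.property
  have := Y.property
  have := Fintype.ofFinite X.obj.I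
  have := Fintype.ofFinite Y.obj.I
  rw [mk_mul_mk, mulObj_eq X Y inferInstance inferInstance, map_sum, mark_mk, mark_mk,
    AddExt.mark_eq_sum, AddExt.mark_eq_sum, Finset.sum_mul_sum]
  refine Finset.sum_congr rfl fun i _ => ?_
  rw [map_sum]
  exact Finset.sum_congr rfl fun j _ => mark_prodClass hS hF _ _ _

end BurnsideClass

/-! ### Marks on the Grothendieck ring -/

namespace GrothendieckRing

/-- The number of morphisms from `P`, on the Grothendieck ring. -/
def mark [Finite S] (P : F.Centric) : GrothendieckRing (BurnsideClass F) →+ ℤ :=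
  lift ((Nat.castAddMonoidHom ℤ).comp (BurnsideClass.mark P))

theorem mark_of [Finite S] (P : F.Centric) (a : BurnsideClass F) :
    mark P (of a) = BurnsideClass.mark P a := lift_of _ _

theorem mark_mul {p : ℕ} [Fact p.Prime] [Finite S]
    (hS : IsPGroup p S) (hF : F.IsSaturated p) (P : F.Centric)
    (a b : GrothendieckRing (BurnsideClass F)) : mark P (a * b) = mark P a * mark P b := by
  induction a using ind with
  | h a a' =>
  induction b using ind with
  | h b b' =>
    simp only [mul_sub, sub_mul, ← of_mul, map_sub, mark_of, BurnsideClass.mark_mul hS hF,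
      Nat.cast_mul]

/-- An element of the Grothendieck ring is determined by its marks. -/
theorem mark_injective [Finite S] {a b : GrothendieckRing (BurnsideClass F)}
    (h : ∀ P : F.Centric, mark P a = mark P b) : a = b := by
  have h0 : ∀ P : F.Centric, mark P (a - b) = 0 := fun P => by rw [map_sub, h, sub_self]
  rw [← sub_eq_zero]
  generalize a - b = x at h0 ⊢
  induction x using ind with
  | h a b =>
  induction a using BurnsideClass.ind with
  | h X =>
  induction b using BurnsideClass.ind with
  | h Y =>
  have := X.property
  have := Y.property
  have := Fintype.ofFinite X.obj.I
  have := Fintype.ofFinite Y.obj.I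
  -- The components of `X` with sign `1` and those of `Y` with sign `-1` form a relation between
  -- marks. The table is triangular: a morphism `P → H` forces `|P| ≤ |H|`, and it is an isomorphism
  -- if the orders agree.
  have key := sum_eq_zero_of_marks (m := fun P H : F.Centric => Nat.card (P ⟶ H))
    (size := fun P => Nat.card P.grp) (r := fun P H => Nonempty (P ≅ H))
    (f := fun H => of (BurnsideClass.mk H.toAddExt))
    (fun P => (Nat.card_pos_iff.2 ⟨⟨𝟙 P⟩, inferInstance⟩).ne')
    (fun P H hm => by
      obtain ⟨a⟩ := (Nat.card_pos_iff.1 (Nat.pos_of_ne_zero hm)).1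
      exact ⟨FusionSystem.OrbitHom.card_le a, fun hle =>
        FusionSystem.Centric.nonempty_iso (FusionSystem.OrbitHom.conj a hle)⟩)
    (fun P H H' ⟨e⟩ => Nat.card_congr (Iso.homToEquiv e))
    (fun H H' ⟨e⟩ => congrArg of (BurnsideClass.sound
      (AddExt.iso_of_components (Equiv.refl _) fun _ => ⟨e⟩)))
    (ι := X.obj.I ⊕ Y.obj.I) (Sum.elim 1 (-1)) (Sum.elim X.obj.obj Y.obj.obj) Finset.univ
    (fun P => by
      have := h0 P
      rw [map_sub, mark_of, mark_of, BurnsideClass.mark_mk, BurnsideClass.mark_mk,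
        AddExt.mark_eq_sum, AddExt.mark_eq_sum] at this
      rw [Fintype.sum_sum_type]
      simpa [← sub_eq_add_neg] using this)
  rw [Fintype.sum_sum_type] at key
  rw [BurnsideClass.mk_eq_sum X, BurnsideClass.mk_eq_sum Y, map_sum, map_sum]
  simpa [← sub_eq_add_neg] using key

end GrothendieckRing

end

section

variable {S : Type u} [Group S] {F : FusionSystem S}

namespace FusionSystem

/-! ### Automorphisms in the orbit category -/

/-- The class of an automorphism. -/
def OrbitHom.ofAut {P : Subgroup S} (a : F.aut P) : F.OrbitHom P P := OrbitHom.mk (mem_aut.1 a.2)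

theorem OrbitHom.ofAut_mul {P : Subgroup S} (a b : F.aut P) :
    ofAut (a * b) = comp (ofAut a) (ofAut b) := rfl

theorem OrbitHom.comp_ofAut_one {P H : Subgroup S} (a : F.OrbitHom P H) :
    comp a (ofAut 1) = a := by
  induction a using OrbitHom.ind
  rfl

theorem OrbitHom.ofAut_eq_iff {P : Subgroup S} {a b : F.aut P} : ofAut a = ofAut b ↔
    ∃ k : P, ∀ x : P, ((b : MulAut P) x : S) = k * (a : MulAut P) x * (k : S)⁻¹ :=
  (mk_eq_iff (mem_aut.1 a.2) (mem_aut.1 b.2)).trans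
    ⟨fun ⟨k, h⟩ => ⟨k, fun x => congrArg Subtype.val (h x)⟩,
      fun ⟨k, h⟩ => ⟨k, fun x => Subtype.ext (h x)⟩⟩

theorem OrbitHom.ofAut_surjective [Finite S] {P : Subgroup S} :
    Function.Surjective (ofAut : F.aut P → F.OrbitHom P P) := by
  intro a
  induction a using OrbitHom.ind with
  | h φ hφ =>
    exact ⟨⟨MulEquiv.ofBijective φ (Finite.injective_iff_bijective.1 (F.injective hφ)), hφ⟩, rfl⟩

theorem OrbitHom.ofAut_fn {P : Subgroup S} (a : F.aut P) {f : S → S}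
    (h : ∀ x : P, f x = (a : MulAut P) x) : ConjOn P P f (ofAut a).fn :=
  ConjOn.trans (.of_eq fun x hx => (extendFun_of_mem _ hx).trans (h ⟨x, hx⟩).symm)
    (mk_fn (mem_aut.1 a.2))

/-- The normalizer of `P` acts on the morphisms from `P` in the orbit category. -/
instance normalizerAction (P H : Subgroup S) :
    MulAction (Subgroup.normalizer (P : Set S)) (F.OrbitHom P H) where
  smul n a := OrbitHom.comp a (OrbitHom.ofAut (F.normalizerHom P n)⁻¹)
  one_smul a := by
    change OrbitHom.comp a _ = a
    rw [map_one, inv_one, OrbitHom.comp_ofAut_one]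
  mul_smul m n a := by
    change OrbitHom.comp a _ = OrbitHom.comp (OrbitHom.comp a _) _
    rw [OrbitHom.comp_assoc, map_mul, mul_inv_rev, OrbitHom.ofAut_mul]

theorem smul_orbitHom_fn {P H : Subgroup S} (n : Subgroup.normalizer (P : Set S))
    (a : F.OrbitHom P H) : ConjOn H P (fun x => a.fn ((n : S)⁻¹ * x * n)) (n • a).fn := by
  refine ConjOn.trans ?_ (OrbitHom.comp_fn a (OrbitHom.ofAut (F.normalizerHom P n)⁻¹))
  refine ConjOn.comp (OrbitHom.ofAut_fn _ fun x => ?_) a fun x hx => ?_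
  · rw [← map_inv, normalizerHom_apply]
    simp
  · have := (Subgroup.mem_normalizer_iff.1 (inv_mem n.2) x).1 hx
    simpa using this

/-- A class `P → H` is fixed by `n` when `n` acts through it like an element of `H`. By the
extension theorem it then extends to the group generated by `P` and `n`, and it does so uniquely
because restriction to a centric subgroup is injective in the orbit category. -/
theorem IsSaturated.card_fixedBy {p : ℕ} [Fact p.Prime] [Finite S]
    (hS : IsPGroup p S) (hF : F.IsSaturated p) {P H : Subgroup S} (hP : F.IsCentric P)
    (n : Subgroup.normalizer (P : Set S)) :
    Nat.card (MulAction.fixedBy (F.OrbitHom P H) n) =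
      Nat.card (F.OrbitHom (P ⊔ Subgroup.zpowers (n : S)) H) := by
  have hle : P ≤ P ⊔ Subgroup.zpowers (n : S) := le_sup_left
  have hn : (n : S) ∈ P ⊔ Subgroup.zpowers (n : S) :=
    (le_sup_right : _ ≤ P ⊔ Subgroup.zpowers (n : S)) (Subgroup.mem_zpowers _)
  have hres : ∀ b : F.OrbitHom (P ⊔ Subgroup.zpowers (n : S)) H,
      ConjOn H P b.fn (OrbitHom.comp b (OrbitHom.incl F hle)).fn := fun b =>
    ConjOn.trans ((OrbitHom.incl_fn hle).comp b fun x hx => hle hx) (OrbitHom.comp_fn _ _)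
  have hc : ∀ x ∈ P, (n : S)⁻¹ * x * n ∈ P := fun x hx => by
    have := (Subgroup.mem_normalizer_iff.1 (inv_mem n.2) x).1 hx
    simpa using this
  have hconj : ∀ {f g : S → S}, ConjOn H P f g →
      ConjOn H P (fun x => f ((n : S)⁻¹ * x * n)) (fun x => g ((n : S)⁻¹ * x * n)) :=
    fun ⟨k, hk, e⟩ => ⟨k, hk, fun x hx => e _ (hc x hx)⟩
  symm
  refine Nat.card_congr (Equiv.ofBijective (fun b => (⟨OrbitHom.comp b (OrbitHom.incl F hle), ?_⟩ :
    MulAction.fixedBy (F.OrbitHom P H) n)) ⟨?_, ?_⟩)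
  · refine OrbitHom.eq_iff.2 ((smul_orbitHom_fn _ _).symm.trans
      ((hconj (hres b).symm).trans (ConjOn.trans ?_ (hres b))))
    refine ⟨b.fn n, b.fn_mem hn, fun x hx => ?_⟩
    rw [← b.isMor_fn.map_conj hn (hle (hc x hx))]
    congr 1
    group
  · intro b b' h
    refine OrbitHom.eq_iff.2 (hF.conjOn_of_conjOn hS hP hle b.isMor_fn b'.isMor_fn
      (fun x hx => b.fn_mem hx) ?_)
    exact (hres b).trans ((OrbitHom.eq_iff.1 (congrArg Subtype.val h)).trans (hres b').symm)
  · rintro ⟨a, ha⟩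
    have h1 : ConjOn H P (fun x => a.fn ((n : S)⁻¹ * x * n)) a.fn :=
      (smul_orbitHom_fn n a).trans (by rw [show n • a = a from ha]; exact .refl)
    obtain ⟨k, hk, e⟩ := h1
    obtain ⟨hP', g, hg, hgf, hgK⟩ := hF.exists_extension_transporter hS (H := ⊤) (K := H) hP
      a.isMor_fn le_top (fun x hx => a.fn_mem hx)
    have hmem : (n : S) ∈ transporter ⊤ H P a.fn := by
      refine ⟨Subgroup.mem_top _, n.2, k, hk, fun x hx => ?_⟩
      rw [e _ ((Subgroup.mem_normalizer_iff.1 n.2 x).1 hx)]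
      congr 3
      group
    have hle' : P ⊔ Subgroup.zpowers (n : S) ≤ transporter ⊤ H P a.fn :=
      sup_le hP' (Subgroup.zpowers_le.2 hmem)
    refine ⟨OrbitHom.ofFun g (hg.mono hle') fun x hx => hgK x (hle' hx), Subtype.ext ?_⟩
    refine OrbitHom.eq_iff.2 ((hres (OrbitHom.ofFun g (hg.mono hle')
      fun x hx => hgK x (hle' hx))).symm.trans ?_)
    exact ((OrbitHom.ofFun_fn (hg.mono hle') fun x hx => hgK x (hle' hx)).mono hle).symm.trans
      (.of_eq fun x hx => (hgf x hx).symm)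

theorem _root_.CentricMackey.card_eq_card_range_mul_card_ker {G : Type u} {H : Type v} [Group G]
    [Group H] (f : G →* H) : Nat.card G = Nat.card f.range * Nat.card f.ker := by
  rw [Subgroup.card_eq_card_quotient_mul_card_subgroup f.ker,
    Nat.card_congr (QuotientGroup.quotientKerEquivRange f).toEquiv]

/-- The endomorphisms of `P` in the orbit category are `Aut_F(P) / Inn(P)`, and since `P` is centric
the maps from `P` and from `N_S(P)` to `Aut_F(P)` have the same kernel. If `Aut_S(P)` is Sylow, this
exhibits `|N_S(P) : P|` as the `p`-part of the number of endomorphisms. -/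
theorem card_orbitHom_self_mul [Finite S] {P : Subgroup S} (hP : F.IsCentric P) :
    Nat.card (F.OrbitHom P P) * Nat.card P =
      (F.normalizerHom P).range.index * Nat.card (Subgroup.normalizer (P : Set S)) := by
  have hle : P ≤ Subgroup.normalizer (P : Set S) := Subgroup.le_normalizer
  obtain ⟨i, hi⟩ : ∃ i, i = (F.normalizerHom P).comp (Subgroup.inclusion hle) := ⟨_, rfl⟩
  have hia : ∀ k x : P, ((i k : MulAut P) x : S) = k * x * (k : S)⁻¹ := fun k x => by
    rw [hi]; exact normalizerHom_apply _ _
  have h1 : Nat.card (F.OrbitHom P P) = Nat.card (F.aut P ⧸ i.range) := by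
    -- `Inn(P)` acts on representatives by multiplication from the left, while the quotient is by
    -- cosets `a Inn(P)`; hence the inverse.
    refine card_eq_of_surjective (W := F.aut P) (f := OrbitHom.ofAut)
      (g := fun a => ((a⁻¹ : F.aut P) : F.aut P ⧸ i.range)) OrbitHom.ofAut_surjective ?_ ?_
    · intro y
      obtain ⟨a, rfl⟩ := QuotientGroup.mk_surjective y
      exact ⟨a⁻¹, by simp⟩
    · intro a b
      rw [QuotientGroup.eq, inv_inv, OrbitHom.ofAut_eq_iff]
      constructor
      · rintro ⟨k, h⟩
        refine ⟨k⁻¹, ?_⟩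
        rw [eq_mul_inv_iff_mul_eq]
        refine aut_ext fun x => ?_
        change ((i k⁻¹ : MulAut P) ((b : MulAut P) x) : S) = _
        rw [hia]
        rw [h x]
        simp [mul_assoc]
      · rintro ⟨k, h⟩
        refine ⟨k⁻¹, fun x => ?_⟩
        rw [eq_mul_inv_iff_mul_eq] at h
        rw [← h]
        change _ = _ * ((i k : MulAut P) ((b : MulAut P) x) : S) * _
        rw [hia]
        simp [mul_assoc]
  have h2 : Nat.card i.ker = Nat.card (F.normalizerHom P).ker := by
    refine Nat.card_congr (Equiv.ofBijective (fun x => (⟨Subgroup.inclusion hle x, by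
      have h := MonoidHom.mem_ker.1 x.2
      rw [MonoidHom.mem_ker, ← h]
      exact (DFunLike.congr_fun hi _).symm⟩ : (F.normalizerHom P).ker)) ⟨?_, ?_⟩)
    · intro x y h
      exact Subtype.ext (Subgroup.inclusion_injective hle (congrArg Subtype.val h))
    · rintro ⟨n, hn⟩
      have hnP : (n : S) ∈ P := hP.mem_of_commute fun x hx => by
        rw [← normalizerHom_apply (F := F) n ⟨x, hx⟩, MonoidHom.mem_ker.1 hn]
        rfl
      exact ⟨⟨⟨n, hnP⟩, by rw [hi]; exact hn⟩, rfl⟩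
  rw [h1, card_eq_card_range_mul_card_ker i, ← mul_assoc,
    ← Subgroup.card_eq_card_quotient_mul_card_subgroup, h2,
    card_eq_card_range_mul_card_ker (F.normalizerHom P), ← mul_assoc, Subgroup.index_mul_card]

/-- The centric subgroup generated by a centric subgroup and an element. -/
def Centric.adjoin (P : F.Centric) (s : S) : F.Centric :=
  ⟨P.grp ⊔ Subgroup.zpowers s, P.isCentric.mono le_sup_left⟩

end FusionSystem

/-! ### Congruences between marks and an element with constant marks -/

namespace GrothendieckRing

/-- Orbit counting: for a single subgroup `H` the sum is the number of fixed points of the elements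
of `N_S(P)` on `Hom(P, H)`, that is, the number of orbits times `|N_S(P)|`. -/
theorem card_normalizer_dvd_sum_mark {p : ℕ} [Fact p.Prime] [Finite S] (hS : IsPGroup p S)
    (hF : F.IsSaturated p) (P : F.Centric)
    [Fintype (Subgroup.normalizer (P.grp : Set S))] (e : GrothendieckRing (BurnsideClass F)) :
    (Nat.card (Subgroup.normalizer (P.grp : Set S)) : ℤ) ∣
      ∑ n : Subgroup.normalizer (P.grp : Set S), mark (P.adjoin n) e := by
  induction e using ind with
  | h a b =>
  simp only [map_sub, Finset.sum_sub_distrib]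
  suffices h : ∀ a : BurnsideClass F, (Nat.card (Subgroup.normalizer (P.grp : Set S)) : ℤ) ∣
      ∑ n : Subgroup.normalizer (P.grp : Set S), mark (P.adjoin n) (of a) from
    dvd_sub (h a) (h b)
  intro a
  induction a using BurnsideClass.ind with
  | h X =>
  have := X.property
  have := Fintype.ofFinite X.obj.I
  simp only [mark_of, BurnsideClass.mark_mk, AddExt.mark_eq_sum, Nat.cast_sum]
  rw [Finset.sum_comm]
  refine Finset.dvd_sum fun i _ => ?_
  classical
  have hfin := Fintype.ofFinite (F.OrbitHom P.grp (X.obj.obj i).grp)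
  have h := MulAction.sum_card_fixedBy_eq_card_orbits_mul_card_group
    (Subgroup.normalizer (P.grp : Set S)) (F.OrbitHom P.grp (X.obj.obj i).grp)
  have h2 : ∑ n : Subgroup.normalizer (P.grp : Set S), Nat.card (P.adjoin n ⟶ X.obj.obj i) =
      ∑ n : Subgroup.normalizer (P.grp : Set S),
        Fintype.card (MulAction.fixedBy (F.OrbitHom P.grp (X.obj.obj i).grp) n) :=
    Finset.sum_congr rfl fun n _ => by
      rw [← Nat.card_eq_fintype_card, hF.card_fixedBy hS P.isCentric]
      rfl
  rw [← Nat.cast_sum, h2, h, Nat.card_eq_fintype_card]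
  exact Int.natCast_dvd_natCast.2 (dvd_mul_left _ _)

theorem mark_congr [Finite S] {P Q : F.Centric} (h : Nonempty (P ≅ Q))
    (e : GrothendieckRing (BurnsideClass F)) : mark P e = mark Q e := by
  induction e using ind with
  | h a b =>
  induction a using BurnsideClass.ind with
  | h X =>
  induction b using BurnsideClass.ind with
  | h Y =>
  simp only [map_sub, mark_of, BurnsideClass.mark_mk, AddExt.mark_congr_left h]

/-- In the congruence for `P`, the elements of `P` contribute the mark at `P` and all others
contribute `n`, so `|N_S(P) : P|` divides `n - mark P e`. The remaining factor of `|P ⟶ P|` is the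
index `c` of `Aut_S(P)` in `Aut_F(P)`, prime to `p` because `P` is fully normalized. -/
theorem dvd_mark_sub {p : ℕ} [Fact p.Prime] [Finite S] (hS : IsPGroup p S)
    (hF : F.IsSaturated p) (P : F.Centric) (hP : F.FullyNormalized P.grp)
    (e : GrothendieckRing (BurnsideClass F)) (n : ℤ)
    (h : ∀ Q : F.Centric, P.grp < Q.grp → mark Q e = n) :
    ∃ c : ℕ, ¬ p ∣ c ∧ (Nat.card (P ⟶ P) : ℤ) ∣ c * (n - mark P e) := by
  obtain ⟨T, hT⟩ := hF.exists_sylow_eq_range hS P.grp hP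
  have : Finite (MulAut P.grp) :=
    Finite.of_injective (fun e => (e : P.grp → P.grp)) DFunLike.coe_injective
  refine ⟨(F.normalizerHom P.grp).range.index, hT ▸ T.not_dvd_index, ?_⟩
  have hf := Fintype.ofFinite (Subgroup.normalizer (P.grp : Set S))
  obtain ⟨t, ht⟩ := card_normalizer_dvd_sum_mark hS hF P e
  have h1 : ∀ x : Subgroup.normalizer (P.grp : Set S), (x : S) ∉ P.grp →
      mark (P.adjoin x) e = n := fun x hx => h _ (lt_of_le_of_ne le_sup_left fun e =>
        hx (sup_eq_left.1 e.symm (Subgroup.mem_zpowers (x : S))))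
  have h2 : ∀ x : Subgroup.normalizer (P.grp : Set S), (x : S) ∈ P.grp →
      mark (P.adjoin x) e = mark P e := fun x hx => by
    congr 1
    exact congrArg _ (FusionSystem.Centric.grp_injective F
      (sup_eq_left.2 (Subgroup.zpowers_le.2 hx)))
  classical
  have h3 : ∑ x : Subgroup.normalizer (P.grp : Set S), mark (P.adjoin x) e =
      Nat.card P.grp * (mark P e - n) +
        Nat.card (Subgroup.normalizer (P.grp : Set S)) * n := by
    have e1 : ∀ x : Subgroup.normalizer (P.grp : Set S), mark (P.adjoin x) e =
        (if (x : S) ∈ P.grp then mark P e - n else 0) + n := fun x => by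
      split_ifs with hx
      · rw [h2 x hx]; ring
      · rw [h1 x hx]; ring
    have e2 : (Finset.univ.filter fun x : Subgroup.normalizer (P.grp : Set S) =>
        (x : S) ∈ P.grp).card = Nat.card P.grp := by
      rw [← Fintype.card_subtype (fun x : Subgroup.normalizer (P.grp : Set S) =>
        (x : S) ∈ P.grp), ← Nat.card_eq_fintype_card]
      exact Nat.card_congr
        { toFun := fun x => ⟨x.1, x.2⟩
          invFun := fun x => ⟨⟨x, Subgroup.le_normalizer x.2⟩, x.2⟩
          left_inv := fun _ => rfl
          right_inv := fun _ => rfl }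
    rw [Finset.sum_congr rfl fun x _ => e1 x, Finset.sum_add_distrib, ← Finset.sum_filter,
      Finset.sum_const, Finset.sum_const, e2, Finset.card_univ, ← Nat.card_eq_fintype_card]
    simp
  have h4 := FusionSystem.card_orbitHom_self_mul P.isCentric
  have h4' : (Nat.card (P ⟶ P) : ℤ) * Nat.card P.grp =
      (F.normalizerHom P.grp).range.index * Nat.card (Subgroup.normalizer (P.grp : Set S)) := by
    exact_mod_cast h4
  have hpos : (Nat.card P.grp : ℤ) ≠ 0 := by exact_mod_cast Nat.card_pos.ne'
  refine ⟨n - t, mul_right_cancel₀ hpos ?_⟩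
  rw [h3] at ht
  linear_combination (-((F.normalizerHom P.grp).range.index : ℤ)) * ht - (n - t) * h4'

/-- Induction over families closed under targets of morphisms: remove the isomorphism class of a
subgroup of minimal order, solve the problem on the rest, and correct the mark at the removed class
with a multiple of that class. -/
theorem exists_const_mark_on {p : ℕ} [Fact p.Prime] [Finite S] (hS : IsPGroup p S)
    (hF : F.IsSaturated p) (U : Finset F.Centric)
    (hU : ∀ P ∈ U, ∀ H : F.Centric, Nonempty (P ⟶ H) → H ∈ U) :
    ∃ n : ℕ, ¬ p ∣ n ∧ ∃ e : GrothendieckRing (BurnsideClass F), ∀ P ∈ U, mark P e = n := by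
  classical
  induction hk : U.card using Nat.strong_induction_on generalizing U with
  | h k ih =>
  rcases U.eq_empty_or_nonempty with rfl | hne
  · exact ⟨1, (Fact.out : p.Prime).not_dvd_one, 0, by simp⟩
  obtain ⟨P0, hP0, hmin⟩ := U.exists_min_image (fun P => Nat.card P.grp) hne
  obtain ⟨K, hK, hKn⟩ := F.exists_fullyNormalized P0.grp
  let P : F.Centric := ⟨K, P0.isCentric.of_conj hK⟩
  obtain ⟨i0⟩ : Nonempty (P0 ≅ P) := FusionSystem.Centric.nonempty_iso hK
  have hPU : P ∈ U := hU P0 hP0 P ⟨i0.hom⟩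
  have hcard : Nat.card P.grp = Nat.card P0.grp := hK.card_eq.symm
  have hisoP : ∀ Q ∈ U, Nonempty (Q ⟶ P) → Nonempty (Q ≅ P) := fun Q hQ ⟨a⟩ =>
    FusionSystem.Centric.nonempty_iso (FusionSystem.OrbitHom.conj a (hcard ▸ hmin Q hQ))
  let U' := U.filter fun Q => ¬ Nonempty (Q ≅ P)
  obtain ⟨n, hn, e, he⟩ := ih U'.card (hk ▸ Finset.card_lt_card
    (Finset.filter_ssubset.2 ⟨P, hPU, not_not.2 ⟨Iso.refl _⟩⟩)) U' (by
      intro Q hQ H hQH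
      rw [Finset.mem_filter] at hQ ⊢
      refine ⟨hU Q hQ.1 H hQH, fun ⟨i⟩ => hQ.2 ?_⟩
      obtain ⟨a⟩ := hQH
      exact hisoP Q hQ.1 ⟨a ≫ i.hom⟩) rfl
  obtain ⟨c, hc, a, ha⟩ := dvd_mark_sub hS hF P hKn e n fun Q hQ => he Q (by
    have hPQ : P.grp ≤ Q.grp := hQ.le
    rw [Finset.mem_filter]
    refine ⟨hU P hPU Q ⟨FusionSystem.OrbitHom.incl F hPQ⟩, fun ⟨i⟩ => ?_⟩
    exact (card_lt_of_lt hQ).not_ge (FusionSystem.OrbitHom.card_le i.hom))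
  -- By minimality of its order `P` receives no morphism from the rest of `U`, so adding multiples
  -- of `[P]` changes only the marks at its own class. The multiple `a` comes from `c (n - mark P e)
  -- = |P ⟶ P| a`.
  refine ⟨c * n, (Fact.out : p.Prime).not_dvd_mul hc hn,
    c • e + a • of (BurnsideClass.mk P.toAddExt), fun Q hQ => ?_⟩
  rw [map_add, map_nsmul, map_zsmul, mark_of, BurnsideClass.mark_mk, AddExt.mark_toAddExt]
  by_cases hQP : Nonempty (Q ≅ P)
  · obtain ⟨i⟩ := hQP
    rw [mark_congr ⟨i⟩, Nat.card_congr (Iso.homFromEquiv i)]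
    push_cast
    rw [smul_eq_mul, nsmul_eq_mul, mul_comm a, ← ha]
    ring
  · have : IsEmpty (Q ⟶ P) := ⟨fun a => hQP (hisoP Q hQ ⟨a⟩)⟩
    rw [Nat.card_of_isEmpty, he Q (Finset.mem_filter.2 ⟨hQ, hQP⟩)]
    simp

/-- Up to an integer that is prime to `p`, the Burnside ring has an identity element. -/
theorem exists_const_mark {p : ℕ} [Fact p.Prime] [Finite S] (hS : IsPGroup p S)
    (hF : F.IsSaturated p) :
    ∃ n : ℕ, ¬ p ∣ n ∧ ∃ e : GrothendieckRing (BurnsideClass F), ∀ P, mark P e = n := by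
  obtain ⟨n, hn, e, he⟩ := exists_const_mark_on hS hF Finset.univ fun _ _ _ _ => Finset.mem_univ _
  exact ⟨n, hn, e, fun P => he P (Finset.mem_univ P)⟩

end GrothendieckRing

end

section

/-! ### Products of bisets with sets -/

/-- Two `G`-sets are isomorphic. -/
def SetIso (G : Type u) [Group G] (X : Type v) (Y : Type w) [MulAction G X] [MulAction G Y] :
    Prop := ∃ e : X ≃ Y, ∀ (g : G) (x : X), e (g • x) = g • e x

namespace Biset

variable {G H : Type u} [Group G] [Group H]

/-- The product of a `G`-set and a `(G, H)`-biset, with the diagonal action of `G`. -/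
def leftProd (X : Type u) [MulAction G X] [Finite X] (Y : Biset G H) : Biset G H :=
  letI : MulAction Hᵐᵒᵖ (X × Y.carrier) :=
    { smul := fun h a => (a.1, h • a.2)
      one_smul := fun _ => Prod.ext rfl (one_smul _ _)
      mul_smul := fun _ _ _ => Prod.ext rfl (mul_smul _ _ _) }
  { carrier := X × Y.carrier
    comm := ⟨fun g h a => Prod.ext rfl (smul_comm g h a.2)⟩ }

/-- The product of a `(G, H)`-biset and an `H`-set, with the diagonal action of `H`. -/
def rightProd (Y : Biset G H) (X : Type u) [MulAction H X] [Finite X] : Biset G H :=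
  letI : MulAction G (Y.carrier × X) :=
    { smul := fun g a => (g • a.1, a.2)
      one_smul := fun a => Prod.ext (one_smul _ _) rfl
      mul_smul := fun g h a => Prod.ext (mul_smul _ _ _) rfl }
  letI : MulAction Hᵐᵒᵖ (Y.carrier × X) :=
    { smul := fun h a => (h • a.1, h.unop⁻¹ • a.2)
      one_smul := fun a => Prod.ext (one_smul _ _) (by
        change (1 : Hᵐᵒᵖ).unop⁻¹ • a.2 = a.2
        rw [MulOpposite.unop_one, inv_one, one_smul])
      mul_smul := fun g h a => Prod.ext (mul_smul _ _ _) (by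
        change (g * h).unop⁻¹ • a.2 = g.unop⁻¹ • h.unop⁻¹ • a.2
        rw [smul_smul]; simp) }
  { carrier := Y.carrier × X
    comm := ⟨fun g h a => Prod.ext (smul_comm g h a.1) rfl⟩ }

theorem leftProd_congr {X X' : Type u} [MulAction G X] [Finite X] [MulAction G X'] [Finite X']
    (Y : Biset G H) (h : SetIso G X X') : Iso (leftProd X Y) (leftProd X' Y) := by
  obtain ⟨e, he⟩ := h
  exact ⟨Equiv.prodCongr e (Equiv.refl _), fun g a => Prod.ext (he g a.1) rfl, fun h a => rfl⟩

theorem leftProd_sum (X X' : Type u) [MulAction G X] [Finite X] [MulAction G X'] [Finite X']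
    (Y : Biset G H) : Iso (leftProd (X ⊕ X') Y) (sum (leftProd X Y) (leftProd X' Y)) :=
  ⟨Equiv.sumProdDistrib X X' Y.carrier, by rintro g ⟨(x | x), y⟩ <;> rfl,
    by rintro g ⟨(x | x), y⟩ <;> rfl⟩

theorem leftProd_leftProd (X X' : Type u) [MulAction G X] [Finite X] [MulAction G X'] [Finite X']
    (Y : Biset G H) : Iso (leftProd X (leftProd X' Y)) (leftProd (X × X') Y) :=
  ⟨(Equiv.prodAssoc X X' Y.carrier).symm, fun _ _ => rfl, fun _ _ => rfl⟩

/-- Composition with `X × G` on the left is multiplication by the set `X`. With the companion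
`comp_leftProd_regular` for the right side, commuting a set past a biset becomes a comparison of
`leftProd` and `rightProd`. -/
theorem leftProd_regular_comp [Finite G] (X : Type u) [MulAction G X] [Finite X]
    (Y : Biset G H) : Iso (comp (leftProd X (regular G)) Y) (leftProd X Y) := by
  refine Iso.mk' (Y := leftProd X Y)
    (comp.desc (fun (a : X × G) y => ((a.1, a.2 • y) : X × Y.carrier)) ?_)
    (fun (a : X × Y.carrier) => comp.mk (leftProd X (regular G)) Y ((a.1, 1) : X × G) a.2)
    ?_ ?_ ?_ ?_
  · rintro ⟨x, g⟩ j y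
    exact Prod.ext rfl (mul_smul (α := G) g j y)
  · refine comp.ind ?_
    rintro ⟨x, (g : G)⟩ y
    refine (comp.mk_smul (leftProd X (regular G)) Y ((x, 1) : X × G) y g).symm.trans ?_
    exact congrArg (fun t : G => comp.mk (leftProd X (regular G)) Y ((x, t) : X × G) y)
      (one_mul (M := G) g)
  · rintro ⟨x, y⟩
    exact Prod.ext rfl (one_smul G y)
  · intro g
    refine comp.ind ?_
    rintro ⟨x, (k : G)⟩ y
    exact Prod.ext rfl (mul_smul (α := G) g k y)
  · intro h
    refine comp.ind ?_
    rintro ⟨x, (k : G)⟩ y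
    exact Prod.ext rfl (smul_comm k h y)

theorem comp_leftProd_regular [Finite H] (X : Type u) [MulAction H X] [Finite X]
    (Y : Biset G H) : Iso (comp Y (leftProd X (regular H))) (rightProd Y X) := by
  refine Iso.mk' (Y := rightProd Y X)
    (comp.desc (fun y (a : X × H) =>
      ((MulOpposite.op a.2 • y, a.2⁻¹ • a.1) : Y.carrier × X)) ?_)
    (fun (a : Y.carrier × X) => comp.mk Y (leftProd X (regular H)) a.1 ((a.2, 1) : X × H))
    ?_ ?_ ?_ ?_
  · rintro y j ⟨x, (h : H)⟩
    refine Prod.ext ?_ ?_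
    · change MulOpposite.op h • MulOpposite.op j • y = MulOpposite.op (j * h) • y
      rw [smul_smul, ← MulOpposite.op_mul]
    · change h⁻¹ • x = (j * h)⁻¹ • j • x
      rw [smul_smul]; simp
  · refine comp.ind ?_
    rintro y ⟨x, (h : H)⟩
    refine (comp.mk_smul Y (leftProd X (regular H)) y ((h⁻¹ • x, 1) : X × H) h).trans ?_
    congr 1
    exact Prod.ext (smul_inv_smul h x) (mul_one (M := H) h)
  · rintro ⟨y, x⟩
    exact Prod.ext (one_smul _ y) (by change (1 : H)⁻¹ • x = x; simp)
  · intro g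
    refine comp.ind ?_
    rintro y ⟨x, (h : H)⟩
    exact Prod.ext (smul_comm g _ y).symm rfl
  · intro h
    refine comp.ind ?_
    rintro y ⟨x, (k : H)⟩
    refine Prod.ext ?_ ?_
    · change MulOpposite.op (k * h.unop) • y = h • MulOpposite.op k • y
      rw [smul_smul]; rfl
    · change (k * h.unop)⁻¹ • x = h.unop⁻¹ • k⁻¹ • x
      rw [smul_smul]; simp

/-! ### Transitive bisets -/

section transitive

variable [Finite G] [Finite H]

/-- The class of a pair in a transitive biset. -/
def transitive.mk (D : Subgroup (G × H)) (a : G × H) : (transitive D).carrier :=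
  (QuotientGroup.mk a : (G × H) ⧸ D)

theorem transitive.mk_mul (D : Subgroup (G × H)) (a : G × H) {d : G × H} (hd : d ∈ D) :
    transitive.mk D (a * d) = transitive.mk D a :=
  QuotientGroup.mk_mul_of_mem a hd

theorem transitive.mk_eq {D : Subgroup (G × H)} {a b : G × H} :
    transitive.mk D a = transitive.mk D b ↔ a⁻¹ * b ∈ D := QuotientGroup.eq

theorem transitive.smul_mk (D : Subgroup (G × H)) (g : G) (a : G × H) :
    g • transitive.mk D a = transitive.mk D (g * a.1, a.2) := by
  refine congrArg (transitive.mk D) (?_ : (g, 1) * a = _)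
  exact Prod.ext rfl (one_mul _)

theorem transitive.op_smul_mk (D : Subgroup (G × H)) (h : Hᵐᵒᵖ) (a : G × H) :
    h • transitive.mk D a = transitive.mk D (a.1, h.unop⁻¹ * a.2) := by
  refine congrArg (transitive.mk D) (?_ : (1, h.unop⁻¹) * a = _)
  exact Prod.ext (one_mul _) rfl

theorem transitive.ind {D : Subgroup (G × H)} {P : (transitive D).carrier → Prop}
    (h : ∀ g k, P (transitive.mk D (g, k))) (a : (transitive D).carrier) : P a :=
  Quotient.inductionOn' (s₁ := QuotientGroup.leftRel D) a fun b => h b.1 b.2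

/-- A function on a transitive biset. -/
def transitive.desc {D : Subgroup (G × H)} {α : Type v} (f : G → H → α)
    (hf : ∀ g h, ∀ d ∈ D, f (g * d.1) (h * d.2) = f g h) : (transitive D).carrier → α :=
  fun a => Quotient.liftOn' (s₁ := QuotientGroup.leftRel D) a (fun b => f b.1 b.2) fun a b h => by
    rw [QuotientGroup.leftRel_apply] at h
    have := hf a.1 a.2 _ h
    simp only [Prod.fst_mul, Prod.snd_mul, Prod.fst_inv, Prod.snd_inv, mul_inv_cancel_left] at this
    exact this.symm

theorem transitive.desc_mk {D : Subgroup (G × H)} {α : Type v} (f : G → H → α)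
    (hf : ∀ g h, ∀ d ∈ D, f (g * d.1) (h * d.2) = f g h) (g : G) (h : H) :
    transitive.desc f hf (transitive.mk D (g, h)) = f g h := rfl

variable {C : Type u} [Group C]

theorem transitive.mk_mul_range (f : C →* G) (k : C →* H) (a : G) (b : H) (c : C) :
    transitive.mk (f.prod k).range (a * f c, b * k c) = transitive.mk (f.prod k).range (a, b) :=
  transitive.mk_mul _ (a, b) (show (f c, k c) ∈ (f.prod k).range from ⟨c, rfl⟩)

/-- The isomorphism sends `(x, (g, h)D)` to `((g, h)D, h θ(g⁻¹ x))`; compatibility of `θ` with the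
two actions of `C` is what makes it independent of the representative. It is the source of the
centrality of the elements `gamma`. -/
theorem leftProd_transitive (f : C →* G) (k : C →* H) {X X' : Type u} [MulAction G X] [Finite X]
    [MulAction H X'] [Finite X'] (θ : X ≃ X') (hθ : ∀ c x, θ (f c • x) = k c • θ x) :
    Iso (leftProd X (transitive (f.prod k).range)) (rightProd (transitive (f.prod k).range) X') := by
  have hθ' : ∀ c x, θ.symm (k c • x) = f c • θ.symm x := fun c x => by
    rw [Equiv.symm_apply_eq, hθ, Equiv.apply_symm_apply]
  let D := (f.prod k).range
  refine Iso.mk' (X := leftProd X (transitive D)) (Y := rightProd (transitive D) X')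
    (fun a : X × (transitive D).carrier =>
      ((a.2, transitive.desc (fun g h => h • θ (g⁻¹ • a.1)) (by
        rintro g h _ ⟨c, rfl⟩
        have := hθ c⁻¹ (g⁻¹ • a.1)
        simp only [MonoidHom.prod_apply, mul_inv_rev, mul_smul, map_inv] at this ⊢
        rw [this, smul_inv_smul]) a.2) : (transitive D).carrier × X'))
    (fun a : (transitive D).carrier × X' =>
      ((transitive.desc (fun g h => g • θ.symm (h⁻¹ • a.2)) (by
        rintro g h _ ⟨c, rfl⟩
        have := hθ' c⁻¹ (h⁻¹ • a.2)
        simp only [MonoidHom.prod_apply, mul_inv_rev, mul_smul, map_inv] at this ⊢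
        rw [this, smul_inv_smul]) a.1, a.1) : X × (transitive D).carrier)) ?_ ?_ ?_ ?_
  · rintro ⟨x, a⟩
    induction a using transitive.ind with
    | h g h => exact Prod.ext (by simp [transitive.desc_mk]) rfl
  · rintro ⟨a, x⟩
    induction a using transitive.ind with
    | h g h => exact Prod.ext rfl (by simp [transitive.desc_mk])
  · rintro l ⟨x, a⟩
    induction a using transitive.ind with
    | h g h =>
      refine Prod.ext rfl ?_
      change ((1 : H) * h) • θ ((l * g)⁻¹ • l • x) = h • θ (g⁻¹ • x)
      rw [smul_smul, one_mul]
      simp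
  · rintro l ⟨x, a⟩
    induction a using transitive.ind with
    | h g h =>
      refine Prod.ext rfl ?_
      change (l.unop⁻¹ * h) • θ (((1 : G) * g)⁻¹ • x) = l.unop⁻¹ • h • θ (g⁻¹ • x)
      rw [mul_smul, one_mul]

/-- The bijection in the composition formula for transitive bisets. -/
def transitive.compMap [Finite C] (f : C →* G) (k : C →* H) :
    (comp (transitive (f.prod (MonoidHom.id C)).range)
      (transitive ((MonoidHom.id C).prod k).range)).carrier → (transitive (f.prod k).range).carrier :=
  comp.desc (fun a b => transitive.desc
    (fun l c => transitive.desc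
      (fun c' h => transitive.mk (f.prod k).range (l * f (c⁻¹ * c'), h)) (by
        rintro c' h _ ⟨d, rfl⟩
        have := transitive.mk_mul_range f k (l * f (c⁻¹ * c')) h d
        simpa [mul_assoc] using this) b) (by
      rintro l c _ ⟨d, rfl⟩
      congr 1
      funext c' h
      simp [mul_assoc]) a) (by
    intro a j b
    induction a using transitive.ind with
    | h l c =>
    induction b using transitive.ind with
    | h c' h =>
      rw [transitive.smul_mk, transitive.op_smul_mk]
      simp only [transitive.desc_mk]
      simp [mul_assoc])

theorem transitive.compMap_mk [Finite C] (f : C →* G) (k : C →* H) (l : G) (c c' : C) (h : H) :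
    transitive.compMap f k (comp.mk _ _ (transitive.mk _ (l, c)) (transitive.mk _ (c', h))) =
      transitive.mk _ (l * f (c⁻¹ * c'), h) := rfl

/-- The middle group `C` is filled by either factor alone, so the Mackey formula has a single term;
`(l, c)` and `(c', h)` compose to `(l f(c⁻¹ c'), h)`. -/
theorem transitive_comp [Finite C] (f : C →* G) (k : C →* H) :
    Iso (comp (transitive (f.prod (MonoidHom.id C)).range)
      (transitive ((MonoidHom.id C).prod k).range)) (transitive (f.prod k).range) := by
  refine Iso.mk' (transitive.compMap f k)
    (transitive.desc (fun l h => comp.mk (transitive (f.prod (MonoidHom.id C)).range)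
      (transitive ((MonoidHom.id C).prod k).range) (transitive.mk _ (l, 1))
        (transitive.mk _ (1, h))) ?_) ?_ ?_ ?_ ?_
  · rintro l h _ ⟨d, rfl⟩
    have e1 := transitive.mk_mul_range f (MonoidHom.id C) l d⁻¹ d
    have e2 := transitive.mk_mul_range (MonoidHom.id C) k d⁻¹ h d
    simp only [MonoidHom.id_apply, inv_mul_cancel] at e1 e2
    have e3 := comp.mk_smul (transitive (f.prod (MonoidHom.id C)).range)
      (transitive ((MonoidHom.id C).prod k).range) (transitive.mk _ (l, 1))
      (transitive.mk _ (d⁻¹, h)) d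
    rw [transitive.op_smul_mk, transitive.smul_mk] at e3
    simp only [MulOpposite.unop_op, mul_one, mul_inv_cancel] at e3
    change comp.mk _ _ (transitive.mk _ (l * f d, 1)) (transitive.mk _ (1, h * k d)) = _
    rw [e1, e2]
    exact e3
  · refine comp.ind fun a b => ?_
    induction a using transitive.ind with
    | h l c =>
    induction b using transitive.ind with
    | h c' h =>
      rw [transitive.compMap_mk, transitive.desc_mk]
      have e1 := transitive.mk_mul_range f (MonoidHom.id C) l c (c⁻¹ * c')
      simp only [MonoidHom.id_apply, mul_inv_cancel_left] at e1
      have e2 := comp.mk_smul (transitive (f.prod (MonoidHom.id C)).range)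
        (transitive ((MonoidHom.id C).prod k).range)
        (transitive.mk _ (l * f (c⁻¹ * c'), c')) (transitive.mk _ (1, h)) c'
      rw [transitive.op_smul_mk, transitive.smul_mk, e1] at e2
      simp only [MulOpposite.unop_op, mul_one, inv_mul_cancel] at e2
      exact e2
  · intro a
    induction a using transitive.ind with
    | h l h =>
      rw [transitive.desc_mk, transitive.compMap_mk]
      simp
  · refine fun g => comp.ind fun a b => ?_
    induction a using transitive.ind with
    | h l c =>
    induction b using transitive.ind with
    | h c' h =>
      rw [comp.smul_mk, transitive.smul_mk, transitive.compMap_mk, transitive.compMap_mk,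
        transitive.smul_mk, mul_assoc]
  · refine fun g => comp.ind fun a b => ?_
    induction a using transitive.ind with
    | h l c =>
    induction b using transitive.ind with
    | h c' h =>
      rw [comp.op_smul_mk, transitive.op_smul_mk, transitive.compMap_mk, transitive.compMap_mk,
        transitive.op_smul_mk]

theorem transitive_id : Iso (transitive ((MonoidHom.id G).prod (MonoidHom.id G)).range)
    (regular G) := by
  refine Iso.mk' (Y := regular G) (transitive.desc (fun l h => (l * h⁻¹ : G)) ?_)
    (fun g : G => transitive.mk _ (g, 1)) ?_ ?_ ?_ ?_
  · rintro l h _ ⟨d, rfl⟩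
    change l * d * (h * d)⁻¹ = l * h⁻¹
    group
  · refine transitive.ind fun l h => ?_
    have := transitive.mk_mul_range (MonoidHom.id G) (MonoidHom.id G) l h h⁻¹
    rw [MonoidHom.id_apply, mul_inv_cancel] at this
    exact this
  · intro (g : G)
    change g * (1 : G)⁻¹ = g
    rw [inv_one, mul_one]
  · intro g
    refine transitive.ind fun l h => ?_
    rw [transitive.smul_mk]
    exact mul_assoc g l h⁻¹
  · intro g
    refine transitive.ind fun l h => ?_
    rw [transitive.op_smul_mk]
    change l * (g.unop⁻¹ * h)⁻¹ = l * h⁻¹ * g.unop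
    group

/-- The bijection is `(kQ, g) ↦ (k, g⁻¹ k)`. It identifies the biset of the set of cosets `G / Q`
with an induction after a restriction. -/
theorem leftProd_quotient_regular (Q : Subgroup G) (f : C →* G) (hf : f.range = Q) :
    Iso (leftProd (G ⧸ Q) (regular G)) (transitive (f.prod f).range) := by
  refine Iso.mk' (X := leftProd (G ⧸ Q) (regular G)) (Y := transitive (f.prod f).range)
    (fun a : (G ⧸ Q) × G => Quotient.liftOn' a.1
      (fun k => transitive.mk (f.prod f).range (k, a.2⁻¹ * k)) fun k k' h => ?_)
    (transitive.desc (fun k l => (((k : G ⧸ Q), k * l⁻¹) : (G ⧸ Q) × G)) ?_) ?_ ?_ ?_ ?_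
  · rw [QuotientGroup.leftRel_apply, ← hf] at h
    obtain ⟨c, hc⟩ := h
    have := transitive.mk_mul_range f f k (a.2⁻¹ * k) c
    rw [← this, hc]
    simp [mul_assoc]
  · rintro k l _ ⟨c, rfl⟩
    refine Prod.ext ?_ ?_
    · exact QuotientGroup.mk_mul_of_mem k (hf ▸ ⟨c, rfl⟩)
    · simp
  · rintro ⟨a, (g : G)⟩
    induction a using Quotient.inductionOn' with
    | h k =>
      refine Prod.ext rfl ?_
      change k * (g⁻¹ * k)⁻¹ = g
      group
  · refine transitive.ind fun k l => ?_
    change transitive.mk _ (k, (k * l⁻¹)⁻¹ * k) = _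
    congr 2
    group
  · rintro g ⟨a, (h : G)⟩
    induction a using Quotient.inductionOn' with
    | h k =>
      change transitive.mk _ (g * k, (g * h)⁻¹ * (g * k)) = g • transitive.mk _ (k, h⁻¹ * k)
      rw [transitive.smul_mk]
      congr 2
      group
  · rintro g ⟨a, (h : G)⟩
    induction a using Quotient.inductionOn' with
    | h k =>
      change transitive.mk _ (k, (h * g.unop)⁻¹ * k) = g • transitive.mk _ (k, h⁻¹ * k)
      rw [transitive.op_smul_mk]
      congr 2
      group

end transitive

end Biset

end

section

/-! ### The bisets attached to finite sets with an action -/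

theorem SetIso.trans {G : Type u} [Group G] {X : Type v} {Y : Type w} {Z : Type x}
    [MulAction G X] [MulAction G Y] [MulAction G Z] (h : SetIso G X Y) (h' : SetIso G Y Z) :
    SetIso G X Z := by
  obtain ⟨e, he⟩ := h
  obtain ⟨f, hf⟩ := h'
  exact ⟨e.trans f, fun g x => by rw [Equiv.trans_apply, he, hf]; rfl⟩

theorem SetIso.of_eq {G : Type u} [Group G] {ι : Type v} {A B : ι → Subgroup G} (h : A = B) :
    SetIso G (Σ i, G ⧸ A i) (Σ i, G ⧸ B i) := by
  subst h
  exact ⟨Equiv.refl _, fun _ _ => rfl⟩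

theorem SetIso.orbits {G : Type u} [Group G] (X : Type v) [MulAction G X] :
    SetIso G (Σ o : MulAction.orbitRel.Quotient G X, G ⧸ MulAction.stabilizer G o.out) X := by
  refine ⟨Equiv.ofBijective
    (fun t => MulAction.ofQuotientStabilizer G t.1.out t.2) ⟨?_, ?_⟩, ?_⟩
  · rintro ⟨o, a⟩ ⟨o', a'⟩ h
    dsimp only at h
    have ho : o = o' := by
      rw [← Quotient.out_eq' o, ← Quotient.out_eq' o']
      refine Quotient.sound' (s₁ := MulAction.orbitRel G X) ?_
      rw [MulAction.orbitRel_apply]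
      have h1 := MulAction.ofQuotientStabilizer_mem_orbit G o.out a
      have h2 := MulAction.ofQuotientStabilizer_mem_orbit G o'.out a'
      rw [h] at h1
      exact (MulAction.orbit_eq_iff.2 h1).symm.trans (MulAction.orbit_eq_iff.2 h2) ▸
        MulAction.mem_orbit_self _
    subst ho
    rw [MulAction.injective_ofQuotientStabilizer G _ h]
  · intro x
    have hx : (Quotient.mk'' x : MulAction.orbitRel.Quotient G X).out ∈ MulAction.orbit G x :=
      Quotient.mk_out' (s₁ := MulAction.orbitRel G X) x
    obtain ⟨g, hg⟩ := hx
    refine ⟨⟨Quotient.mk'' x, ((g⁻¹ : G) : G ⧸ _)⟩, ?_⟩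
    dsimp only at hg ⊢
    rw [MulAction.ofQuotientStabilizer_mk, ← hg, inv_smul_smul]
  · rintro g ⟨o, a⟩
    exact MulAction.ofQuotientStabilizer_smul G o.out g a

namespace BisetClass

variable {G H : Type u} [Group G] [Group H] [Finite G] [Finite H]

/-- The class of the biset `X × G`, for a finite `G`-set `X`. -/
def cls (G : Type u) [Group G] [Finite G] (X : Type u) [MulAction G X] [Finite X] :
    BisetClass G G := mk (Biset.leftProd X (Biset.regular G))

variable (X X' : Type u) [MulAction G X] [Finite X] [MulAction G X'] [Finite X']

variable {X X'} in
theorem cls_congr (h : SetIso G X X') : cls G X = cls G X' := sound (Biset.leftProd_congr _ h)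

theorem cls_sum : cls G (X ⊕ X') = cls G X + cls G X' := sound (Biset.leftProd_sum X X' _)

theorem cls_mul : comp (cls G X) (cls G X') = cls G (X × X') :=
  (sound (Biset.leftProd_regular_comp X _)).trans (sound (Biset.leftProd_leftProd X X' _))

theorem cls_empty [IsEmpty X] : cls G X = 0 :=
  sound (Biset.iso_of_isEmpty (fun a => isEmptyElim (a : X × G).1) (fun a => PEmpty.elim a))

theorem cls_unique [Unique X] : cls G X = one G := by
  refine sound ⟨(Equiv.uniqueProd G X : X × G ≃ G), fun g a => rfl, fun h a => rfl⟩

theorem cls_sigma {ι : Type u} [Fintype ι] (Y : ι → Type u) [i1 : ∀ i, MulAction G (Y i)]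
    [i2 : ∀ i, Finite (Y i)] : cls G (Σ i, Y i) = ∑ i, cls G (Y i) := by
  refine Fintype.induction_empty_option (P := fun ι _ => ∀ (Y : ι → Type u)
    (_ : ∀ i, MulAction G (Y i)) (_ : ∀ i, Finite (Y i)), cls G (Σ i, Y i) = ∑ i, cls G (Y i))
    ?_ ?_ ?_ ι Y i1 i2
  · intro α β _ e h Y _ _
    let := Fintype.ofEquiv β e.symm
    rw [← e.sum_comp, ← h]
    refine (cls_congr ⟨Equiv.sigmaCongrLeft (β := Y) e, ?_⟩).symm
    rintro g ⟨a, x⟩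
    rfl
  · intro Y _ _
    rw [cls_empty]
    simp
  · intro α _ h Y _ _
    rw [Fintype.sum_option, ← h, ← cls_sum]
    refine (cls_congr ⟨⟨Sum.elim (fun y => ⟨none, y⟩) (fun t => ⟨some t.1, t.2⟩), fun t =>
      match t with
      | ⟨none, y⟩ => Sum.inl y
      | ⟨some a, y⟩ => Sum.inr ⟨a, y⟩, ?_, ?_⟩, ?_⟩).symm
    · rintro (y | t) <;> rfl
    · rintro ⟨_ | a, y⟩ <;> rfl
    · rintro g (y | t) <;> rfl

theorem cls_comp_transitive {C : Type u} [Group C] (f : C →* G) (k : C →* H)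
    {X X' : Type u} [MulAction G X] [Finite X] [MulAction H X'] [Finite X'] (θ : X ≃ X')
    (hθ : ∀ c x, θ (f c • x) = k c • θ x) :
    comp (cls G X) (mk (Biset.transitive (f.prod k).range)) =
      comp (mk (Biset.transitive (f.prod k).range)) (cls H X') :=
  (sound (Biset.leftProd_regular_comp X _)).trans
    ((sound (Biset.leftProd_transitive f k θ hθ)).trans
      (sound (Biset.comp_leftProd_regular X' _)).symm)

end BisetClass

section

variable {S : Type u} [Group S] [Finite S]

theorem comp_diagClass {C L A : Subgroup S} (f : C →* L) (k : C →* A) :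
    BisetClass.comp (diagClass f (MonoidHom.id C)) (diagClass (MonoidHom.id C) k) =
      diagClass f k := BisetClass.sound (Biset.transitive_comp f k)

theorem diagClass_id (C : Subgroup S) :
    diagClass (MonoidHom.id C) (MonoidHom.id C) = BisetClass.one C :=
  BisetClass.sound Biset.transitive_id

theorem diagClass_comp_equiv {C D L A : Subgroup S} (e : D ≃* C) (f : C →* L) (k : C →* A) :
    diagClass (f.comp e.toMonoidHom) (k.comp e.toMonoidHom) = diagClass f k := by
  have : ((f.comp e.toMonoidHom).prod (k.comp e.toMonoidHom)).range = (f.prod k).range := by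
    ext t
    constructor
    · rintro ⟨d, rfl⟩; exact ⟨e d, rfl⟩
    · rintro ⟨c, rfl⟩; exact ⟨e.symm c, by simp⟩
  rw [diagClass, diagClass, this]

theorem cls_quotient {A K : Subgroup S} (h : A ≤ K) :
    BisetClass.cls K (K ⧸ A.subgroupOf K) =
      diagClass (Subgroup.inclusion h) (Subgroup.inclusion h) :=
  BisetClass.sound (Biset.leftProd_quotient_regular _ _ (by
    ext x
    constructor
    · rintro ⟨a, rfl⟩; exact a.2
    · intro hx; exact ⟨⟨x, hx⟩, rfl⟩))

omit [Finite S] in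
/-- Every finite `K`-set is a disjoint union of sets of cosets. -/
theorem SetIso.exists_sigma (K : Subgroup S) (X : Type u) [MulAction K X] [Finite X] :
    ∃ (ι : Type u) (_ : Fintype ι) (A : ι → Subgroup S), (∀ i, A i ≤ K) ∧
      SetIso K (Σ i, K ⧸ (A i).subgroupOf K) X := by
  refine ⟨MulAction.orbitRel.Quotient K X, Fintype.ofFinite _,
    fun o => (MulAction.stabilizer K o.out).map K.subtype, fun o => ?_, ?_⟩
  · exact Subgroup.map_subtype_le _
  · have : (fun o : MulAction.orbitRel.Quotient K X =>
        ((MulAction.stabilizer K o.out).map K.subtype).subgroupOf K) =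
        fun o => MulAction.stabilizer K o.out := by
      funext o
      exact Subgroup.comap_map_eq_self_of_injective K.subtype_injective _
    exact (SetIso.of_eq this).trans (SetIso.orbits X)

namespace BisetSums

omit [Finite S] in
theorem single_same (A B : Subgroup S) (a : BisetClass A B) : single A B a A B = a := by
  simp [single]

omit [Finite S] in
theorem single_of_ne_left {A B A' : Subgroup S} (h : A' ≠ A) (a : BisetClass A B) (B' : Subgroup S) :
    single A B a A' B' = 0 := by
  simp [single, h]

omit [Finite S] in
theorem single_of_ne_right {A B B' : Subgroup S} (h : B' ≠ B) (a : BisetClass A B)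
    (A' : Subgroup S) : single A B a A' B' = 0 := by
  by_cases hA : A' = A
  · subst hA; simp [single, h]
  · exact single_of_ne_left hA a B'

omit [Finite S] in
theorem ext {f g : BisetSums S} (h : ∀ A B, f A B = g A B) : f = g :=
  funext fun A => funext fun B => h A B

/-- `single` as an additive map. -/
def singleHom (A B : Subgroup S) : BisetClass A B →+ BisetSums S where
  toFun := single A B
  map_zero' := by simp [single]; rfl
  map_add' a b := by simp only [single, Pi.single_add]; rfl

theorem single_add (A B : Subgroup S) (a b : BisetClass A B) :
    single A B (a + b) = single A B a + single A B b := map_add (singleHom A B) a b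

theorem single_sum (A B : Subgroup S) {ι : Type v} (s : Finset ι) (a : ι → BisetClass A B) :
    single A B (∑ i ∈ s, a i) = ∑ i ∈ s, single A B (a i) := map_sum (singleHom A B) a s

theorem single_mul_single {A B C : Subgroup S} (a : BisetClass A B) (b : BisetClass B C) :
    single A B a * single B C b = single A C (BisetClass.comp a b) := by
  refine ext fun A' C' => ?_
  rw [mul_apply]
  by_cases hA : A' = A
  swap
  · rw [single_of_ne_left hA]
    exact Finset.sum_eq_zero fun J _ => by rw [single_of_ne_left hA, map_zero]; rfl
  by_cases hC : C' = C
  swap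
  · rw [single_of_ne_right hC]
    exact Finset.sum_eq_zero fun J _ => by rw [single_of_ne_right hC, map_zero]
  subst hA hC
  rw [single_same, Finset.sum_eq_single B, single_same, single_same]
  · intro J _ hJ
    rw [single_of_ne_right hJ, map_zero]; rfl
  · intro h
    exact (h (mem_subgroups B)).elim

theorem single_mul_single_of_ne {A B B' C : Subgroup S} (h : B ≠ B') (a : BisetClass A B)
    (b : BisetClass B' C) : single A B a * single B' C b = 0 := by
  refine ext fun A' C' => ?_
  rw [mul_apply]
  refine Finset.sum_eq_zero fun J _ => ?_
  by_cases hJ : J = B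
  · subst hJ; rw [single_of_ne_left h, map_zero]
  · rw [single_of_ne_right hJ, map_zero]; rfl

theorem one_eq_sum : (1 : BisetSums S) =
    ∑ K ∈ subgroups S, single K K (BisetClass.one K) := by
  refine ext fun A B => ?_
  have happ : (∑ K ∈ subgroups S, single K K (BisetClass.one K)) A B =
      ∑ K ∈ subgroups S, single K K (BisetClass.one K) A B :=
    map_sum ((Pi.evalAddMonoidHom (fun B : Subgroup S => BisetClass A B) B).comp
      (Pi.evalAddMonoidHom (fun A : Subgroup S => ∀ B : Subgroup S, BisetClass A B) A)) _ _
  rw [happ, Finset.sum_eq_single A]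
  · change one A B = _
    by_cases h : A = B
    · subst h; rw [one_self, single_same]
    · rw [one_ne h, single_of_ne_right (Ne.symm h)]
  · intro K _ hK
    exact single_of_ne_left (Ne.symm hK) _ _
  · intro h
    exact (h (mem_subgroups A)).elim

end BisetSums

/-- The element of the semiring of bisets given by a finite `K`-set. -/
def setSum (K : Subgroup S) (X : Type u) [MulAction K X] [Finite X] : BisetSums S :=
  BisetSums.single K K (BisetClass.cls K X)

/-- Coset sets therefore give elements of the Mackey algebra, and so do all finite sets by
decomposition into orbits. -/
theorem indGen_mul_resGen {A K : Subgroup S} (h : A ≤ K) :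
    indGen h * resGen h = setSum K (K ⧸ A.subgroupOf K) := by
  rw [indGen, resGen, BisetSums.single_mul_single, comp_diagClass, setSum, cls_quotient h]

theorem indGen_refl (K : Subgroup S) :
    indGen (le_refl K) = BisetSums.single K K (BisetClass.one K) := by
  rw [← diagClass_id]; rfl

theorem setSum_mem (F : FusionSystem S) (K : Subgroup S) (X : Type u) [MulAction K X] [Finite X] :
    setSum K X ∈ genSubsemiring F := by
  obtain ⟨ι, _, A, hA, h⟩ := SetIso.exists_sigma K X
  rw [setSum, ← BisetClass.cls_congr h, BisetClass.cls_sigma, BisetSums.single_sum]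
  refine sum_mem fun i _ => ?_
  change setSum K _ ∈ _
  rw [← indGen_mul_resGen (hA i)]
  exact mul_mem (Subsemiring.subset_closure (IsGen.ind _)) (Subsemiring.subset_closure (IsGen.res _))

end

end

section

/-! ### Marks of finite sets with an action -/

section fixCard

variable {S : Type u} [Group S] {K : Subgroup S} (P : Subgroup S)

theorem fixCard_congr {X : Type v} {Y : Type w} [MulAction K X] [MulAction K Y]
    (h : SetIso K X Y) : fixCard (K := K) P X = fixCard (K := K) P Y := by
  obtain ⟨e, he⟩ := h
  refine Nat.card_congr (e.subtypeEquiv fun x => ?_)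
  refine forall₂_congr fun k _ => ?_
  rw [← he, e.apply_eq_iff_eq]

theorem fixCard_sigma {ι : Type v} [Fintype ι] (Y : ι → Type w) [∀ i, MulAction K (Y i)]
    [∀ i, Finite (Y i)] : fixCard (K := K) P (Σ i, Y i) = ∑ i, fixCard (K := K) P (Y i) := by
  unfold fixCard
  rw [← Nat.card_sigma]
  refine Nat.card_congr ⟨fun t => ⟨t.1.1, t.1.2, fun k hk => ?_⟩,
    fun t => ⟨⟨t.1, t.2.1⟩, fun k hk => ?_⟩, fun _ => rfl, fun _ => rfl⟩
  · exact eq_of_heq (Sigma.mk.inj (t.2 k hk)).2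
  · exact congrArg (Sigma.mk t.1) (t.2.2 k hk)

theorem fixCard_sum (X : Type v) (Y : Type w) [MulAction K X] [MulAction K Y] [Finite X]
    [Finite Y] : fixCard (K := K) P (X ⊕ Y) = fixCard (K := K) P X + fixCard (K := K) P Y := by
  unfold fixCard
  rw [← Nat.card_sum]
  refine Nat.card_congr (Equiv.subtypeSum.trans (Equiv.sumCongr ?_ ?_))
  · exact Equiv.subtypeEquivRight fun x => forall₂_congr fun k _ => Sum.inl_injective.eq_iff
  · exact Equiv.subtypeEquivRight fun x => forall₂_congr fun k _ => Sum.inr_injective.eq_iff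

theorem fixCard_prod (X : Type v) (Y : Type w) [MulAction K X] [MulAction K Y] :
    fixCard (K := K) P (X × Y) = fixCard (K := K) P X * fixCard (K := K) P Y := by
  unfold fixCard
  rw [← Nat.card_prod]
  refine Nat.card_congr ((Equiv.subtypeEquivRight fun x => ?_).trans
    Equiv.subtypeProdEquivProd)
  simp only [Prod.ext_iff, ← forall_and]
  rfl

theorem fixCard_quotient_ne_zero [Finite S] {H : Subgroup S} (hPK : P ≤ K) :
    fixCard (K := K) P (K ⧸ H.subgroupOf K) ≠ 0 ↔ ∃ k ∈ K, FusionSystem.conjBy P k ≤ H := by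
  rw [fixCard, Nat.card_ne_zero]
  constructor
  · rintro ⟨⟨⟨x, hx⟩⟩, -⟩
    obtain ⟨k, rfl⟩ := QuotientGroup.mk_surjective x
    refine ⟨k, k.2, ?_⟩
    rintro _ ⟨s, hs, rfl⟩
    have := smul_mk_eq_iff.1 (hx ⟨s, hPK hs⟩ hs)
    rw [Subgroup.mem_subgroupOf] at this
    simpa using this
  · rintro ⟨k, hk, h⟩
    refine ⟨⟨⟨((⟨k, hk⟩ : K) : K ⧸ _), fun s hs => smul_mk_eq_iff.2 ?_⟩⟩, inferInstance⟩
    rw [Subgroup.mem_subgroupOf]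
    exact h ⟨s, hs, by simp⟩

theorem SetIso.conjBy {H : Subgroup S} {k : S} (hk : k ∈ K) :
    SetIso K (K ⧸ H.subgroupOf K) (K ⧸ (FusionSystem.conjBy H k).subgroupOf K) := by
  have key : ∀ a b : K, (a⁻¹ * b ∈ H.subgroupOf K ↔
      (a * ⟨k, hk⟩)⁻¹ * (b * ⟨k, hk⟩) ∈ (FusionSystem.conjBy H k).subgroupOf K) := fun a b => by
    rw [Subgroup.mem_subgroupOf, Subgroup.mem_subgroupOf, FusionSystem.mem_conjBy]
    have : k * ((a * ⟨k, hk⟩)⁻¹ * (b * ⟨k, hk⟩) : K) * k⁻¹ = ((a⁻¹ * b : K) : S) := by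
      simp only [Subgroup.coe_mul, Subgroup.coe_inv]
      group
    rw [this]
  refine ⟨Quotient.congr (Equiv.mulRight (⟨k, hk⟩ : K)) fun a b => ?_, ?_⟩
  · exact QuotientGroup.leftRel_apply.trans ((key a b).trans QuotientGroup.leftRel_apply.symm)
  · intro g x
    obtain ⟨a, rfl⟩ := QuotientGroup.mk_surjective x
    exact congrArg QuotientGroup.mk (mul_assoc g a _)

end fixCard

theorem GrothendieckAlgebra.of_add {R : Type v} [CommRing R] {A : Type u}
    [NonUnitalNonAssocSemiring A] (a b : A) : of R (a + b) = of R a + of R b := by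
  unfold of
  rw [map_add, TensorProduct.tmul_add]
  rfl

theorem GrothendieckAlgebra.of_mul {R : Type v} [CommRing R] {A : Type u}
    [NonUnitalNonAssocSemiring A] (a b : A) : of R (a * b) = of R a * of R b := by
  unfold of
  rw [GrothendieckRing.of_mul]
  have := (Algebra.TensorProduct.tmul_mul_tmul (R := ℤ) (1 : R) 1 (GrothendieckRing.of a)
    (GrothendieckRing.of b)).symm
  rw [one_mul] at this
  exact this

/-- The canonical homomorphism from a semiring to the base change of its Grothendieck ring. -/
def GrothendieckAlgebra.ofHom (R : Type v) [CommRing R] (A : Type u) [Semiring A] :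
    A →+* GrothendieckAlgebra R A where
  toFun := of R
  map_one' := rfl
  map_mul' := of_mul
  map_zero' := by unfold of; rw [map_zero, TensorProduct.tmul_zero]; rfl
  map_add' := of_add

theorem GrothendieckAlgebra.induction {R : Type v} [CommRing R] {A : Type u}
    [NonUnitalNonAssocSemiring A] {P : GrothendieckAlgebra R A → Prop}
    (h0 : ∀ (a : A), P (of R a)) (h1 : ∀ x y, P x → P y → P (x + y))
    (h2 : ∀ (r : R) x, P x → P (r • x)) (x : GrothendieckAlgebra R A) : P x := by
  have hr : ∀ (r : R) (a : A), P (r ⊗ₜ[ℤ] GrothendieckRing.of a) := fun r a => by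
    have : r ⊗ₜ[ℤ] GrothendieckRing.of a = r • of R a := by
      refine Eq.trans ?_ (TensorProduct.smul_tmul' r (1 : R) (GrothendieckRing.of a)).symm
      rw [smul_eq_mul, mul_one]
    rw [this]
    exact h2 _ _ (h0 a)
  refine TensorProduct.induction_on (motive := P) x ?_ ?_ (fun x y => h1 x y)
  · have := hr 0 0
    rwa [TensorProduct.zero_tmul] at this
  · intro r z
    induction z using GrothendieckRing.ind with
    | h a b =>
      have : r ⊗ₜ[ℤ] (GrothendieckRing.of a - GrothendieckRing.of b) =
          r ⊗ₜ[ℤ] GrothendieckRing.of a + (-r) ⊗ₜ[ℤ] GrothendieckRing.of b := by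
        rw [TensorProduct.tmul_sub, TensorProduct.neg_tmul, sub_eq_add_neg]
      rw [this]
      exact h1 _ _ (hr _ _) (hr _ _)

/-! ### Classes of finite sets modulo the ideal of the non-centric subgroups -/

section bar

variable {S : Type u} [Group S] [Finite S] (R : Type v) [CommRing R] (F : FusionSystem S)

/-- The canonical homomorphism from the semiring of bisets to the quotient of the Mackey algebra. -/
def toCentric : genSubsemiring F →+* CentricMackeyAlgebra R F :=
  (Ideal.Quotient.mk _).comp (GrothendieckAlgebra.ofHom R (genSubsemiring F))

/-- The element of the Mackey algebra given by a finite `K`-set. -/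
def setElem (K : Subgroup S) (X : Type u) [MulAction K X] [Finite X] : genSubsemiring F :=
  ⟨setSum K X, setSum_mem F K X⟩

/-- The image in `μ(F) / I` of the element given by a finite `K`-set. -/
def bar (K : Subgroup S) (X : Type u) [MulAction K X] [Finite X] : CentricMackeyAlgebra R F :=
  toCentric R F (setElem F K X)

theorem toCentric_indGen_refl {K : Subgroup S} (hK : ¬ F.IsCentric K) :
    toCentric R F ⟨indGen (le_refl K), Subsemiring.subset_closure (IsGen.ind _)⟩ = 0 :=
  Ideal.Quotient.eq_zero_iff_mem.2 (TwoSidedIdeal.mem_asIdeal.2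
    (TwoSidedIdeal.subset_span ⟨K, hK, rfl⟩))

variable {K : Subgroup S} {X Y : Type u} [MulAction K X] [Finite X] [MulAction K Y] [Finite Y]

theorem bar_congr (h : SetIso K X Y) : bar R F K X = bar R F K Y := by
  unfold bar setElem setSum
  simp only [BisetClass.cls_congr h]

variable (K X Y)

theorem bar_sum : bar R F K (X ⊕ Y) = bar R F K X + bar R F K Y := by
  unfold bar
  rw [← map_add]
  congr 1
  refine Subtype.ext ?_
  change setSum K (X ⊕ Y) = setSum K X + setSum K Y
  rw [setSum, BisetClass.cls_sum, BisetSums.single_add]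
  rfl

theorem bar_sigma {ι : Type u} [Fintype ι] (Z : ι → Type u) [∀ i, MulAction K (Z i)]
    [∀ i, Finite (Z i)] : bar R F K (Σ i, Z i) = ∑ i, bar R F K (Z i) := by
  unfold bar
  rw [← map_sum]
  congr 1
  refine Subtype.ext ?_
  rw [AddSubmonoidClass.coe_finsetSum]
  change setSum K (Σ i, Z i) = ∑ i, setSum K (Z i)
  rw [setSum, BisetClass.cls_sigma, BisetSums.single_sum]
  rfl

theorem bar_mul : bar R F K X * bar R F K Y = bar R F K (X × Y) := by
  unfold bar
  rw [← map_mul]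
  congr 1
  refine Subtype.ext ?_
  change setSum K X * setSum K Y = setSum K (X × Y)
  rw [setSum, setSum, BisetSums.single_mul_single, BisetClass.cls_mul]
  rfl

theorem bar_mul_of_ne {K L : Subgroup S} (h : K ≠ L) (X Y : Type u) [MulAction K X] [Finite X]
    [MulAction L Y] [Finite Y] : bar R F K X * bar R F L Y = 0 := by
  unfold bar
  rw [← map_mul, ← map_zero (toCentric R F)]
  congr 1
  exact Subtype.ext (BisetSums.single_mul_single_of_ne h _ _)

variable {K} in
theorem bar_eq_zero (hK : ¬ F.IsCentric K) : bar R F K X = 0 := by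
  have : bar R F K X = toCentric R F ⟨indGen (le_refl K),
      Subsemiring.subset_closure (IsGen.ind _)⟩ * bar R F K X := by
    unfold bar
    rw [← map_mul]
    congr 1
    refine Subtype.ext ?_
    change setSum K X = indGen (le_refl K) * setSum K X
    rw [indGen_refl, setSum, BisetSums.single_mul_single, BisetClass.one_comp]
  rw [this, toCentric_indGen_refl R F hK, zero_mul]

-- The class of `K / A` is `I_A^K R_A^K`, which factors through the idempotent `I_A^A` of the ideal.
variable {K} in
theorem bar_quotient_eq_zero {A : Subgroup S} (hAK : A ≤ K) (hA : ¬ F.IsCentric A) :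
    bar R F K (K ⧸ A.subgroupOf K) = 0 := by
  have : bar R F K (K ⧸ A.subgroupOf K) =
      toCentric R F ⟨indGen hAK, Subsemiring.subset_closure (IsGen.ind _)⟩ *
        (toCentric R F ⟨indGen (le_refl A), Subsemiring.subset_closure (IsGen.ind _)⟩ *
        toCentric R F ⟨resGen hAK, Subsemiring.subset_closure (IsGen.res _)⟩) := by
    unfold bar
    rw [← map_mul, ← map_mul]
    congr 1
    refine Subtype.ext ?_
    change setSum K _ = indGen hAK * (indGen (le_refl A) * resGen hAK)
    rw [← indGen_mul_resGen hAK, indGen_refl, resGen, BisetSums.single_mul_single,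
      BisetClass.one_comp]
  rw [this, toCentric_indGen_refl R F hA, zero_mul, mul_zero]

variable {K X Y} in
/-- The class of a finite `K`-set in `μ(F) / I` only depends on its marks at centric subgroups. -/
theorem bar_eq_of_fixCard (h : ∀ P : Subgroup S, P ≤ K → F.IsCentric P →
    fixCard (K := K) P X = fixCard (K := K) P Y) : bar R F K X = bar R F K Y := by
  classical
  obtain ⟨ι, _, A, hA, hX⟩ := SetIso.exists_sigma K X
  obtain ⟨κ, _, B, hB, hY⟩ := SetIso.exists_sigma K Y
  rw [← bar_congr R F hX, ← bar_congr R F hY, bar_sigma, bar_sigma, ← sub_eq_zero]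
  let C := {A : Subgroup S // A ≤ K ∧ F.IsCentric A}
  -- A centric `P` has fixed points only on cosets of centric subgroups. So orbits of non-centric
  -- type are invisible to the marks, and their classes vanish modulo the ideal; both sides may be
  -- restricted to centric types.
  have hup : ∀ {P H : Subgroup S}, P ≤ K → F.IsCentric P →
      fixCard (K := K) P (K ⧸ H.subgroupOf K) ≠ 0 → F.IsCentric H := by
    intro P H hPK hP h
    obtain ⟨k, hk, hle⟩ := (fixCard_quotient_ne_zero P hPK).1 h
    exact hP.of_mor (F.isMor_conj k⁻¹ P) fun x hx => hle ⟨x, hx, by simp⟩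
  let g : ι ⊕ κ → Subgroup S := Sum.elim A B
  let c : ι ⊕ κ → ℤ := Sum.elim (fun _ => 1) (fun _ => -1)
  have hg : ∀ t, g t ≤ K := by rintro (i | i); exacts [hA i, hB i]
  -- The table of marks of `K`, restricted to centric subgroups: triangular with respect to order,
  -- with `K`-conjugacy as the equivalence.
  have key := sum_eq_zero_of_marks (ι := {t // F.IsCentric (g t)}) (C := C)
    (m := fun P H => fixCard (K := K) P.1 (K ⧸ H.1.subgroupOf K))
    (size := fun H => Nat.card H.1) (r := fun P H => ∃ k ∈ K, FusionSystem.conjBy P.1 k = H.1)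
    (f := fun H => bar R F K (K ⧸ H.1.subgroupOf K)) ?_ ?_ ?_ ?_ (fun t => c t.1)
    (fun t => ⟨g t.1, hg t.1, t.2⟩) Finset.univ ?_
  · have hs := Finset.sum_subtype (Finset.univ.filter fun t => F.IsCentric (g t)) (p := fun t => F.IsCentric (g t)) (F := inferInstance)
      (fun t => by rw [Finset.mem_filter]; simp)
      (fun t => c t • bar R F K (K ⧸ (g t).subgroupOf K))
    rw [← hs, Finset.sum_filter_of_ne, Fintype.sum_sum_type] at key
    · simpa [c, g, sub_eq_add_neg] using key
    · intro t _ ht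
      by_contra hc
      exact ht (by rw [bar_quotient_eq_zero R F (hg t) hc, smul_zero])
  · rintro ⟨P, hP, hP'⟩
    exact (fixCard_quotient_ne_zero P hP).2 ⟨1, one_mem _, by rw [FusionSystem.conjBy_one]⟩
  · rintro ⟨P, hP, hP'⟩ ⟨H, hH, hH'⟩ hm
    obtain ⟨k, hk, hle⟩ := (fixCard_quotient_ne_zero P hP).1 hm
    refine ⟨?_, fun h => ⟨k, hk, ?_⟩⟩
    · rw [← FusionSystem.card_conjBy P k]
      exact card_le_of_le hle
    · refine Subgroup.eq_of_le_of_card_ge hle ?_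
      rw [FusionSystem.card_conjBy]
      exact h
  · rintro P ⟨H, hH, hH'⟩ ⟨H', hH1, hH2⟩ ⟨k, hk, rfl⟩
    exact fixCard_congr _ (SetIso.conjBy hk)
  · rintro ⟨H, hH, hH'⟩ ⟨H', hH1, hH2⟩ ⟨k, hk, rfl⟩
    exact bar_congr R F (SetIso.conjBy hk)
  · rintro ⟨P, hP, hP'⟩
    have hs := Finset.sum_subtype (Finset.univ.filter fun t => F.IsCentric (g t)) (p := fun t => F.IsCentric (g t)) (F := inferInstance)
      (fun t => by rw [Finset.mem_filter]; simp)
      (fun t => c t * (fixCard (K := K) P (K ⧸ (g t).subgroupOf K) : ℤ))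
    have h0 := h P hP hP'
    rw [← fixCard_congr P hX, ← fixCard_congr P hY, fixCard_sigma, fixCard_sigma] at h0
    rw [← hs, Finset.sum_filter_of_ne, Fintype.sum_sum_type]
    · have h1 : (∑ i, (fixCard (K := K) P (K ⧸ (A i).subgroupOf K) : ℤ)) =
          ∑ i, (fixCard (K := K) P (K ⧸ (B i).subgroupOf K) : ℤ) := by exact_mod_cast h0
      simp only [c, g, Sum.elim_inl, Sum.elim_inr, one_mul, neg_mul, Finset.sum_neg_distrib]
      exact add_neg_eq_zero.2 h1
    · intro t _ ht
      refine hup hP hP' (H := g t) fun h => ht ?_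
      rw [h]; simp

end bar

end

section

/-! ### Central elements from sets with an action of `S` -/

/-- A `G`-set regarded as an `H`-set through a homomorphism `H → G`. -/
def ActionVia {G : Type u} {H : Type v} [Group G] [Group H] (_ : H →* G) (X : Type w) : Type w := X

instance {G : Type u} {H : Type v} [Group G] [Group H] (f : H →* G) (X : Type w)
    [MulAction G X] : MulAction H (ActionVia f X) := MulAction.compHom X f

instance {G : Type u} {H : Type v} [Group G] [Group H] (f : H →* G) (X : Type w)
    [Finite X] : Finite (ActionVia f X) := inferInstanceAs (Finite X)

variable {S : Type u} [Group S] [Finite S] (R : Type v) [CommRing R] (F : FusionSystem S)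

omit [Finite S] in
theorem fixCard_restrict {P K : Subgroup S} (hPK : P ≤ K) (X : Type w) [MulAction S X] :
    fixCard (K := K) P X = fixCard (K := P) P X :=
  Nat.card_congr (Equiv.subtypeEquivRight fun _ =>
    ⟨fun h k hk => h ⟨k, hPK hk⟩ hk, fun h k hk => h ⟨k, hk⟩ hk⟩)

/-- The element of `μ(F) / I` given by a finite `S`-set. -/
def gamma (X : Type u) [MulAction S X] [Finite X] : CentricMackeyAlgebra R F :=
  ∑ K ∈ BisetSums.subgroups S, bar R F K X

section

variable (X Y : Type u) [MulAction S X] [Finite X] [MulAction S Y] [Finite Y]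

variable {X Y} in
theorem gamma_eq_of_marks (h : ∀ P : F.Centric, fixCard (K := P.grp) P.grp X =
    fixCard (K := P.grp) P.grp Y) : gamma R F X = gamma R F Y := by
  refine Finset.sum_congr rfl fun K _ => bar_eq_of_fixCard R F fun P hPK hP => ?_
  rw [fixCard_restrict hPK, fixCard_restrict hPK]
  exact h ⟨P, hP⟩

theorem gamma_sum : gamma R F (X ⊕ Y) = gamma R F X + gamma R F Y := by
  unfold gamma
  rw [← Finset.sum_add_distrib]
  exact Finset.sum_congr rfl fun K _ => bar_sum R F K X Y

theorem gamma_empty [IsEmpty X] : gamma R F X = 0 := by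
  refine Finset.sum_eq_zero fun K _ => ?_
  unfold bar
  rw [← map_zero (toCentric R F)]
  congr 1
  refine Subtype.ext ?_
  change setSum K X = 0
  rw [setSum, BisetClass.cls_empty]
  exact map_zero (BisetSums.singleHom K K)

theorem gamma_mul : gamma R F X * gamma R F Y = gamma R F (X × Y) := by
  unfold gamma
  rw [Finset.sum_mul_sum]
  refine Finset.sum_congr rfl fun K hK => ?_
  rw [Finset.sum_eq_single_of_mem K hK fun L _ hL => bar_mul_of_ne R F hL.symm X Y, bar_mul]

theorem gamma_unique [Unique X] : gamma R F X = 1 := by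
  unfold gamma bar
  rw [← map_sum, ← map_one (toCentric R F)]
  congr 1
  refine Subtype.ext ?_
  rw [AddSubmonoidClass.coe_finsetSum]
  change ∑ K ∈ BisetSums.subgroups S, setSum K X = 1
  rw [BisetSums.one_eq_sum]
  refine Finset.sum_congr rfl fun K _ => ?_
  rw [setSum, BisetClass.cls_unique]

theorem gamma_mul_single {L A : Subgroup S} (a : BisetClass L A)
    (h : BisetSums.single L A a ∈ genSubsemiring F) :
    gamma R F X * toCentric R F ⟨_, h⟩ = bar R F L X * toCentric R F ⟨_, h⟩ := by
  unfold gamma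
  rw [Finset.sum_mul]
  refine Finset.sum_eq_single_of_mem L (BisetSums.mem_subgroups L) fun K _ hK => ?_
  unfold bar
  rw [← map_mul, ← map_zero (toCentric R F)]
  congr 1
  exact Subtype.ext (BisetSums.single_mul_single_of_ne hK _ _)

theorem single_mul_gamma {L A : Subgroup S} (a : BisetClass L A)
    (h : BisetSums.single L A a ∈ genSubsemiring F) :
    toCentric R F ⟨_, h⟩ * gamma R F X = toCentric R F ⟨_, h⟩ * bar R F A X := by
  unfold gamma
  rw [Finset.mul_sum]
  refine Finset.sum_eq_single_of_mem A (BisetSums.mem_subgroups A) fun K _ hK => ?_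
  unfold bar
  rw [← map_mul, ← map_zero (toCentric R F)]
  congr 1
  exact Subtype.ext (BisetSums.single_mul_single_of_ne hK.symm _ _)

theorem bar_mul_diagClass {C L A : Subgroup S} (f : C →* L) (k : C →* A)
    (h : BisetSums.single L A (diagClass f k) ∈ genSubsemiring F)
    {X X' : Type u} [MulAction L X] [Finite X] [MulAction A X'] [Finite X'] (θ : X ≃ X')
    (hθ : ∀ c x, θ (f c • x) = k c • θ x) :
    bar R F L X * toCentric R F ⟨_, h⟩ = toCentric R F ⟨_, h⟩ * bar R F A X' := by
  unfold bar
  rw [← map_mul, ← map_mul]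
  congr 1
  refine Subtype.ext ?_
  change setSum L X * BisetSums.single L A (diagClass f k) =
    BisetSums.single L A (diagClass f k) * setSum A X'
  rw [setSum, setSum, BisetSums.single_mul_single, BisetSums.single_mul_single, diagClass,
    BisetClass.cls_comp_transitive f k θ hθ]

omit [Finite S] in
theorem commute_of_closure {A : Type u} [Semiring A] {B : Type v} [Semiring B] {s : Set A}
    (f : Subsemiring.closure s →+* B) {z : B}
    (h : ∀ (a : A) (ha : a ∈ s), z * f ⟨a, Subsemiring.subset_closure ha⟩ =
      f ⟨a, Subsemiring.subset_closure ha⟩ * z) (a : Subsemiring.closure s) :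
    z * f a = f a * z := by
  obtain ⟨a, ha⟩ := a
  induction ha using Subsemiring.closure_induction with
  | mem a ha => exact h a ha
  | zero =>
    have : f ⟨0, zero_mem _⟩ = 0 := map_zero f
    rw [this, mul_zero, zero_mul]
  | one =>
    have : f ⟨1, one_mem _⟩ = 1 := map_one f
    rw [this, mul_one, one_mul]
  | add a b ha hb h1 h2 =>
    have : f ⟨a + b, add_mem ha hb⟩ = f ⟨a, ha⟩ + f ⟨b, hb⟩ := map_add f ⟨a, ha⟩ ⟨b, hb⟩
    rw [this, mul_add, add_mul, h1, h2]
  | mul a b ha hb h1 h2 =>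
    have : f ⟨a * b, mul_mem ha hb⟩ = f ⟨a, ha⟩ * f ⟨b, hb⟩ := map_mul f ⟨a, ha⟩ ⟨b, hb⟩
    rw [this, ← mul_assoc, h1, mul_assoc, h2, mul_assoc]

variable {R F} in
theorem mem_center_of_gens {z : CentricMackeyAlgebra R F}
    (h : ∀ (a : BisetSums S) (ha : IsGen F a),
      z * toCentric R F ⟨a, Subsemiring.subset_closure ha⟩ =
        toCentric R F ⟨a, Subsemiring.subset_closure ha⟩ * z) :
    z ∈ Subalgebra.center R (CentricMackeyAlgebra R F) := by
  have h1 := commute_of_closure (toCentric R F) h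
  rw [Subalgebra.mem_center_iff]
  intro y
  obtain ⟨y, rfl⟩ := Ideal.Quotient.mk_surjective y
  induction y using GrothendieckAlgebra.induction with
  | h0 a => exact (h1 a).symm
  | h1 x y hx hy => rw [map_add, add_mul, mul_add, hx, hy]
  | h2 r x hx =>
    have : Ideal.Quotient.mk (MackeyAlgebra.noncentricIdeal R F).asIdeal (r • x) =
      r • Ideal.Quotient.mk (MackeyAlgebra.noncentricIdeal R F).asIdeal x := rfl
    rw [this, smul_mul_assoc, hx, mul_smul_comm]

/-- Restrictions and inductions commute with the element because the set carries one action of all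
of `S`. For `c_φ` the set `X` and its twist by `φ` need not be isomorphic, but by hypothesis they
have the same marks at centric subgroups, hence the same class modulo the ideal. -/
theorem gamma_mem_center (h : ∀ P Q : F.Centric, F.Conj P.grp Q.grp →
    fixCard (K := P.grp) P.grp X = fixCard (K := Q.grp) Q.grp X) :
    gamma R F X ∈ Subalgebra.center R (CentricMackeyAlgebra R F) := by
  refine mem_center_of_gens ?_
  rintro _ (@⟨H, K, hHK⟩ | @⟨H, K, hHK⟩ | @⟨H, K, φ, hφ⟩)
  · refine (gamma_mul_single R F X _ _).trans (Eq.trans ?_ (single_mul_gamma R F X _ _).symm)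
    exact bar_mul_diagClass R F _ _ _ (Equiv.refl X) fun c x => rfl
  · refine (gamma_mul_single R F X _ _).trans (Eq.trans ?_ (single_mul_gamma R F X _ _).symm)
    exact bar_mul_diagClass R F _ _ _ (Equiv.refl X) fun c x => rfl
  · refine (gamma_mul_single R F X _ _).trans (Eq.trans ?_ (single_mul_gamma R F X _ _).symm)
    have hb : bar R F H X = bar R F H (ActionVia φ.toMonoidHom X) := by
      refine bar_eq_of_fixCard R F fun P hPH hP => ?_
      have hf := (FusionSystem.isMor_extendFun hφ).mono hPH
      rw [fixCard_restrict hPH, h ⟨P, hP⟩ ⟨_, hP.im hf⟩ hf.conj_im]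
      refine Nat.card_congr (Equiv.subtypeEquivRight fun x => ⟨fun h k hk => ?_, fun h k hk => ?_⟩)
      · have := h ⟨_, hf.mem_im_of_mem hk⟩ (hf.mem_im_of_mem hk)
        refine Eq.trans ?_ this
        change (φ k : S) • x = FusionSystem.extendFun φ.toMonoidHom (k : S) • x
        rw [FusionSystem.extendFun_coe]
        rfl
      · obtain ⟨y, hy, e⟩ := hf.mem_im.1 hk
        have := h ⟨y, hPH hy⟩ hy
        refine Eq.trans ?_ this
        change (k : S) • x = (φ ⟨y, hPH hy⟩ : S) • x
        rw [← e, FusionSystem.extendFun_of_mem _ (hPH hy)]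
        rfl
    rw [hb]
    exact bar_mul_diagClass R F _ _ _ (Equiv.refl X) fun c x => rfl

end

end

section

/-! ### The homomorphism from the centric Burnside ring -/

namespace GrothendieckAlgebra

variable (R : Type v) [CommRing R] {A : Type u} [NonUnitalNonAssocSemiring A]

variable {R} in
/-- The extension of an additive and multiplicative map to the base change of the Grothendieck
ring. -/
def lift {B : Type w} [Ring B] [Algebra R B] (f : A →ₙ+* B) : GrothendieckAlgebra R A →ₙₐ[R] B :=
  let l : GrothendieckAlgebra R A →ₗ[R] B :=
    LinearMap.liftBaseChange R (GrothendieckRing.lift (f : A →+ B)).toIntLinearMap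
  have hl : ∀ a, l (of R a) = f a := fun a => by
    refine (LinearMap.liftBaseChange_tmul R _ _ _).trans ?_
    rw [one_smul]
    exact GrothendieckRing.lift_of _ a
  { l with
    map_zero' := map_zero l
    map_mul' := fun x y => by
      change l (x * y) = l x * l y
      induction x using GrothendieckAlgebra.induction with
      | h0 a =>
        induction y using GrothendieckAlgebra.induction with
        | h0 b => rw [← of_mul, hl, hl, hl, map_mul]
        | h1 x y hx hy => rw [mul_add, map_add, map_add, mul_add, hx, hy]
        | h2 r x hx =>
          have : of R a * r • x = r • (of R a * x) :=
            mul_smul_comm (α := R) (β := R ⊗[ℤ] GrothendieckRing A) r (of R a) x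
          rw [this, map_smul, map_smul, hx, mul_smul_comm]
      | h1 x y hx hy => rw [add_mul, map_add, map_add, add_mul, hx, hy]
      | h2 r x hx =>
        have : r • x * y = r • (x * y) :=
          smul_mul_assoc (α := R) (β := R ⊗[ℤ] GrothendieckRing A) r x y
        rw [this, map_smul, map_smul, hx, smul_mul_assoc] }

theorem lift_of {B : Type w} [Ring B] [Algebra R B] (f : A →ₙ+* B) (a : A) :
    lift f (of R a) = f a := by
  refine (LinearMap.liftBaseChange_tmul R _ _ _).trans ?_
  rw [one_smul]
  exact GrothendieckRing.lift_of _ a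

variable {R} in
/-- The extension of an additive and multiplicative map to the center of an algebra. -/
def liftCenter {B : Type w} [Ring B] [Algebra R B] (f : A →ₙ+* Subalgebra.center R B) :
    GrothendieckAlgebra R A →ₙₐ[R] Subalgebra.center R B := lift f

theorem liftCenter_of {B : Type w} [Ring B] [Algebra R B] (f : A →ₙ+* Subalgebra.center R B)
    (a : A) : liftCenter f (of R a) = f a := lift_of R f a

end GrothendieckAlgebra

variable {S : Type u} [Group S] [Finite S] (R : Type v) [CommRing R] (F : FusionSystem S)

variable {F} in
/-- The `S`-set `∐ S / φ(A)`, over the components `(A, φ)` of the product of `H` and `S`. -/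
def orbitSet (H : F.Centric) : Type u :=
  ActionVia (Subgroup.topEquiv.symm.toMonoidHom : S →* (⊤ : Subgroup S)) (F.ProdSet H.grp ⊤)

variable {F} in
/-- The `S`-set given by a formal coproduct of centric subgroups. -/
def coprodSet (X : F.AddExt) : Type u := Σ i : X.obj.I, orbitSet (X.obj.obj i)

instance (H : F.Centric) : MulAction S (orbitSet H) :=
  inferInstanceAs (MulAction S (ActionVia (Subgroup.topEquiv.symm.toMonoidHom : S →* (⊤ : Subgroup S))
    (F.ProdSet H.grp ⊤)))

instance (H : F.Centric) : Finite (orbitSet H) :=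
  inferInstanceAs (Finite (F.ProdSet H.grp ⊤))

instance (X : F.AddExt) : MulAction S (coprodSet X) :=
  inferInstanceAs (MulAction S (Σ i : X.obj.I, orbitSet (X.obj.obj i)))

instance (X : F.AddExt) : Finite (coprodSet X) :=
  haveI := X.property
  inferInstanceAs (Finite (Σ i : X.obj.I, orbitSet (X.obj.obj i)))

variable {F}

variable {p : ℕ} [Fact p.Prime] (hS : IsPGroup p S) (hF : F.IsSaturated p)

include hS hF

/-- The dictionary between the two sides: fixed points on the `S`-set of `H` are counted by the
marks of `H` in the Burnside ring. -/
theorem fixCard_orbitSet (P H : F.Centric) :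
    fixCard (K := P.grp) P.grp (orbitSet H) = Nat.card (P ⟶ H) := by
  refine Eq.trans ?_ (hF.fixCard_prodSet hS P.isCentric (le_top : P.grp ≤ ⊤))
  exact Nat.card_congr (Equiv.subtypeEquivRight fun x =>
    ⟨fun h k hk => h ⟨k, hk⟩ hk, fun h k hk => h ⟨k, trivial⟩ hk⟩)

theorem fixCard_coprodSet (P : F.Centric) (X : F.AddExt) :
    fixCard (K := P.grp) P.grp (coprodSet X) = AddExt.mark P X := by
  have := X.property
  have := Fintype.ofFinite X.obj.I
  rw [AddExt.mark_eq_sum]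
  refine (fixCard_sigma P.grp _).trans ?_
  exact Finset.sum_congr rfl fun i _ => fixCard_orbitSet hS hF P _

theorem gamma_coprodSet_mem (X : F.AddExt) :
    gamma R F (coprodSet X) ∈ Subalgebra.center R (CentricMackeyAlgebra R F) :=
  gamma_mem_center R F _ fun P Q h => by
    rw [fixCard_coprodSet hS hF, fixCard_coprodSet hS hF]
    exact AddExt.mark_congr_left (FusionSystem.Centric.nonempty_iso h) X

/-- The map from isomorphism classes to the center of `μ(F) / I`. -/
def classHom : BurnsideClass F →ₙ+* Subalgebra.center R (CentricMackeyAlgebra R F) where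
  -- Independence of the object, additivity and multiplicativity are all checked on marks; the
  -- `S`-sets involved need not be isomorphic.
  toFun := Quotient.lift (s := isIsomorphicSetoid F.AddExt)
    (fun X => ⟨gamma R F (coprodSet X), gamma_coprodSet_mem R hS hF X⟩) fun X Y h => by
      refine Subtype.ext (gamma_eq_of_marks R F fun P => ?_)
      rw [fixCard_coprodSet hS hF, fixCard_coprodSet hS hF]
      exact AddExt.mark_congr h
  map_zero' := Subtype.ext <| by
    have : IsEmpty (coprodSet (AddExt.empty F)) := ⟨fun t => PEmpty.elim t.1⟩
    exact gamma_empty R F _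
  map_add' a b := by
    induction a using BurnsideClass.ind with
    | h X =>
    induction b using BurnsideClass.ind with
    | h Y =>
      refine Subtype.ext ((gamma_eq_of_marks R F fun P => ?_).trans (gamma_sum R F _ _))
      rw [fixCard_sum, fixCard_coprodSet hS hF P X, fixCard_coprodSet hS hF P Y]
      exact (fixCard_coprodSet hS hF P (AddExt.sum X Y)).trans (AddExt.mark_sum P X Y)
  map_mul' a b := by
    induction a using BurnsideClass.ind with
    | h X =>
    induction b using BurnsideClass.ind with
    | h Y =>
      -- The object `Z` representing the product need not be known explicitly, since only its marks
      -- matter.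
      obtain ⟨Z, hZ⟩ : ∃ Z, BurnsideClass.mk X * BurnsideClass.mk Y = BurnsideClass.mk Z :=
        BurnsideClass.ind (P := fun a => ∃ Z, a = BurnsideClass.mk Z) (fun Z => ⟨Z, rfl⟩) _
      rw [hZ]
      refine Subtype.ext ((gamma_eq_of_marks R F fun P => ?_).trans (gamma_mul R F _ _).symm)
      rw [fixCard_prod, fixCard_coprodSet hS hF, fixCard_coprodSet hS hF, fixCard_coprodSet hS hF,
        ← BurnsideClass.mark_mk, ← BurnsideClass.mark_mk, ← BurnsideClass.mark_mk, ← hZ,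
        BurnsideClass.mark_mul hS hF]

/-- The homomorphism from the centric Burnside ring to the center of `μ(F) / I`. -/
def burnsideHom : BurnsideRing R F →ₙₐ[R] Subalgebra.center R (CentricMackeyAlgebra R F) :=
  GrothendieckAlgebra.liftCenter (classHom R hS hF)

theorem burnsideHom_cls (X : F.AddExt) :
    (burnsideHom R hS hF (BurnsideRing.cls R X) : CentricMackeyAlgebra R F) =
      gamma R F (coprodSet X) :=
  congrArg Subtype.val (GrothendieckAlgebra.liftCenter_of R (classHom R hS hF) (BurnsideClass.mk X))

theorem burnsideHom_toAddExt (H : F.Centric) :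
    (burnsideHom R hS hF (BurnsideRing.cls R H.toAddExt) : CentricMackeyAlgebra R F) =
      gamma R F (orbitSet H) := by
  rw [burnsideHom_cls]
  refine gamma_eq_of_marks R F fun P => ?_
  rw [fixCard_coprodSet hS hF, fixCard_orbitSet hS hF, AddExt.mark_toAddExt]

/-- On the left stands `θ_H(θ^H(1))`, built from a different set for every `K`; on the right, one
`S`-set restricted to every `K`. For centric `P ≤ K` both sets have `|Hom(P, H)|` fixed points, so
their classes agree modulo the ideal. Non-centric `K` contribute zero on the right. -/
theorem sum_bar_prodSet (H : F.Centric) :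
    ∑ K : F.Centric, ∑ q : F.ProdIndex H.grp K.grp, bar R F K.grp (K.grp ⧸ q.image.subgroupOf K.grp) =
      gamma R F (orbitSet H) := by
  refine Finset.sum_of_injOn FusionSystem.Centric.grp
    (FusionSystem.Centric.grp_injective F).injOn (fun K _ => BisetSums.mem_subgroups _) ?_ ?_
  · intro K _ hK
    refine bar_eq_zero R F _ fun hc => hK ⟨⟨K, hc⟩, by simp, rfl⟩
  · intro K _
    rw [← bar_sigma R F K.grp (fun q : F.ProdIndex H.grp K.grp => K.grp ⧸ q.image.subgroupOf K.grp)]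
    refine bar_eq_of_fixCard R F fun P hPK hP => ?_
    rw [fixCard_restrict hPK, fixCard_orbitSet hS hF ⟨P, hP⟩ H]
    exact hF.fixCard_prodSet hS hP hPK

omit hS hF

/-! ### The composition of the maps `θ` -/

theorem conjGen_mul_conjGen_symm {H K : Subgroup S} (φ : H ≃* K) :
    conjGen φ * conjGen φ.symm = indGen (le_refl K) := by
  have h := diagClass_comp_equiv φ φ.symm.toMonoidHom (MonoidHom.id K)
  have h1 : φ.symm.toMonoidHom.comp φ.toMonoidHom = MonoidHom.id H := by ext x; simp
  rw [h1, MonoidHom.id_comp] at h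
  have h' := diagClass_comp_equiv φ (MonoidHom.id K) (MonoidHom.id K)
  rw [MonoidHom.id_comp] at h'
  rw [conjGen, conjGen, BisetSums.single_mul_single, ← h, comp_diagClass, h', indGen_refl,
    diagClass_id]

theorem single_mul_indGen_refl {A B : Subgroup S} (a : BisetClass B A) :
    BisetSums.single B A a * indGen (le_refl A) = BisetSums.single B A a := by
  rw [indGen_refl, BisetSums.single_mul_single, BisetClass.comp_one]

theorem single_mul_indGen_refl_of_ne {A B K : Subgroup S} (h : A ≠ K) (a : BisetClass B A) :
    BisetSums.single B A a * indGen (le_refl K) = 0 := by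
  rw [indGen_refl, BisetSums.single_mul_single_of_ne h]

variable (F) in
theorem conj_mul_innerOne {A B H : Subgroup S} (hA : A ≤ H) (φ : A ≃* B)
    (hφ : φ.toMonoidHom ∈ F.Hom A B) :
    MackeyAlgebra.conj R F φ hφ * MackeyAlgebra.innerOne R F H = MackeyAlgebra.conj R F φ hφ := by
  classical
  unfold MackeyAlgebra.innerOne
  rw [Finset.mul_sum, Finset.sum_eq_single_of_mem A
    (Finset.mem_filter.2 ⟨BisetSums.mem_subgroups A, hA⟩)]
  · refine (GrothendieckAlgebra.of_mul _ _).symm.trans ?_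
    refine congrArg (GrothendieckAlgebra.of R) (Subtype.ext ?_)
    exact single_mul_indGen_refl _
  · intro K _ hK
    refine (GrothendieckAlgebra.of_mul _ _).symm.trans ?_
    refine Eq.trans ?_ (map_zero (GrothendieckAlgebra.ofHom R (genSubsemiring F)))
    refine congrArg (GrothendieckAlgebra.of R) (Subtype.ext ?_)
    exact single_mul_indGen_refl_of_ne hK.symm _

/-- The conjugations cancel, and `I R` is the class of the cosets of `φ(A)`. The two factors
`innerOne` come from the form of `ResInd.tmul` and `ResInd.eval`; they are absorbed because `A ≤ H`.
-/
theorem indConj_mul_conjRes {A K H : Subgroup S} (hA : A ≤ H) (φ : F.OrbitHom A K) :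
    MackeyAlgebra.indConj R F φ * MackeyAlgebra.innerOne R F H * MackeyAlgebra.innerOne R F H *
      (MackeyAlgebra.conjRes R F φ * MackeyAlgebra.idem R F K) =
    GrothendieckAlgebra.of R (setElem F K (K ⧸ (image φ.rep).subgroupOf K)) := by
  unfold MackeyAlgebra.indConj MackeyAlgebra.conjRes
  rw [mul_assoc (MackeyAlgebra.ind R F _), conj_mul_innerOne R F hA,
    mul_assoc (MackeyAlgebra.ind R F _), conj_mul_innerOne R F hA]
  refine Eq.trans (b := GrothendieckAlgebra.ofHom R (genSubsemiring F)
    (⟨_, Subsemiring.subset_closure (IsGen.ind (FusionSystem.image_le φ.rep))⟩ *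
      ⟨_, Subsemiring.subset_closure (IsGen.conj _ (F.toImage_mem φ.rep_mem))⟩ *
      (⟨_, Subsemiring.subset_closure (IsGen.conj _ (F.toImage_symm_mem φ.rep_mem))⟩ *
      ⟨_, Subsemiring.subset_closure (IsGen.res (FusionSystem.image_le φ.rep))⟩ *
      ⟨_, Subsemiring.subset_closure (IsGen.ind (le_refl K))⟩))) ?_ ?_
  · simp only [map_mul]
    rfl
  · refine congrArg (GrothendieckAlgebra.of R) (Subtype.ext ?_)
    change indGen _ * conjGen _ * (conjGen _ * resGen _ * indGen _) = setSum _ _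
    rw [← indGen_mul_resGen (FusionSystem.image_le φ.rep), mul_assoc (conjGen _) (resGen _),
      resGen, single_mul_indGen_refl, ← mul_assoc, mul_assoc (indGen _) (conjGen _),
      conjGen_mul_conjGen_symm, indGen, single_mul_indGen_refl]

/-- `θ_H θ^H` is multiplication by an element of the Mackey algebra that does not depend on `M`, so
the statement for arbitrary `M` reduces to the one for `μ(F) / I`. -/
theorem thetaDown_thetaUp (H : F.Centric) (M : Type w) [AddCommGroup M]
    [Module (MackeyAlgebra R F) M] (m : M) :
    thetaDown R F H.grp M (thetaUp R F H.grp M m) =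
      (∑ K : F.Centric, ∑ q : F.ProdIndex H.grp K.grp, GrothendieckAlgebra.of R
        (setElem F K.grp (K.grp ⧸ q.image.subgroupOf K.grp)) : MackeyAlgebra R F) • m := by
  unfold thetaUp
  simp only [AddMonoidHom.finsetSum_apply, map_sum, Finset.sum_smul]
  refine Finset.sum_congr rfl fun K _ => Finset.sum_congr rfl fun q _ => ?_
  refine (ResInd.eval_tmul _ _ M _ _).trans ?_
  rw [DistribSMul.toAddMonoidHom_apply, smul_smul, smul_smul,
    indConj_mul_conjRes R q.rep.le q.rep.hom]
  rfl

include hS hF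

theorem burnsideHom_eq_mk (H : F.Centric) :
    (burnsideHom R hS hF (BurnsideRing.cls R H.toAddExt) : CentricMackeyAlgebra R F) =
      Ideal.Quotient.mk (MackeyAlgebra.noncentricIdeal R F).asIdeal
        (∑ K : F.Centric, ∑ q : F.ProdIndex H.grp K.grp, GrothendieckAlgebra.of R
          (setElem F K.grp (K.grp ⧸ q.image.subgroupOf K.grp))) := by
  rw [burnsideHom_toAddExt, ← sum_bar_prodSet R hS hF]
  simp only [map_sum]
  rfl

theorem burnsideHom_eq_theta (H : F.Centric) :
    (burnsideHom R hS hF (BurnsideRing.cls R H.toAddExt) : CentricMackeyAlgebra R F) =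
      thetaDown R F H.grp (CentricMackeyAlgebra R F)
        (thetaUp R F H.grp (CentricMackeyAlgebra R F) 1) := by
  rw [thetaDown_thetaUp, burnsideHom_eq_mk]
  exact congrArg (Ideal.Quotient.mk _) (mul_one _).symm

end

section

/-! ### The identity element -/

variable {S : Type u} [Group S] [Finite S] (R : Type v) [CommRing R] {F : FusionSystem S}

theorem IsPLocal.isUnit {p : ℕ} {R : Type v} [CommRing R] (hR : IsPLocal p R)
    {n : ℕ} (hn : ¬ p ∣ n) : IsUnit (n : R) := by
  induction n using induction_on_primes with
  | zero => exact (hn (dvd_zero p)).elim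
  | one => simp
  | prime_mul q a hq ih =>
    rw [Nat.cast_mul]
    refine (hR q hq fun h => hn (h ▸ dvd_mul_right q a)).mul (ih fun h => hn (h.mul_left q))

variable (F) in
theorem gamma_sigma {ι : Type u} [Fintype ι] (Z : ι → Type u) [∀ i, MulAction S (Z i)]
    [∀ i, Finite (Z i)] : gamma R F (Σ i, Z i) = ∑ i, gamma R F (Z i) := by
  unfold gamma
  rw [Finset.sum_comm]
  exact Finset.sum_congr rfl fun K _ => bar_sigma R F K Z

namespace GrothendieckAlgebra

variable {R}
variable {A : Type u} [NonUnitalNonAssocSemiring A]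

/-- A pure tensor. -/
def tmul (r : R) (a : GrothendieckRing A) : GrothendieckAlgebra R A := r ⊗ₜ[ℤ] a

theorem tmul_mul_tmul (r r' : R) (a a' : GrothendieckRing A) :
    tmul r a * tmul r' a' = tmul (r * r') (a * a') :=
  Algebra.TensorProduct.tmul_mul_tmul _ _ _ _

theorem tmul_nsmul (r : R) (n : ℕ) (a : GrothendieckRing A) :
    tmul r (n • a) = tmul (n * r) a := by
  unfold tmul
  rw [← natCast_zsmul, ← TensorProduct.smul_tmul, natCast_zsmul, nsmul_eq_mul]

theorem induction_tmul {P : GrothendieckAlgebra R A → Prop} (h0 : ∀ r a, P (tmul r a))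
    (h1 : ∀ x y, P x → P y → P (x + y)) (x : GrothendieckAlgebra R A) : P x :=
  TensorProduct.induction_on (motive := P) x
    (TensorProduct.zero_tmul (R := ℤ) R (0 : GrothendieckRing A) ▸ h0 0 0) h0 h1

theorem lift_tmul {B : Type w} [Ring B] [Algebra R B] (f : A →ₙ+* B) (r : R)
    (a : GrothendieckRing A) : lift f (tmul r a) = r • GrothendieckRing.lift (f : A →+ B) a :=
  LinearMap.liftBaseChange_tmul R _ _ _

/-- The additive extension of an additive and multiplicative map to the Grothendieck ring. -/
def liftInt {B : Type w} [Ring B] [Algebra R B] (f : A →ₙ+* Subalgebra.center R B) :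
    GrothendieckRing A →+ Subalgebra.center R B := GrothendieckRing.lift (f : A →+ _)

theorem liftInt_of {B : Type w} [Ring B] [Algebra R B] (f : A →ₙ+* Subalgebra.center R B) (a : A) :
    liftInt f (GrothendieckRing.of a) = f a := GrothendieckRing.lift_of _ a

theorem liftCenter_tmul {B : Type w} [Ring B] [Algebra R B] (f : A →ₙ+* Subalgebra.center R B)
    (r : R) (a : GrothendieckRing A) : liftCenter f (tmul r a) = r • liftInt f a :=
  lift_tmul f r a

end GrothendieckAlgebra

variable {p : ℕ} [Fact p.Prime] (hS : IsPGroup p S) (hF : F.IsSaturated p)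

-- If `e = [X] - [Y]` has constant mark `n`, then the `S`-set of `X` has the same marks as the
-- `S`-set of `Y` together with `n` fixed points, and a fixed point gives the identity.
include hS hF in
theorem lift_classHom_eq {n : ℕ} {e : GrothendieckRing (BurnsideClass F)}
    (he : ∀ P, GrothendieckRing.mark P e = n) :
    GrothendieckAlgebra.liftInt (classHom R hS hF) e = (n : R) • 1 := by
  induction e using GrothendieckRing.ind with
  | h a b =>
  induction a using BurnsideClass.ind with
  | h X =>
  induction b using BurnsideClass.ind with
  | h Y =>
  rw [map_sub, GrothendieckAlgebra.liftInt_of, GrothendieckAlgebra.liftInt_of, sub_eq_iff_eq_add]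
  refine Subtype.ext ?_
  -- A set of `n` points with trivial action, written as copies of `S / S` so that the action and
  -- the universe come for free.
  let Z : Type u := Σ _ : ULift.{u} (Fin n), S ⧸ (⊤ : Subgroup S)
  have : Subsingleton (S ⧸ (⊤ : Subgroup S)) := QuotientGroup.subsingleton_quotient_top
  let : Unique (S ⧸ (⊤ : Subgroup S)) := Unique.mk' _
  have hZ : gamma R F Z = (n : R) • 1 := by
    rw [gamma_sigma, Finset.sum_congr rfl fun i _ => gamma_unique R F (S ⧸ (⊤ : Subgroup S))]
    simp [Nat.cast_smul_eq_nsmul]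
  change gamma R F (coprodSet X) = (n : R) • 1 + gamma R F (coprodSet Y)
  rw [← hZ, ← gamma_sum]
  refine gamma_eq_of_marks R F fun P => ?_
  have h := he P
  rw [map_sub, GrothendieckRing.mark_of, GrothendieckRing.mark_of, sub_eq_iff_eq_add] at h
  have hfix : fixCard (K := P.grp) P.grp Z = n := by
    have e : {x : Z // ∀ k : P.grp, (k : S) ∈ P.grp → k • x = x} ≃ Z :=
      Equiv.subtypeUnivEquiv fun x k _ => Sigma.ext rfl (heq_of_eq (Subsingleton.elim _ _))
    refine (Nat.card_congr e).trans ?_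
    simp [Z]
  rw [fixCard_sum, hfix, fixCard_coprodSet hS hF, fixCard_coprodSet hS hF]
  rw [BurnsideClass.mark_mk, BurnsideClass.mark_mk] at h
  exact_mod_cast h

-- With `e` of constant mark `n`, the elements `e b` and `n b` have equal marks and so coincide. As
-- `p` does not divide `n`, it is invertible in `R`, and `n⁻¹ ⊗ e` is the identity.
include hS hF in
theorem exists_identity (hR : IsPLocal p R) :
    ∃ e : BurnsideRing R F, IsIdentity e ∧ burnsideHom R hS hF e = 1 := by
  obtain ⟨n, hn, e, he⟩ := GrothendieckRing.exists_const_mark hS hF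
  obtain ⟨u, hu⟩ := hR.isUnit hn
  have h1 : ∀ b, e * b = n • b := fun b => GrothendieckRing.mark_injective fun P => by
    rw [GrothendieckRing.mark_mul hS hF, he, map_nsmul, nsmul_eq_mul]
  have h2 : ∀ b, b * e = n • b := fun b => GrothendieckRing.mark_injective fun P => by
    rw [GrothendieckRing.mark_mul hS hF, he, map_nsmul, nsmul_eq_mul, mul_comm]
  have h3 : ∀ (r : R) (b : GrothendieckRing (BurnsideClass F)),
      GrothendieckAlgebra.tmul (↑u⁻¹ * r) (n • b) = GrothendieckAlgebra.tmul r b := fun r b => by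
    rw [GrothendieckAlgebra.tmul_nsmul, ← hu, ← mul_assoc, Units.mul_inv, one_mul]
  refine ⟨GrothendieckAlgebra.tmul ↑u⁻¹ e, fun b => ⟨?_, ?_⟩, ?_⟩
  · induction b using GrothendieckAlgebra.induction_tmul with
    | h0 r b => rw [GrothendieckAlgebra.tmul_mul_tmul, h1, h3]
    | h1 x y hx hy => rw [mul_add, hx, hy]
  · induction b using GrothendieckAlgebra.induction_tmul with
    | h0 r b => rw [GrothendieckAlgebra.tmul_mul_tmul, h2, mul_comm r, h3]
    | h1 x y hx hy => rw [add_mul, hx, hy]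
  · refine (GrothendieckAlgebra.liftCenter_tmul (classHom R hS hF) _ e).trans ?_
    rw [lift_classHom_eq R hS hF he, smul_smul, ← hu, Units.inv_mul, one_smul]

/-! ### The action on centric Mackey functors -/

-- An `F`-isomorphism `K → L` yields a `G`-isomorphism from `j(K)` to `j(L)`. So the centralizer of
-- `j(L)` in `T` lies in `j(L)`, and injectivity of `j` brings this back to `S`.
omit [Finite S] in
theorem FusionSystem.IsContained.isCentric {T : Type w} [Group T] {G : FusionSystem T} {j : S →* T}
    (h : F.IsContained G j) {K : Subgroup S} (hK : G.IsCentric (K.map j)) : F.IsCentric K := by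
  rintro L ⟨e, he⟩
  obtain ⟨ψ, hψ, hψe⟩ := h.2 K L _ he
  have himg : image ψ = L.map j := by
    refine le_antisymm (FusionSystem.image_le ψ) ?_
    rintro _ ⟨y, hy, rfl⟩
    refine ⟨⟨j (e.symm ⟨y, hy⟩), Subgroup.mem_map_of_mem j (e.symm ⟨y, hy⟩).2⟩, ?_⟩
    refine (hψe _).trans ?_
    simp
  have hL := hK (image ψ) ⟨_, G.toImage_mem hψ⟩
  rw [himg] at hL
  intro s hs
  have : j s ∈ L.map j := hL (by
    rw [Subgroup.mem_centralizer_iff] at hs ⊢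
    rintro _ ⟨y, hy, rfl⟩
    rw [← map_mul, ← map_mul, hs y hy])
  obtain ⟨y, hy, e⟩ := this
  exact h.1 e ▸ hy

section

variable (M : Type w) [AddCommGroup M] [Module (MackeyAlgebra R F) M]
  (hM : ∀ K : Subgroup S, ¬ F.IsCentric K → ∀ m : M, MackeyAlgebra.idem R F K • m = 0)

/-- The action of `μ(F) / I` on a centric Mackey functor. -/
def centricAction : CentricMackeyAlgebra R F →+* AddMonoid.End M :=
  Ideal.Quotient.lift _ (Module.toAddMonoidEnd (MackeyAlgebra R F) M) fun a ha => by
    have hle : MackeyAlgebra.noncentricIdeal R F ≤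
        TwoSidedIdeal.ker (Module.toAddMonoidEnd (MackeyAlgebra R F) M) := by
      refine TwoSidedIdeal.span_le.2 ?_
      rintro _ ⟨K, hK, rfl⟩
      exact (TwoSidedIdeal.mem_ker _).2 (AddMonoidHom.ext fun m => hM K hK m)
    exact (TwoSidedIdeal.mem_ker _).1 (hle (TwoSidedIdeal.mem_asIdeal.1 ha))

variable [Module R M] [IsScalarTower R (MackeyAlgebra R F) M]

theorem centricAction_smul (r : R) (z : CentricMackeyAlgebra R F) (m : M) :
    centricAction R M hM (r • z) m = r • centricAction R M hM z m := by
  obtain ⟨a, rfl⟩ := Ideal.Quotient.mk_surjective z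
  exact smul_assoc r a m

/-- The action of the center of `μ(F) / I` by endomorphisms of a centric Mackey functor. -/
def centerAction : Subalgebra.center R (CentricMackeyAlgebra R F) →ₙₐ[R]
    Module.End (MackeyAlgebra R F) M where
  toFun z :=
    { toFun := centricAction R M hM z
      map_add' := map_add _
      map_smul' := fun a m => by
        have h := Subalgebra.mem_center_iff.1 z.2 (Ideal.Quotient.mk _ a)
        have h' := congrArg (fun t => centricAction R M hM t m) h
        simp only [map_mul] at h'
        exact h'.symm }
  map_zero' := LinearMap.ext fun m => DFunLike.congr_fun (map_zero (centricAction R M hM)) m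
  map_add' z z' := LinearMap.ext fun m =>
    DFunLike.congr_fun (map_add (centricAction R M hM) z.1 z'.1) m
  map_mul' z z' := LinearMap.ext fun m =>
    DFunLike.congr_fun (map_mul (centricAction R M hM) z.1 z'.1) m
  map_smul' r z := LinearMap.ext fun m => centricAction_smul R M hM r z.1 m

theorem centerAction_one : centerAction R M hM 1 = 1 :=
  LinearMap.ext fun m => DFunLike.congr_fun (map_one (centricAction R M hM)) m

include hS hF in
theorem centerAction_burnsideHom (H : F.Centric) (m : M) :
    centerAction R M hM (burnsideHom R hS hF (BurnsideRing.cls R H.toAddExt)) m =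
      thetaDown R F H.grp M (thetaUp R F H.grp M m) := by
  rw [thetaDown_thetaUp]
  change centricAction R M hM (burnsideHom R hS hF (BurnsideRing.cls R H.toAddExt)).1 m = _
  rw [burnsideHom_eq_mk]
  rfl

end

theorem isIdentity_unique {B : Type v} [Mul B] {e e' : B} (h : IsIdentity e)
    (h' : IsIdentity e') : e = e' := (h' e).2.symm.trans (h e').1

end

section

/-! ### Stabilizers in bisets -/

variable {S : Type u} [Group S]

namespace Biset

variable {A B C : Subgroup S}

/-- The group of all `a ∈ A` with `a x = x b` for some `b ∈ B`. -/
def leftStab (X : Biset A B) (x : X.carrier) : Subgroup S where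
  carrier := {s | ∃ (hs : s ∈ A) (b : B), (⟨s, hs⟩ : A) • x = MulOpposite.op b • x}
  one_mem' := ⟨one_mem A, 1, by rw [MulOpposite.op_one, one_smul]; exact one_smul A x⟩
  mul_mem' := by
    rintro s t ⟨hs, b, h1⟩ ⟨ht, c, h2⟩
    refine ⟨mul_mem hs ht, b * c, ?_⟩
    have : (⟨s * t, mul_mem hs ht⟩ : A) = ⟨s, hs⟩ * ⟨t, ht⟩ := rfl
    rw [this, mul_smul, h2, smul_comm, h1, MulOpposite.op_mul, mul_smul]
  inv_mem' := by
    rintro s ⟨hs, b, h⟩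
    refine ⟨inv_mem hs, b⁻¹, ?_⟩
    have : (⟨s⁻¹, inv_mem hs⟩ : A) = ⟨s, hs⟩⁻¹ := rfl
    rw [this, inv_smul_eq_iff, smul_comm, h, MulOpposite.op_inv, inv_smul_smul]

theorem mem_leftStab {X : Biset A B} {x : X.carrier} {s : S} : s ∈ leftStab X x ↔
    ∃ (hs : s ∈ A) (b : B), (⟨s, hs⟩ : A) • x = MulOpposite.op b • x := Iff.rfl

theorem leftStab_op_smul (X : Biset A B) (x : X.carrier) (b : B) :
    leftStab X (MulOpposite.op b • x) = leftStab X x := by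
  ext s
  rw [mem_leftStab, mem_leftStab]
  refine exists_congr fun hs => ⟨fun ⟨c, h⟩ => ⟨b * c * b⁻¹, ?_⟩, fun ⟨c, h⟩ => ⟨b⁻¹ * c * b, ?_⟩⟩
  · rw [smul_comm, ← eq_inv_smul_iff] at h
    rw [h, ← MulOpposite.op_inv, smul_smul, smul_smul, ← MulOpposite.op_mul, ← MulOpposite.op_mul,
      mul_assoc]
  · rw [smul_comm, h, smul_smul, smul_smul, ← MulOpposite.op_mul, ← MulOpposite.op_mul]
    congr 2
    group

theorem leftStab_smul (X : Biset A B) (x : X.carrier) (a : A) :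
    leftStab X (a • x) = FusionSystem.conjBy (leftStab X x) (a : S)⁻¹ := by
  ext s
  rw [FusionSystem.mem_conjBy, mem_leftStab, mem_leftStab]
  constructor
  · rintro ⟨hs, b, h⟩
    refine ⟨mul_mem (mul_mem (inv_mem a.2) hs) (inv_mem (inv_mem a.2)), b, ?_⟩
    have : (⟨(a : S)⁻¹ * s * (a : S)⁻¹⁻¹, mul_mem (mul_mem (inv_mem a.2) hs)
      (inv_mem (inv_mem a.2))⟩ : A) = a⁻¹ * ⟨s, hs⟩ * a⁻¹⁻¹ := rfl
    rw [this, inv_inv, mul_smul, mul_smul, h, smul_comm, inv_smul_smul]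
  · rintro ⟨hs, b, h⟩
    have hs' : s ∈ A := by
      have := mul_mem (mul_mem a.2 hs) (inv_mem a.2)
      convert this using 1
      group
    refine ⟨hs', b, ?_⟩
    have : (⟨s, hs'⟩ : A) * a = a * ⟨(a : S)⁻¹ * s * (a : S)⁻¹⁻¹, hs⟩ := by
      ext; simp [← mul_assoc]
    rw [smul_smul, this, mul_smul, h, smul_comm]

/-- The orbits of the two commuting actions on a biset. -/
def orbitSetoid (X : Biset A B) : Setoid X.carrier where
  r x y := ∃ (a : A) (b : B), y = a • MulOpposite.op b • x
  iseqv :=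
    { refl := fun x => ⟨1, 1, by rw [MulOpposite.op_one, one_smul, one_smul]⟩
      symm := by
        rintro x _ ⟨a, b, rfl⟩
        refine ⟨a⁻¹, b⁻¹, ?_⟩
        rw [smul_comm, inv_smul_smul, MulOpposite.op_inv, inv_smul_smul]
      trans := by
        rintro x _ _ ⟨a, b, rfl⟩ ⟨a', b', rfl⟩
        refine ⟨a' * a, b * b', ?_⟩
        rw [← smul_comm a (MulOpposite.op b'), smul_smul, smul_smul, MulOpposite.op_mul] }

end Biset

namespace FusionSystem

variable (F : FusionSystem S)

theorem conj_conjBy (P : Subgroup S) (s : S) : F.Conj P (conjBy P s) := by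
  have h := (F.isMor_conj s⁻¹ P).conj_im
  convert h using 1
  ext x
  rw [mem_conjBy, (F.isMor_conj s⁻¹ P).mem_im]
  constructor
  · intro hx
    exact ⟨_, hx, by group⟩
  · rintro ⟨y, hy, rfl⟩
    convert hy using 1
    group

open Classical in
/-- The class of a centric subgroup; zero for a subgroup that is not centric. -/
def groupClass (P : Subgroup S) : BurnsideClass F :=
  if h : F.IsCentric P then BurnsideClass.mk (Centric.toAddExt ⟨P, h⟩) else 0

variable {F}

theorem groupClass_grp (P : F.Centric) : F.groupClass P.grp = BurnsideClass.mk P.toAddExt :=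
  dif_pos P.isCentric

theorem groupClass_eq_zero {P : Subgroup S} (h : ¬ F.IsCentric P) : F.groupClass P = 0 := dif_neg h

theorem groupClass_congr {P Q : Subgroup S} (h : F.Conj P Q) :
    F.groupClass P = F.groupClass Q := by
  by_cases hP : F.IsCentric P
  · have hQ := hP.of_conj h
    rw [groupClass_grp ⟨P, hP⟩, groupClass_grp ⟨Q, hQ⟩]
    obtain ⟨e⟩ := Centric.nonempty_iso (H := ⟨P, hP⟩) (K := ⟨Q, hQ⟩) h
    exact BurnsideClass.sound (AddExt.iso_of_components (Equiv.refl _) fun _ => ⟨e⟩)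
  · rw [groupClass_eq_zero hP, groupClass_eq_zero fun hQ => hP (hQ.of_conj h.symm)]

end FusionSystem

namespace Biset

variable {A B C : Subgroup S} (F : FusionSystem S)

/-- The class of the stabilizer of an orbit. -/
def orbitClass (X : Biset A B) : Quotient (orbitSetoid X) → BurnsideClass F :=
  Quotient.lift (fun x => F.groupClass (leftStab X x)) (by
    rintro x _ ⟨a, b, rfl⟩
    rw [leftStab_smul, leftStab_op_smul]
    exact FusionSystem.groupClass_congr (F.conj_conjBy _ _))

instance (X : Biset A B) : Fintype (Quotient (orbitSetoid X)) := Fintype.ofFinite _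

/-- The sum of the classes of the stabilizers of all orbits. -/
def stabSum (X : Biset A B) : BurnsideClass F := ∑ o, orbitClass F X o

theorem leftStab_map {X Y : Biset A B} (e : X.carrier → Y.carrier) (he : Function.Injective e)
    (h1 : ∀ (a : A) x, e (a • x) = a • e x) (h2 : ∀ (b : Bᵐᵒᵖ) x, e (b • x) = b • e x)
    (x : X.carrier) : leftStab Y (e x) = leftStab X x := by
  ext s
  refine exists_congr fun hs => exists_congr fun b => ?_
  rw [← h1, ← h2, he.eq_iff]

theorem stabSum_congr {X Y : Biset A B} (h : Iso X Y) : stabSum F X = stabSum F Y := by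
  obtain ⟨e, h1, h2⟩ := h
  refine Fintype.sum_equiv (Quotient.congr e fun x y => ?_) _ _ ?_
  · refine exists_congr fun a => exists_congr fun b => ?_
    rw [← h2, ← h1, e.apply_eq_iff_eq]
  · refine Quotient.ind fun x => ?_
    exact congrArg F.groupClass (leftStab_map e e.injective h1 h2 x).symm

theorem stabSum_empty : stabSum F (empty A B) = 0 :=
  Finset.sum_eq_zero fun o _ => Quotient.ind
    (motive := fun o => orbitClass F (empty A B) o = 0) (fun x => PEmpty.elim x) o

theorem stabSum_sum (X Y : Biset A B) : stabSum F (sum X Y) = stabSum F X + stabSum F Y := by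
  have inl : ∀ (x : X.carrier), leftStab (sum X Y) (Sum.inl x) = leftStab X x :=
    leftStab_map (X := X) (Y := sum X Y) Sum.inl Sum.inl_injective (fun _ _ => rfl) fun _ _ => rfl
  have inr : ∀ (y : Y.carrier), leftStab (sum X Y) (Sum.inr y) = leftStab Y y :=
    leftStab_map (X := Y) (Y := sum X Y) Sum.inr Sum.inr_injective (fun _ _ => rfl) fun _ _ => rfl
  let e : Quotient (orbitSetoid X) ⊕ Quotient (orbitSetoid Y) ≃
      Quotient (orbitSetoid (sum X Y)) :=
    { toFun := Sum.elim
        (Quotient.map' (s₂ := orbitSetoid (sum X Y)) Sum.inl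
          (by rintro x _ ⟨a, b, rfl⟩; exact ⟨a, b, rfl⟩))
        (Quotient.map' (s₂ := orbitSetoid (sum X Y)) Sum.inr
          (by rintro x _ ⟨a, b, rfl⟩; exact ⟨a, b, rfl⟩))
      invFun := Quotient.lift (s := orbitSetoid (sum X Y))
        (Sum.elim (fun x => Sum.inl (Quotient.mk _ x)) (fun x => Sum.inr (Quotient.mk _ x))) (by
          rintro (x | x) _ ⟨a, b, rfl⟩
          · exact congrArg Sum.inl (Quotient.sound ⟨a, b, rfl⟩)
          · exact congrArg Sum.inr (Quotient.sound ⟨a, b, rfl⟩))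
      left_inv := by
        rintro (o | o)
        · induction o using Quotient.ind; rfl
        · induction o using Quotient.ind; rfl
      right_inv := Quotient.ind (by rintro (x | x) <;> rfl) }
  unfold stabSum
  rw [← e.sum_comp, Fintype.sum_sum_type]
  congr 1
  · refine Finset.sum_congr rfl fun o _ => ?_
    induction o using Quotient.ind with
    | _ x => exact congrArg F.groupClass (inl x)
  · refine Finset.sum_congr rfl fun o _ => ?_
    induction o using Quotient.ind with
    | _ x => exact congrArg F.groupClass (inr x)

theorem stabSum_eq_zero {X : Biset A B} (h : ∀ x, ¬ F.IsCentric (leftStab X x)) :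
    stabSum F X = 0 :=
  Finset.sum_eq_zero fun o _ => Quotient.ind (motive := fun o => orbitClass F X o = 0)
    (fun x => FusionSystem.groupClass_eq_zero (h x)) o

section transitive

variable [Finite S]

theorem mem_leftStab_transitive {D : Subgroup (A × B)} {a : A} {b : B} {s : S} :
    s ∈ leftStab (transitive D) (transitive.mk D (a, b)) ↔
      ∃ (hs : s ∈ A) (c : B), (a⁻¹ * ⟨s, hs⟩ * a, c) ∈ D := by
  rw [mem_leftStab]
  refine exists_congr fun hs => ?_
  simp only [transitive.smul_mk, transitive.op_smul_mk]
  constructor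
  · rintro ⟨c, h⟩
    have := transitive.mk_eq.1 h.symm
    refine ⟨_, (?_ : (a⁻¹ * ⟨s, hs⟩ * a, ((c⁻¹ * b)⁻¹ * b : B)) ∈ D)⟩
    convert this using 1
    exact Prod.ext (mul_assoc _ _ _) rfl
  · rintro ⟨c, h⟩
    refine ⟨b * c * b⁻¹, (transitive.mk_eq.2 ?_).symm⟩
    convert h using 1
    refine Prod.ext (mul_assoc _ _ _).symm ?_
    change ((b * c * b⁻¹)⁻¹ * b)⁻¹ * b = c
    group

/-- The biset of the coset set `K / P` has a single orbit, with stabilizer `P` at the base point: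
stabilizers recover `[P]` from its image in the Mackey algebra. -/
theorem stabSum_transitive_inclusion {P K : Subgroup S} (h : P ≤ K) :
    stabSum F (transitive ((Subgroup.inclusion h).prod (Subgroup.inclusion h)).range) =
      F.groupClass P := by
  set D := ((Subgroup.inclusion h).prod (Subgroup.inclusion h)).range
  have hst : leftStab (transitive D) (transitive.mk D (1, 1)) = P := by
    ext s
    rw [mem_leftStab_transitive]
    constructor
    · rintro ⟨hs, c, x, hx⟩
      have : (x : S) = 1⁻¹ * s * 1 := congrArg (fun t : K × K => (t.1 : S)) hx
      have e : (x : S) = s := by rw [this]; simp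
      exact e ▸ x.2
    · intro hs
      refine ⟨h hs, ⟨s, h hs⟩, ⟨s, hs⟩, ?_⟩
      refine Prod.ext (Subtype.ext ?_) rfl
      change s = (1 : S)⁻¹ * s * 1
      simp
  let : Unique (Quotient (orbitSetoid (transitive D))) :=
    ⟨⟨Quotient.mk _ (transitive.mk D (1, 1))⟩, Quotient.ind (transitive.ind fun a b =>
      (Quotient.sound ⟨a, b⁻¹, by
        rw [transitive.op_smul_mk, transitive.smul_mk]
        simp⟩ : Quotient.mk (orbitSetoid (transitive D)) (transitive.mk D (1, 1)) = _).symm)⟩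
  refine (Fintype.sum_unique _).trans ?_
  exact congrArg F.groupClass hst

end transitive

/-! ### Bisets whose stabilizers are graphs of morphisms -/

/-- The right action is free, and every stabilizer acts on the right through a morphism of the
fusion system. -/
def IsGood (X : Biset A B) : Prop := ∀ x : X.carrier,
  (∀ b : B, MulOpposite.op b • x = x → b = 1) ∧
    ∃ f : S → S, F.IsMor (leftStab X x) f ∧ ∀ (s : S) (hs : s ∈ A), s ∈ leftStab X x →
      ∃ hb : f s ∈ B, (⟨s, hs⟩ : A) • x = MulOpposite.op (⟨f s, hb⟩ : B) • x

variable {F}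

theorem IsGood.sum {X Y : Biset A B} (hX : IsGood F X) (hY : IsGood F Y) :
    IsGood F (Biset.sum X Y) := by
  rintro (x | x)
  · have h := leftStab_map (X := X) (Y := Biset.sum X Y) Sum.inl Sum.inl_injective
      (fun _ _ => rfl) (fun _ _ => rfl) x
    obtain ⟨h1, f, h2, h3⟩ := hX x
    refine ⟨fun b hb => h1 b (Sum.inl_injective hb), f, h ▸ h2, fun s hs hs' => ?_⟩
    obtain ⟨hb, e⟩ := h3 s hs (h ▸ hs')
    exact ⟨hb, congrArg Sum.inl e⟩
  · have h := leftStab_map (X := Y) (Y := Biset.sum X Y) Sum.inr Sum.inr_injective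
      (fun _ _ => rfl) (fun _ _ => rfl) x
    obtain ⟨h1, f, h2, h3⟩ := hY x
    refine ⟨fun b hb => h1 b (Sum.inr_injective hb), f, h ▸ h2, fun s hs hs' => ?_⟩
    obtain ⟨hb, e⟩ := h3 s hs (h ▸ hs')
    exact ⟨hb, congrArg Sum.inr e⟩

theorem comp.mk_eq {X : Biset A B} {Y : Biset B C} {x x' : X.carrier} {y y' : Y.carrier} :
    comp.mk X Y x y = comp.mk X Y x' y' ↔ ∃ b : B, x = MulOpposite.op b • x' ∧ y' = b • y :=
  Quotient.eq (r := compSetoid X Y)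

theorem exists_of_mem_leftStab_comp {X : Biset A B} {Y : Biset B C} {x : X.carrier}
    {y : Y.carrier} {s : S} (h : s ∈ leftStab (comp X Y) (comp.mk X Y x y)) :
    ∃ (hs : s ∈ A) (b : B) (c : C), (⟨s, hs⟩ : A) • x = MulOpposite.op b • x ∧
      b • y = MulOpposite.op c • y := by
  obtain ⟨hs, c, e⟩ := h
  rw [comp.smul_mk, comp.op_smul_mk, comp.mk_eq] at e
  obtain ⟨b, h1, h2⟩ := e
  exact ⟨hs, b, c, h1, h2.symm⟩

theorem leftStab_comp_le {X : Biset A B} {Y : Biset B C} (x : X.carrier) (y : Y.carrier) :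
    leftStab (comp X Y) (comp.mk X Y x y) ≤ leftStab X x := fun s h => by
  obtain ⟨hs, b, -, h1, -⟩ := exists_of_mem_leftStab_comp h
  exact ⟨hs, b, h1⟩

/-- If `s` stabilizes the class of `(x, y)` through `b ∈ B`, then freeness of the action on `X`
forces `b = f(s)`. Hence `f` maps the stabilizer of `(x, y)` into that of `y`, and the stabilizer
acts through `g ∘ f`. -/
theorem IsGood.comp {X : Biset A B} {Y : Biset B C} (hX : IsGood F X) (hY : IsGood F Y) :
    IsGood F (Biset.comp X Y) := by
  refine comp.ind fun x y => ?_
  obtain ⟨h1, f, h2, h3⟩ := hX x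
  obtain ⟨h4, g, h5, h6⟩ := hY y
  refine ⟨fun c hc => ?_, fun s => g (f s), ?_, ?_⟩
  · rw [comp.op_smul_mk, comp.mk_eq] at hc
    obtain ⟨b, e, e'⟩ := hc
    rw [h1 b e.symm, one_smul] at e'
    exact h4 c e'.symm
  all_goals
    have key : ∀ s (h : s ∈ leftStab (Biset.comp X Y) (comp.mk X Y x y)), f s ∈ leftStab Y y := by
      intro s h
      obtain ⟨hs, b, c, e, e'⟩ := exists_of_mem_leftStab_comp h
      obtain ⟨hb, e2⟩ := h3 s hs ⟨hs, b, e⟩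
      have : b = ⟨f s, hb⟩ := by
        rw [e, ← inv_smul_eq_iff, smul_smul, ← MulOpposite.op_inv, ← MulOpposite.op_mul] at e2
        rw [← mul_inv_eq_one]
        exact h1 _ e2
      exact ⟨hb, c, this ▸ e'⟩
  · exact (h2.mono (leftStab_comp_le x y)).comp h5 key
  · intro s hs h
    obtain ⟨hb, e⟩ := h3 s hs (leftStab_comp_le x y h)
    obtain ⟨hc, e'⟩ := h6 (f s) hb (key s h)
    refine ⟨hc, ?_⟩
    rw [comp.smul_mk, comp.op_smul_mk, e, comp.mk_smul, e']

/-- The stabilizer of a point of the composite is mapped into `B` by a morphism of `F`; were it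
centric, `B` would be centric as well. -/
theorem IsGood.stabSum_comp_eq_zero {X : Biset A B} (hX : IsGood F X) (Y : Biset B C)
    (hB : ¬ F.IsCentric B) : stabSum F (Biset.comp X Y) = 0 := by
  refine stabSum_eq_zero F (comp.ind fun x y hc => hB ?_)
  obtain ⟨-, f, h2, h3⟩ := hX x
  refine (hc.mono (leftStab_comp_le x y)).of_mor h2 fun s hs => ?_
  obtain ⟨hs', -⟩ := id hs
  exact (h3 s hs' hs).1

theorem isGood_regular [Finite A] : IsGood F (regular A) := by
  intro (x : A)
  refine ⟨fun b (hb : x * b = x) => mul_eq_left.1 hb, fun s => (x : S)⁻¹ * s * (x : S)⁻¹⁻¹,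
    F.isMor_conj _ _, fun s hs _ => ⟨mul_mem (mul_mem (inv_mem x.2) hs) (inv_mem (inv_mem x.2)), ?_⟩⟩
  refine Subtype.ext ?_
  change s * x = x * ((x : S)⁻¹ * s * (x : S)⁻¹⁻¹)
  group

theorem isGood_empty : IsGood F (empty A B) := fun x => PEmpty.elim x

/-- The stabilizer of `(a, b)` is `a f(C) a⁻¹`, acting through `s ↦ b g(f⁻¹(a⁻¹ s a)) b⁻¹`.
Injectivity of `f` gives freeness on the right. -/
theorem isGood_transitive [Finite S] {f : C →* A} {g : C →* B} (hf : f ∈ F.Hom C A)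
    (hg : g ∈ F.Hom C B) : IsGood F (transitive (f.prod g).range) := by
  refine transitive.ind fun a b => ⟨fun c hc => ?_, ?_⟩
  · rw [transitive.op_smul_mk, transitive.mk_eq] at hc
    obtain ⟨d, hd⟩ := hc
    have h1 : f d = a⁻¹ * a := congrArg Prod.fst hd
    have h2 : g d = (c⁻¹ * b)⁻¹ * b := congrArg Prod.snd hd
    rw [inv_mul_cancel] at h1
    have hd1 : d = 1 := F.injective hf (h1.trans (map_one f).symm)
    rw [hd1, map_one, eq_comm, inv_mul_eq_one] at h2
    simpa using h2
  · have hf' := FusionSystem.isMor_extendFun hf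
    have hg' := FusionSystem.isMor_extendFun hg
    obtain ⟨r, hr, hr1, hr2, hr3⟩ := hf'.exists_inv
    have key : ∀ s, s ∈ leftStab (transitive (f.prod g).range) (transitive.mk _ (a, b)) →
        ∃ (hs : s ∈ A) (c : C), f c = a⁻¹ * ⟨s, hs⟩ * a := fun s h => by
      obtain ⟨hs, x, c, hc⟩ := mem_leftStab_transitive.1 h
      exact ⟨hs, c, congrArg Prod.fst hc⟩
    have key2 : ∀ s (hs : s ∈ A) (c : C), f c = a⁻¹ * ⟨s, hs⟩ * a →
        (a : S)⁻¹ * s * (a : S)⁻¹⁻¹ = FusionSystem.extendFun f (c : S) := fun s hs c hc => by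
      rw [FusionSystem.extendFun_coe, hc, inv_inv]
      rfl
    refine ⟨fun s => (b : S) * FusionSystem.extendFun g (r ((a : S)⁻¹ * s * (a : S)⁻¹⁻¹)) *
      (b : S)⁻¹, ?_, ?_⟩
    · refine (((F.isMor_conj (a : S)⁻¹ _).comp hr ?_).comp hg' ?_).comp (F.isMor_conj (b : S) ⊤)
        fun _ _ => Subgroup.mem_top _
      · intro s h
        obtain ⟨hs, c, hc⟩ := key s h
        rw [key2 s hs c hc]
        exact hf'.mem_im_of_mem c.2
      · intro s h
        obtain ⟨hs, c, hc⟩ := key s h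
        rw [key2 s hs c hc]
        exact hr2 _ (hf'.mem_im_of_mem c.2)
    · intro s hs h
      obtain ⟨_, c, hc⟩ := key s h
      have e : (b : S) * FusionSystem.extendFun g (r ((a : S)⁻¹ * s * (a : S)⁻¹⁻¹)) * (b : S)⁻¹ =
          ((b * g c * b⁻¹ : B) : S) := by
        rw [key2 s hs c hc, hr1 c c.2, FusionSystem.extendFun_coe]
        rfl
      refine ⟨Eq.mpr (congrArg (· ∈ B) e) (b * g c * b⁻¹ : B).2, ?_⟩
      have e' : (⟨(b : S) * FusionSystem.extendFun g (r ((a : S)⁻¹ * s * (a : S)⁻¹⁻¹)) * (b : S)⁻¹,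
        Eq.mpr (congrArg (· ∈ B) e) (b * g c * b⁻¹ : B).2⟩ : B) = b * g c * b⁻¹ := Subtype.ext e
      dsimp only
      rw [e', transitive.smul_mk, transitive.op_smul_mk, eq_comm, transitive.mk_eq]
      refine ⟨c, Prod.ext ?_ ?_⟩
      · exact hc.trans (mul_assoc _ _ _)
      · change g c = ((b * g c * b⁻¹)⁻¹ * b)⁻¹ * b
        group

end Biset

end

section

/-! ### Injectivity -/

namespace GrothendieckAlgebra

variable {R : Type v} [CommRing R] {A : Type u} {B : Type w} [NonUnitalNonAssocSemiring A]
  [NonUnitalNonAssocSemiring B]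

variable (R) in
/-- The linear extension of an additive map. -/
def map (f : A →+ B) : GrothendieckAlgebra R A →ₗ[R] GrothendieckAlgebra R B :=
  LinearMap.baseChange R (GrothendieckRing.lift (GrothendieckRing.of.comp f)).toIntLinearMap

theorem map_of (f : A →+ B) (a : A) : map R f (of R a) = of R (f a) :=
  congrArg (fun t : GrothendieckRing B => (1 : R) ⊗ₜ[ℤ] t) (GrothendieckRing.lift_of _ a)

variable (R) in
/-- The class of an element, as an additive map. -/
def ofAddHom (A : Type u) [NonUnitalNonAssocSemiring A] : A →+ GrothendieckAlgebra R A where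
  toFun := of R
  map_zero' := by unfold of; rw [map_zero, TensorProduct.tmul_zero]; rfl
  map_add' := of_add

theorem of_sum {ι : Type x} (s : Finset ι) (a : ι → A) :
    of R (∑ i ∈ s, a i) = ∑ i ∈ s, of R (a i) := _root_.map_sum (ofAddHom R A) a s

theorem mul_smul' (r : R) (a b : GrothendieckAlgebra R A) : a * r • b = r • (a * b) :=
  mul_smul_comm (α := R) (β := R ⊗[ℤ] GrothendieckRing A) r a b

theorem smul_mul' (r : R) (a b : GrothendieckAlgebra R A) : r • a * b = r • (a * b) :=
  smul_mul_assoc (α := R) (β := R ⊗[ℤ] GrothendieckRing A) r a b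

end GrothendieckAlgebra

/-! ### The map from the Mackey algebra back to the Burnside ring -/

variable {S : Type u} [Group S] [Finite S] (R : Type v) [CommRing R] (F : FusionSystem S)

/-- The sum of the classes of the stabilizers, as an additive map. -/
def stabHom (A B : Subgroup S) : BisetClass A B →+ BurnsideClass F where
  toFun := Quotient.lift (Biset.stabSum F) fun _ _ h => Biset.stabSum_congr F h
  map_zero' := Biset.stabSum_empty F
  map_add' := by rintro ⟨X⟩ ⟨Y⟩; exact Biset.stabSum_sum F X Y

/-- The class contains a biset whose stabilizers are graphs of morphisms. -/
def IsGoodClass {A B : Subgroup S} (a : BisetClass A B) : Prop :=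
  ∃ X : Biset A B, Biset.IsGood F X ∧ BisetClass.mk X = a

variable {F}

omit [Finite S] in
theorem isGoodClass_zero {A B : Subgroup S} : IsGoodClass F (0 : BisetClass A B) :=
  ⟨_, Biset.isGood_empty, rfl⟩

omit [Finite S] in
theorem IsGoodClass.add {A B : Subgroup S} {a b : BisetClass A B} (ha : IsGoodClass F a)
    (hb : IsGoodClass F b) : IsGoodClass F (a + b) := by
  obtain ⟨X, hX, rfl⟩ := ha
  obtain ⟨Y, hY, rfl⟩ := hb
  exact ⟨_, hX.sum hY, rfl⟩

theorem isGoodClass_single {C L A : Subgroup S} {f : C →* L} {g : C →* A} (hf : f ∈ F.Hom C L)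
    (hg : g ∈ F.Hom C A) (L' A' : Subgroup S) :
    IsGoodClass F (BisetSums.single L A (diagClass f g) L' A') := by
  by_cases hL : L' = L
  swap
  · rw [BisetSums.single_of_ne_left hL]; exact isGoodClass_zero
  by_cases hA : A' = A
  swap
  · rw [BisetSums.single_of_ne_right hA]; exact isGoodClass_zero
  subst hL hA
  rw [BisetSums.single_same]
  exact ⟨_, Biset.isGood_transitive hf hg, rfl⟩

/-- The generators are transitive bisets given by pairs of morphisms of `F`, and good bisets are
closed under disjoint union and composition. This is where it matters that the Mackey algebra
contains only bisets generated from `F`. -/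
theorem isGoodClass_of_mem {a : BisetSums S} (ha : a ∈ genSubsemiring F) :
    ∀ A B, IsGoodClass F (a A B) := by
  induction ha using Subsemiring.closure_induction with
  | mem a ha =>
    obtain (@⟨H, K, hHK⟩ | @⟨H, K, hHK⟩ | @⟨H, K, φ, hφ⟩) := ha
    · exact isGoodClass_single (F.id_mem _) (F.inclusion_mem hHK)
    · exact isGoodClass_single (F.inclusion_mem hHK) (F.id_mem _)
    · exact isGoodClass_single hφ (F.id_mem _)
  | zero => exact fun A B => isGoodClass_zero
  | one =>
    intro A B
    change IsGoodClass F (BisetSums.one A B)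
    by_cases h : A = B
    · subst h
      rw [BisetSums.one_self]
      exact ⟨_, Biset.isGood_regular, rfl⟩
    · rw [BisetSums.one_ne h]
      exact isGoodClass_zero
  | add a b _ _ ha hb => exact fun A B => (ha A B).add (hb A B)
  | mul a b _ _ ha hb =>
    intro A B
    rw [BisetSums.mul_apply]
    refine Finset.sum_induction _ (IsGoodClass F) (fun _ _ => IsGoodClass.add) isGoodClass_zero
      fun J _ => ?_
    obtain ⟨X, hX, e⟩ := ha A J
    obtain ⟨Y, hY, e'⟩ := hb J B
    rw [← e, ← e']
    exact ⟨_, hX.comp hY, rfl⟩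

variable (F) in
/-- The sum of the classes of the stabilizers in the component at a subgroup `K`. -/
def stabAt (K : Subgroup S) : genSubsemiring F →+ BurnsideClass F where
  toFun a := stabHom F K K (a.1 K K)
  map_zero' := map_zero (stabHom F K K)
  map_add' a b := map_add (stabHom F K K) (a.1 K K) (b.1 K K)

/-- The component at `(K, K)` is a composite through the non-centric group `L`, so it has no centric
stabilizers. -/
theorem stabAt_mul_idem_mul (K : Subgroup S) {L : Subgroup S} (hL : ¬ F.IsCentric L)
    (a b : genSubsemiring F) :
    stabAt F K (a * ⟨indGen (le_refl L), Subsemiring.subset_closure (IsGen.ind _)⟩ * b) = 0 := by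
  have h : (a.1 * indGen (le_refl L) * b.1) K K = BisetClass.comp (a.1 K L) (b.1 L K) := by
    rw [indGen_refl, BisetSums.mul_apply, Finset.sum_eq_single_of_mem L (BisetSums.mem_subgroups L),
      BisetSums.mul_apply, Finset.sum_eq_single_of_mem L (BisetSums.mem_subgroups L),
      BisetSums.single_same, BisetClass.comp_one]
    · intro J _ hJ
      rw [BisetSums.single_of_ne_left hJ, map_zero]
    · intro J _ hJ
      rw [BisetSums.mul_apply, Finset.sum_eq_zero, map_zero]
      · rfl
      · intro J' _
        rw [BisetSums.single_of_ne_right hJ, map_zero]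
  change stabHom F K K ((a.1 * indGen (le_refl L) * b.1) K K) = 0
  obtain ⟨X, hX, e⟩ := isGoodClass_of_mem a.2 K L
  obtain ⟨Y, hY, e'⟩ := isGoodClass_of_mem b.2 L K
  rw [h, ← e, ← e']
  exact hX.stabSum_comp_eq_zero Y hL

variable (F) in
theorem map_stabAt_eq_zero (K : Subgroup S) {z : MackeyAlgebra R F}
    (hz : z ∈ (MackeyAlgebra.noncentricIdeal R F).asIdeal) :
    GrothendieckAlgebra.map R (stabAt F K) z = 0 := by
  have h := TwoSidedIdeal.mem_span_iff_mem_addSubgroup_closure.1 (TwoSidedIdeal.mem_asIdeal.1 hz)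
  refine (AddSubgroup.closure_le
    (K := (GrothendieckAlgebra.map R (stabAt F K)).toAddMonoidHom.ker)).2 ?_ h
  rintro _ ⟨_, ⟨a, -, _, ⟨L, hL, rfl⟩, rfl⟩, b, -, rfl⟩
  change GrothendieckAlgebra.map R (stabAt F K) (a * MackeyAlgebra.idem R F L * b) = 0
  induction a using GrothendieckAlgebra.induction with
  | h1 x y hx hy => rw [add_mul, add_mul, map_add, hx, hy, add_zero]
  | h2 r x hx => rw [GrothendieckAlgebra.smul_mul', GrothendieckAlgebra.smul_mul', map_smul, hx, smul_zero]
  | h0 a =>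
    induction b using GrothendieckAlgebra.induction with
    | h1 x y hx hy => rw [mul_add, map_add, hx, hy, add_zero]
    | h2 r x hx => rw [GrothendieckAlgebra.mul_smul', map_smul, hx, smul_zero]
    | h0 b =>
      have h := congrArg (GrothendieckAlgebra.ofAddHom R (BurnsideClass F))
        (stabAt_mul_idem_mul K hL a b)
      rw [map_zero] at h
      refine Eq.trans ?_ h
      refine Eq.trans ?_ (GrothendieckAlgebra.map_of (R := R) (stabAt F K) _)
      rw [GrothendieckAlgebra.of_mul, GrothendieckAlgebra.of_mul]
      rfl

variable (F) in
/-- The map from `μ(F) / I` to the Burnside ring given by the stabilizers at a subgroup `K`. -/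
def stabBar (K : Subgroup S) : CentricMackeyAlgebra R F →+ BurnsideRing R F :=
  QuotientAddGroup.lift (MackeyAlgebra.noncentricIdeal R F).asIdeal.toAddSubgroup
    (GrothendieckAlgebra.map R (stabAt F K)).toAddMonoidHom fun _ hz => map_stabAt_eq_zero R F K hz

theorem stabBar_mk (K : Subgroup S) (z : MackeyAlgebra R F) :
    stabBar R F K (Ideal.Quotient.mk _ z) = GrothendieckAlgebra.map R (stabAt F K) z := rfl

theorem stabBar_smul (K : Subgroup S) (r : R) (z : CentricMackeyAlgebra R F) :
    stabBar R F K (r • z) = r • stabBar R F K z := by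
  obtain ⟨z, rfl⟩ := Ideal.Quotient.mk_surjective z
  exact map_smul (GrothendieckAlgebra.map R (stabAt F K)) r z

theorem stabAt_setElem {P K : Subgroup S} (h : P ≤ K) :
    stabAt F K (setElem F K (K ⧸ P.subgroupOf K)) = F.groupClass P := by
  change stabHom F K K (BisetSums.single K K (BisetClass.cls K (K ⧸ P.subgroupOf K)) K K) = _
  rw [BisetSums.single_same, cls_quotient h]
  exact Biset.stabSum_transitive_inclusion F h

theorem stabAt_setElem_of_ne {K L : Subgroup S} (h : K ≠ L) (X : Type u) [MulAction L X] [Finite X] :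
    stabAt F K (setElem F L X) = 0 := by
  change stabHom F K K (BisetSums.single L L (BisetClass.cls L X) K K) = 0
  rw [BisetSums.single_of_ne_left h, map_zero]

variable {p : ℕ} [Fact p.Prime] (hS : IsPGroup p S) (hF : F.IsSaturated p)

include hS hF

/-- At `P` both sides have mark `|Hom(P, H)| |Hom(P, K)|`, because the components of the product
represent pairs of morphisms and `φ(A)` is isomorphic to `A`. The equality is stated in the
Grothendieck group, where marks separate elements. -/
theorem of_sum_groupClass (H K : F.Centric) :
    GrothendieckRing.of (∑ q : F.ProdIndex H.grp K.grp, F.groupClass q.image) =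
      GrothendieckRing.of (BurnsideClass.mk K.toAddExt * BurnsideClass.mk H.toAddExt) := by
  refine GrothendieckRing.mark_injective fun P => ?_
  rw [GrothendieckRing.mark_of, GrothendieckRing.mark_of, BurnsideClass.mark_mul hS hF, map_sum,
    BurnsideClass.mark_mk, BurnsideClass.mark_mk, AddExt.mark_toAddExt, AddExt.mark_toAddExt,
    mul_comm]
  congr 1
  have h : ∀ q : F.ProdIndex H.grp K.grp, BurnsideClass.mark P (F.groupClass q.image) =
      Nat.card (F.OrbitHom P.grp q.rep.A) := fun q => by
    have hc : F.Conj q.rep.A q.image := ⟨_, F.toImage_mem q.rep.hom.rep_mem⟩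
    rw [← FusionSystem.groupClass_congr hc,
      FusionSystem.groupClass_grp (F := F) ⟨q.rep.A, q.rep.isCentric⟩, BurnsideClass.mark_mk,
      AddExt.mark_toAddExt]
    rfl
  rw [Finset.sum_congr rfl fun q _ => h q, ← Nat.card_sigma]
  exact (Nat.card_congr (Equiv.ofBijective _ (hF.prodMap_bijective hS P.isCentric))).trans
    (Nat.card_prod _ _)

/-- Only the component at `K` of `Γ([H])` is seen. It consists of the coset sets `K / φ(A)` over `[H
× K]`, whose stabilizers add up to `[K][H]`; the general case follows by linearity. -/
theorem stabBar_burnsideHom (K : F.Centric) (b : BurnsideRing R F) :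
    stabBar R F K.grp (burnsideHom R hS hF b).1 = BurnsideRing.cls R K.toAddExt * b := by
  have hcls : ∀ H : F.Centric, stabBar R F K.grp (burnsideHom R hS hF
      (BurnsideRing.cls R H.toAddExt)).1 =
        BurnsideRing.cls R K.toAddExt * BurnsideRing.cls R H.toAddExt := fun H => by
    unfold BurnsideRing.cls
    rw [← GrothendieckAlgebra.of_mul]
    refine Eq.trans ?_ (congrArg (fun t => (1 : R) ⊗ₜ[ℤ] t) (of_sum_groupClass hS hF H K))
    change _ = GrothendieckAlgebra.of R (∑ q : F.ProdIndex H.grp K.grp, F.groupClass q.image)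
    refine (congrArg (stabBar R F K.grp) (burnsideHom_eq_mk R hS hF H)).trans ?_
    rw [stabBar_mk, map_sum, Finset.sum_eq_single_of_mem K (Finset.mem_univ K), map_sum,
      GrothendieckAlgebra.of_sum]
    · refine Finset.sum_congr rfl fun q _ => ?_
      rw [GrothendieckAlgebra.map_of, stabAt_setElem]
      exact FusionSystem.image_le _
    · intro L _ hL
      rw [map_sum]
      refine Finset.sum_eq_zero fun q _ => ?_
      rw [GrothendieckAlgebra.map_of, stabAt_setElem_of_ne fun h =>
        hL (FusionSystem.Centric.grp_injective F h.symm)]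
      exact map_zero (GrothendieckAlgebra.ofAddHom R (BurnsideClass F))
  induction b using GrothendieckAlgebra.induction with
  | h0 a =>
    induction a using BurnsideClass.ind with
    | h X =>
      have := X.property
      have := Fintype.ofFinite X.obj.I
      rw [BurnsideClass.mk_eq_sum X, GrothendieckAlgebra.of_sum, map_sum, Finset.mul_sum,
        AddSubmonoidClass.coe_finsetSum, map_sum]
      exact Finset.sum_congr rfl fun i _ => hcls _
  | h1 x y hx hy => rw [mul_add, ← hx, ← hy, map_add]; exact map_add (stabBar R F K.grp) _ _
  | h2 r x hx => rw [GrothendieckAlgebra.mul_smul', ← hx, map_smul, ← stabBar_smul]; rfl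

/-- An element of the kernel is annihilated by every `[K]`, hence by all linear combinations of
these, in particular by `ω`. -/
theorem burnsideHom_injective
    (h : ∃ ω : BurnsideRing R F, ∀ b : BurnsideRing R F, ω * b = 0 → b = 0) :
    Function.Injective (burnsideHom R hS hF) := by
  obtain ⟨ω, hω⟩ := h
  rw [injective_iff_map_eq_zero]
  intro b hb
  have hK : ∀ K : F.Centric, BurnsideRing.cls R K.toAddExt * b = 0 := fun K => by
    rw [← stabBar_burnsideHom R hS hF, hb]
    exact map_zero (stabBar R F K.grp)
  refine hω b ?_
  clear hω
  induction ω using GrothendieckAlgebra.induction with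
  | h0 a =>
    induction a using BurnsideClass.ind with
    | h X =>
      have := X.property
      have := Fintype.ofFinite X.obj.I
      rw [BurnsideClass.mk_eq_sum X, GrothendieckAlgebra.of_sum, Finset.sum_mul]
      exact Finset.sum_eq_zero fun i _ => hK _
  | h1 x y hx hy => rw [add_mul, hx, hy, add_zero]
  | h2 r x hx => rw [GrothendieckAlgebra.smul_mul', hx, smul_zero]

/-- The multiplication was defined by biadditive extension from single subgroups; comparison of
marks shows that it is given by the categorical product for all objects. -/
theorem cls_mul_cls [Limits.HasBinaryProducts F.AddExt] (X Y : F.AddExt) :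
    BurnsideRing.cls R X * BurnsideRing.cls R Y = BurnsideRing.cls R (X ⨯ Y) := by
  unfold BurnsideRing.cls
  rw [← GrothendieckAlgebra.of_mul]
  refine congrArg (fun t => (1 : R) ⊗ₜ[ℤ] t) (GrothendieckRing.mark_injective fun P => ?_)
  rw [GrothendieckRing.mark_of, GrothendieckRing.mark_of, BurnsideClass.mark_mul hS hF,
    BurnsideClass.sound (AddExt.nonempty_prod_iso hS hF X Y), BurnsideClass.mark_mk,
    BurnsideClass.mark_mk, BurnsideClass.mark_mk, AddExt.mark_prodObj hS hF]

end

end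

end CentricMackey

/-! ### The main theorem -/

theorem mainTheorem4 (p : ℕ) [Fact p.Prime] (S : Type u) [Group S] [Finite S] (hS : IsPGroup p S)
    (F : FusionSystem S) (hF : F.IsSaturated p) (R : Type v) [CommRing R] :
    (∃ _ : Limits.HasBinaryProducts F.AddExt, ∀ X Y : F.AddExt,
      BurnsideRing.cls R X * BurnsideRing.cls R Y = BurnsideRing.cls R (X ⨯ Y)) ∧
    (∃ Γ : BurnsideRing R F →ₙₐ[R] Subalgebra.center R (CentricMackeyAlgebra R F),
      (∀ H : F.Centric, (Γ (BurnsideRing.cls R H.toAddExt) : CentricMackeyAlgebra R F) =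
        thetaDown R F H.grp (CentricMackeyAlgebra R F)
          (thetaUp R F H.grp (CentricMackeyAlgebra R F) 1)) ∧
      ((∃ ω : BurnsideRing R F, ∀ b : BurnsideRing R F, ω * b = 0 → b = 0) →
        Function.Injective Γ) ∧
      (IsPLocal p R → ∃ e : BurnsideRing R F, IsIdentity e ∧ Γ e = 1)) ∧
    (IsPLocal p R →
      ∀ (T : Type w) [Group T] [Finite T] (_ : IsPGroup p T) (G : FusionSystem T)
        (_ : G.IsSaturated p) (j : S →* T) (_ : F.IsContained G j)
        (M : Type x) [AddCommGroup M] [Module (MackeyAlgebra R F) M] [Module R M]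
        [IsScalarTower R (MackeyAlgebra R F) M] [Module.Finite (MackeyAlgebra R F) M],
        IsCentricModule R F G j M →
        ∃ act : BurnsideRing R F →ₙₐ[R] Module.End (MackeyAlgebra R F) M,
          (∀ (H : F.Centric) (m : M), act (BurnsideRing.cls R H.toAddExt) m =
            thetaDown R F H.grp M (thetaUp R F H.grp M m)) ∧
          ∀ e : BurnsideRing R F, IsIdentity e → act e = 1) := by
  refine ⟨⟨AddExt.hasBinaryProducts hS hF, fun X Y => ?_⟩,
    ⟨burnsideHom R hS hF, burnsideHom_eq_theta R hS hF, burnsideHom_injective R hS hF,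
      exists_identity R hS hF⟩, ?_⟩
  · have := AddExt.hasBinaryProducts hS hF
    exact cls_mul_cls R hS hF X Y
  · intro hR T _ _ _ G _ j hj M _ _ _ _ _ hM
    -- A subgroup that is not `F`-centric is not `G`-centric either, so the ideal acts as zero on
    -- `M`.
    have hM' : ∀ K : Subgroup S, ¬ F.IsCentric K → ∀ m : M, MackeyAlgebra.idem R F K • m = 0 :=
      fun K hK => hM K fun h => hK (hj.isCentric h)
    refine ⟨(centerAction R M hM').comp (burnsideHom R hS hF),
      centerAction_burnsideHom R hS hF M hM', fun e he => ?_⟩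
    obtain ⟨e', he', h1⟩ := exists_identity R hS hF hR
    -- The action of an arbitrary identity element is known because there is only one, namely the
    -- one constructed from constant marks.
    rw [isIdentity_unique he he']
    exact (congrArg (centerAction R M hM') h1).trans (centerAction_one R M hM')
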